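/- Let $\gamma>0$ be fixed. For $N\ge 2$ let $H$ be an $N\times N$ GUE matrix, i.e. a random Hermitian matrix with density proportional to $e^{-\frac N2\operatorname{Tr}H^2}$ with respect to Lebesgue measure on its real degrees of freedom, let $J=H+i\gamma\,\mathrm{diag}(1,0,\dots,0)$, and let $X_j+iY_j$, $j=1,\dots,N$, be the eigenvalues of $J$ counted with multiplicity. Then the mean density of imaginary parts $\rho_N(Y)=\big\langle\frac1N\sum_{j=1}^N\delta(Y-Y_j)\big\rangle$ exists as a continuous nonnegative function on $(0,\gamma)$: for every Borel set $B\subseteq\mathbb R$ the expected number of $j$ with $Y_j\in B$ equals $N\int_{B\cap(0,\gamma)}\rho_N(Y)\,dY$. Put, for $0\le Y<\gamma$ (and $Y>0$ in $\Psi_\gamma$), $$r_*(Y)=\frac{\sqrt{Y^2+4}-Y}{2},\qquad \Phi_\gamma(Y)=Y(\gamma-Y)-\ln\frac{\gamma-Y}{\gamma}-Yr_*(Y)+2\ln r_*(Y),$$ $$\Psi_\gamma(Y)=\frac1{\sqrt{2\pi}}\,\frac{\gamma}{(\gamma-Y)^2}\,\frac{(1-r_*(Y)(\gamma-Y))^2}{Y^{3/2}(Y^2+4)^{1/4}},$$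 and, for $\gamma>1$, $Y_*=\gamma-\gamma^{-1}$ and $Y_{**}=\dfrac{2(\gamma-\gamma^{-1})}{3+\sqrt{1+8\gamma^{-2}}}$. (a) Let $0<\varepsilon\le1$ and $y>0$ be fixed, with $y<\gamma$ if $\varepsilon=1$, and set $Y=Y_N=yN^{-(1-\varepsilon)}$. Then, as $N\to\infty$, $$\rho_N(Y)=\frac1{\sqrt N}\big(\Psi_\gamma(Y)+o(Y^{-3/2})\big)e^{-N\Phi_\gamma(Y)}.$$ Moreover $$\rho_N(Y)\sim\frac1{\sqrt N}\,\Psi_\gamma(Y)\,e^{-N\Phi_\gamma(Y)}$$ (the ratio of the two sides tends to $1$), except possibly in two degenerate cases: $\gamma=1$ and $\varepsilon\le\frac23$; or $\gamma>1$, $\varepsilon=1$ and $y=Y_{**}$, where $\Psi_\gamma(y)=0$. (b) $\Phi_\gamma$ is smooth and nonnegative on $[0,\gamma)$, and $\Phi_\gamma(0)=0$. If $\gamma\le1$, then $\Phi_\gamma$ is strictly increasing on $[0,\gamma)$. If $\gamma>1$, then $0<Y_{**}<Y_*<\gamma$, and $\Phi_\gamma$ has exactly two local extrema in $(0,\gamma)$: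 a local minimum at $Y_*$, where $\Phi_\gamma(Y_*)=0$, and a local maximum at $Y_{**}$. -/

import Mathlib

open MeasureTheory Filter Asymptotics Set
open scoped ENNReal Topology

noncomputable section

/-- The `N × N` Hermitian matrix with real coordinates `x`: the diagonal entries are `x i i`, and for
`i < j` the `(i, j)` entry is `x i j + x j i * I`. -/
def hermitianOf {N : ℕ} (x : Fin N → Fin N → ℝ) : Matrix (Fin N) (Fin N) ℂ :=
  Matrix.of fun i j =>
    if i = j then (x i i : ℂ)
    else if i < j then (x i j : ℂ) + (x j i : ℂ) * Complex.I
    else (x j i : ℂ) - (x i j : ℂ) * Complex.I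

/-- The unnormalised GUE weight `exp (-(N/2) Tr H²)` at the Hermitian matrix `H` with coordinates
`x`. -/
def gueWeight (N : ℕ) (x : Fin N → Fin N → ℝ) : ℝ≥0∞ :=
  ENNReal.ofReal
    (Real.exp (-((N : ℝ) / 2) * ((hermitianOf x * hermitianOf x).trace).re))

/-- The GUE law, in the coordinates of `hermitianOf`: the probability measure whose density with
respect to Lebesgue measure is `const * exp (-(N/2) Tr H²)`. -/
def gue (N : ℕ) : Measure (Fin N → Fin N → ℝ) :=
  (∫⁻ x, gueWeight N x)⁻¹ • (volume : Measure (Fin N → Fin N → ℝ)).withDensity (gueWeight N)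

/-- The matrix `J = H + i γ diag(1, 0, …, 0)`. -/
def deformedGUE {N : ℕ} (γ : ℝ) (x : Fin N → Fin N → ℝ) : Matrix (Fin N) (Fin N) ℂ :=
  hermitianOf x +
    Complex.I • Matrix.diagonal fun i : Fin N => if (i : ℕ) = 0 then (γ : ℂ) else 0

open Classical in
/-- The number of eigenvalues of `M`, counted with algebraic multiplicity, whose imaginary part lies
in `B`. -/
def countIm {N : ℕ} (M : Matrix (Fin N) (Fin N) ℂ) (B : Set ℝ) : ℕ :=
  M.charpoly.roots.countP fun z => z.im ∈ B

/-- The GUE expectation of the number of eigenvalues of `J` with imaginary part in `B`. -/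
def meanCountIm (N : ℕ) (γ : ℝ) (B : Set ℝ) : ℝ≥0∞ :=
  ∫⁻ x, (countIm (deformedGUE γ x) B : ℝ≥0∞) ∂(gue N)

/-- `ρ` is the mean density of imaginary parts `⟨N⁻¹ ∑ⱼ δ(Y - Yⱼ)⟩` on `(0, γ)`: it is continuous and
nonnegative there, and the expected number of eigenvalues with imaginary part in a Borel set `B` is
`N` times the integral of `ρ` over `B ∩ (0, γ)`. (In particular almost surely no imaginary part lies
outside `(0, γ)`.) Continuity makes the values of `ρ` at the points of `(0, γ)` unique. -/
structure IsMeanDensityIm (N : ℕ) (γ : ℝ) (ρ : ℝ → ℝ) : Prop where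
  continuousOn : ContinuousOn ρ (Ioo 0 γ)
  nonneg : ∀ Y ∈ Ioo 0 γ, 0 ≤ ρ Y
  meanCount_eq : ∀ B : Set ℝ, MeasurableSet B →
    meanCountIm N γ B = N * ∫⁻ Y in B ∩ Ioo 0 γ, ENNReal.ofReal (ρ Y)

/-- `r_*(Y)` -/
def rStar (Y : ℝ) : ℝ := (√(Y ^ 2 + 4) - Y) / 2

/-- The rate function `Φ_γ`. -/
def rateΦ (γ Y : ℝ) : ℝ :=
  Y * (γ - Y) - Real.log ((γ - Y) / γ) - Y * rStar Y + 2 * Real.log (rStar Y)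

/-- The prefactor `Ψ_γ`. -/
def prefactorΨ (γ Y : ℝ) : ℝ :=
  1 / √(2 * Real.pi) * (γ / (γ - Y) ^ 2) *
    ((1 - rStar Y * (γ - Y)) ^ 2 / (Y ^ (3 / 2 : ℝ) * (Y ^ 2 + 4) ^ (1 / 4 : ℝ)))

/-- `Y_* = γ - γ⁻¹` -/
def yMin (γ : ℝ) : ℝ := γ - γ⁻¹

/-- `Y_** = 2 (γ - γ⁻¹) / (3 + √(1 + 8 γ⁻²))` -/
def yMax (γ : ℝ) : ℝ := 2 * (γ - γ⁻¹) / (3 + √(1 + 8 * (γ⁻¹) ^ 2))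

/-- The height `Y = y N^{-(1-ε)}`. -/
def scaledY (ε y : ℝ) (N : ℕ) : ℝ := y * (N : ℝ) ^ (-(1 - ε))

end

/-! For every N ≥ 2 the density is computed exactly; its closed form `densityIm` is then analysed.
Write r for r_*(Y) and g = γ − Y.

Exact density. View H as a first row and column (a, v) bordering a Hermitian block x of size N − 1.
Almost surely no eigenvector of H has vanishing first coordinate (`ae_not_hasSmallEigenvector`), so
every eigenvector of J can be normalised to (1, w). The eigenvalue equation is then solved for the
border: v = zw − xw, and reality of a forces Im z = γ/(1 + |w|²). The eigenvalues of J thus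
correspond to the preimages of (x, a, v) under a smooth map `eigenMap`: (x, Re z, w) ↦ (x, a, v)
between spaces of equal dimension. The area formula with multiplicity converts the expected count
into an integral of Jacobian times Gaussian weight. The Jacobian is |det(A + w w* A*)|²/(1 + |w|²)
with A = z − x (`det_fderiv_eigenMap`).

Unitary invariance reduces to w = s e₀, where a rescaling of the border of x turns the integrand
into the GUE weight of size N − 1 times |det(z − H) − iδ det(z − H')|², H' being the first minor
(`det_eigMatrix_single`, `jacWeight_single`), while Re z becomes Gaussian. Rotating the border onto
e₀ shows that the pair of determinants is a Markov chain in the size (`charLaw_succ`). Its second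
moments obey a linear recursion solved by Hermite kernels (`hasSecondMoments_charLaw`), and
averaging over Re z yields the Laguerre sums `lagMass` at NY² (`hermiteMoment_eq`). The substitution
|w|² = γ/Y − 1 gives `meanCountIm_eq`.

Asymptotics. `lagMass N x` is the mass of an ultra-log-concave weight on {0, …, N − 1}. The
logarithmic derivative in Y of the mass at x = NY² is 2μ/Y, with μ the mean of the weight. Summation
by parts gives exact equations for μ and the variance, and Poisson-type moment bounds close them, so
μ is known up to O((NY)^(-1/2)) (`abs_lagMu_sub_le`). Integrating inwards from Y = ∞, where only the
top coefficient and Stirling's formula matter, gives the mass with its constant, uniformly as NY → ∞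
(`tendsto_lagLogRatio`). The remaining Laguerre sums in the density are expressed through the same
mass and mean, so the density is the claimed exponential times (1 − rg)² + O(1/(NY))
(`densityIm_eq`). The little-o statement follows, and the ratio tends to one whenever NY(1 − rg)² →
∞; this excludes only the two degenerate cases.

Rate function. Since Y = 1/r − r, the derivative of Φ is (g − r)(gr − 1)/(gr). The two factors are
decreasing in Y and vanish at Y_* and Y_** respectively when γ > 1, and both are negative when γ ≤
1. -/

noncomputable section

/-! ### Monotonicity and extrema of the rate function. -/

section RateFunction

lemma sqrt_sq_add_four_pos (Y : ℝ) : 0 < √(Y ^ 2 + 4) := by positivity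

lemma sq_sqrt_sq_add_four (Y : ℝ) : √(Y ^ 2 + 4) ^ 2 = Y ^ 2 + 4 :=
  Real.sq_sqrt (by positivity)

lemma abs_lt_sqrt_sq_add_four (Y : ℝ) : |Y| < √(Y ^ 2 + 4) := by
  rw [← Real.sqrt_sq_eq_abs]
  exact Real.sqrt_lt_sqrt (by positivity) (by linarith)

lemma rStar_pos (Y : ℝ) : 0 < rStar Y := by
  have := abs_lt_sqrt_sq_add_four Y
  have := le_abs_self Y
  unfold rStar
  linarith

lemma rStar_sq (Y : ℝ) : rStar Y ^ 2 = 1 - Y * rStar Y := by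
  have := sq_sqrt_sq_add_four Y
  unfold rStar
  linarith [this]

lemma sqrt_eq_rStar (Y : ℝ) : √(Y ^ 2 + 4) = 2 * rStar Y + Y := by
  unfold rStar
  ring

lemma rStar_zero : rStar 0 = 1 := by
  have : √(4 : ℝ) = 2 := by
    rw [show (4 : ℝ) = 2 ^ 2 by norm_num]; exact Real.sqrt_sq (by norm_num)
  simp [rStar, this]

lemma rStar_le_one {Y : ℝ} (hY : 0 ≤ Y) : rStar Y ≤ 1 := by
  have := rStar_sq Y
  have h := rStar_pos Y
  nlinarith [mul_nonneg hY h.le]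

lemma hasDerivAt_sqrt_sq_add_four (Y : ℝ) :
    HasDerivAt (fun Y : ℝ => √(Y ^ 2 + 4)) (Y / √(Y ^ 2 + 4)) Y := by
  have h : HasDerivAt (fun Y : ℝ => Y ^ 2 + 4) (2 * Y) Y := by
    simpa using (hasDerivAt_pow 2 Y).add_const 4
  convert h.sqrt (by positivity) using 1
  have := sqrt_sq_add_four_pos Y
  field_simp

lemma hasDerivAt_rStar (Y : ℝ) :
    HasDerivAt rStar (-rStar Y / √(Y ^ 2 + 4)) Y := by
  have := ((hasDerivAt_sqrt_sq_add_four Y).sub (hasDerivAt_id Y)).div_const 2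
  refine this.congr_deriv ?_
  have := sqrt_sq_add_four_pos Y
  unfold rStar
  field_simp
  ring

/-- This function is the exponential growth rate of `lagMass N (N * Y ^ 2)`. Its derivative is clean
because 2 − Y r_* = 1 + r_*² = r_* √(Y² + 4). -/
lemma hasDerivAt_mul_rStar_sub_log (Y : ℝ) :
    HasDerivAt (fun Y => Y * rStar Y - 2 * Real.log (rStar Y)) (2 * rStar Y) Y := by
  have h := ((hasDerivAt_id Y).mul (hasDerivAt_rStar Y)).sub
    (((hasDerivAt_rStar Y).log (rStar_pos Y).ne').const_mul 2)
  refine h.congr_deriv ?_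
  have h1 := sqrt_sq_add_four_pos Y
  have h2 := rStar_pos Y
  have h3 := sqrt_eq_rStar Y
  simp only [id]
  field_simp
  rw [h3]
  linear_combination -2 * rStar_sq Y

/-- With g = γ − Y and Y = 1/r_* − r_*, the derivative g − Y + 1/g − 2r_* equals g + 1/g − r_* −
1/r_*, which vanishes exactly when g = r_* or g r_* = 1. The factored form displays these critical
points. -/
lemma hasDerivAt_rateΦ {γ Y : ℝ} (hγ : 0 < γ) (hY : Y < γ) :
    HasDerivAt (rateΦ γ)
      ((γ - Y - rStar Y) * (rStar Y * (γ - Y) - 1) / ((γ - Y) * rStar Y)) Y := by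
  have hg : 0 < γ - Y := by linarith
  have h1 : HasDerivAt (fun Y => γ - Y) (-1) Y := by
    simpa using (hasDerivAt_id Y).const_sub γ
  have h2 := (h1.div_const γ).log (by positivity)
  have h3 := (((hasDerivAt_id Y).mul h1).sub h2).sub (hasDerivAt_mul_rStar_sub_log Y)
  have h4 : rateΦ γ = fun Y => id Y * (γ - Y) - Real.log ((γ - Y) / γ) -
      (Y * rStar Y - 2 * Real.log (rStar Y)) := by
    funext Y; simp only [rateΦ, id]; ring
  rw [h4]
  refine h3.congr_deriv ?_
  have h2 := rStar_pos Y
  have h5 := rStar_sq Y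
  simp only [id]
  field_simp
  linear_combination (-(γ - Y)) * h5

lemma contDiff_rStar {n : WithTop ℕ∞} : ContDiff ℝ n rStar := by
  unfold rStar
  refine ContDiff.div_const (ContDiff.sub (ContDiff.sqrt (by fun_prop) ?_) contDiff_id) 2
  intro x; positivity

lemma contDiffAt_rateΦ {γ Y : ℝ} (hγ : 0 < γ) (hY : Y < γ) {n : WithTop ℕ∞} :
    ContDiffAt ℝ n (rateΦ γ) Y := by
  have hr : ContDiffAt ℝ n rStar Y := contDiff_rStar.contDiffAt
  have hg : 0 < γ - Y := by linarith
  unfold rateΦ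
  have h1 : ContDiffAt ℝ n (fun Y : ℝ => γ - Y) Y := by fun_prop
  have h2 : ContDiffAt ℝ n (fun Y : ℝ => Real.log ((γ - Y) / γ)) Y :=
    (h1.div_const γ).log (by positivity)
  have h3 : ContDiffAt ℝ n (fun Y : ℝ => Real.log (rStar Y)) Y := hr.log (rStar_pos Y).ne'
  exact ((((contDiffAt_id.mul h1).sub h2).sub (contDiffAt_id.mul hr)).add
    (contDiffAt_const.mul h3))

lemma rateΦ_zero {γ : ℝ} (hγ : 0 < γ) : rateΦ γ 0 = 0 := by
  simp [rateΦ, rStar_zero, hγ.ne']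

lemma continuousOn_rateΦ {γ : ℝ} (hγ : 0 < γ) : ContinuousOn (rateΦ γ) (Ico 0 γ) :=
  fun _ hY => (hasDerivAt_rateΦ hγ hY.2).continuousAt.continuousWithinAt

lemma one_lt_rStar_add {Y : ℝ} (hY : 0 < Y) : 1 < rStar Y + Y := by
  have := rStar_sq Y
  have h := rStar_pos Y
  nlinarith

lemma rStar_lt_one {Y : ℝ} (hY : 0 < Y) : rStar Y < 1 := by
  have := rStar_sq Y
  have h := rStar_pos Y
  nlinarith [mul_pos hY h]

/-- For γ ≤ 1 the inequalities r_* < 1 < r_* + Y make both numerator factors of the derivative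
negative. -/
lemma strictMonoOn_rateΦ {γ : ℝ} (hγ : 0 < γ) (hγ1 : γ ≤ 1) :
    StrictMonoOn (rateΦ γ) (Ico 0 γ) := by
  refine strictMonoOn_of_deriv_pos (convex_Ico 0 γ) (continuousOn_rateΦ hγ) fun Y hY => ?_
  rw [interior_Ico] at hY
  rw [(hasDerivAt_rateΦ hγ hY.2).deriv]
  have h1 := one_lt_rStar_add hY.1
  have h2 := rStar_lt_one hY.1
  have h3 := rStar_pos Y
  have h4 : 0 < γ - Y := sub_pos.2 hY.2
  refine div_pos (mul_pos_of_neg_of_neg (by linarith) ?_) (by positivity)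
  nlinarith [hY.1]

lemma yMax_pos {γ : ℝ} (hγ : 1 < γ) : 0 < yMax γ := by
  have : γ⁻¹ < 1 := inv_lt_one_of_one_lt₀ hγ
  unfold yMax
  have : 0 < γ - γ⁻¹ := by linarith
  positivity

lemma yMin_lt {γ : ℝ} (hγ : 1 < γ) : yMin γ < γ := by
  have : 0 < γ⁻¹ := by positivity
  unfold yMin; linarith

lemma yMax_lt_yMin {γ : ℝ} (hγ : 1 < γ) : yMax γ < yMin γ := by
  have : γ⁻¹ < 1 := inv_lt_one_of_one_lt₀ hγ
  have h : 0 < γ - γ⁻¹ := by linarith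
  have h2 : 0 ≤ √(1 + 8 * γ⁻¹ ^ 2) := Real.sqrt_nonneg _
  unfold yMax yMin
  rw [div_lt_iff₀ (by positivity)]
  nlinarith

/-- The two roots of t² + Yt − 1 have product −1, so only one of them is positive. -/
lemma rStar_eq_of_quadratic {Y q : ℝ} (hq : 0 < q) (h : q ^ 2 = 1 - Y * q) : rStar Y = q := by
  have h1 := rStar_sq Y
  have h2 := rStar_pos Y
  have h3 : (rStar Y - q) * (rStar Y + q + Y) = 0 := by linear_combination h1 - h
  rcases mul_eq_zero.1 h3 with h4 | h4
  · linarith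
  · exfalso
    have : rStar Y * q = -1 := by nlinarith
    nlinarith [mul_pos h2 hq]

lemma rStar_yMin {γ : ℝ} (hγ : 1 < γ) : rStar (yMin γ) = γ⁻¹ := by
  have h0 : 0 < γ := by linarith
  refine rStar_eq_of_quadratic (by positivity) ?_
  unfold yMin; field_simp; ring

/-- Substituting r_* = 1/(γ − Y) into r_*² = 1 − Y r_* gives this quadratic; `yMax` is its smaller
root with the numerator rationalised. -/
lemma yMax_quadratic {γ : ℝ} (hγ : 1 < γ) :
    2 * yMax γ ^ 2 - 3 * γ * yMax γ + γ ^ 2 - 1 = 0 := by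
  have h0 : 0 < γ := by linarith
  have hs : √(1 + 8 * γ⁻¹ ^ 2) ^ 2 = 1 + 8 * γ⁻¹ ^ 2 := Real.sq_sqrt (by positivity)
  have h2 : 0 ≤ √(1 + 8 * γ⁻¹ ^ 2) := Real.sqrt_nonneg _
  unfold yMax
  set q := √(1 + 8 * γ⁻¹ ^ 2)
  have hq : γ ^ 2 * q ^ 2 = γ ^ 2 + 8 := by rw [hs]; field_simp
  have : 3 + q ≠ 0 := by positivity
  field_simp
  linear_combination (γ ^ 2 - 1) * hq

lemma rStar_yMax {γ : ℝ} (hγ : 1 < γ) : rStar (yMax γ) * (γ - yMax γ) = 1 := by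
  have h1 := yMax_quadratic hγ
  have h2 := yMax_lt_yMin hγ
  have h3 := yMin_lt hγ
  have h4 : 0 < γ - yMax γ := by linarith
  rw [rStar_eq_of_quadratic (q := (γ - yMax γ)⁻¹) (by positivity)]
  · field_simp
  · field_simp
    linear_combination -h1

/-- Both numerator factors of the derivative of Φ decrease strictly, this one and that of
`strictAnti_sub_rStar`. Each therefore changes sign only once, which fixes the sign of the
derivative on each of the three intervals. -/
lemma strictAnti_rStar_mul {γ : ℝ} :
    StrictAntiOn (fun Y => rStar Y * (γ - Y) - 1) (Iio γ) := by
  intro a ha b hb hab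
  have h1 := rStar_pos a
  have h2 : rStar b < rStar a := by
    refine strictAnti_of_deriv_neg (fun Y => ?_) hab
    rw [(hasDerivAt_rStar Y).deriv, neg_div]
    exact neg_neg_of_pos (div_pos (rStar_pos Y) (sqrt_sq_add_four_pos Y))
  have h3 := rStar_pos b
  simp only [mem_Iio] at ha hb
  dsimp only
  nlinarith

lemma strictAnti_sub_rStar {γ : ℝ} : StrictAnti (fun Y => γ - Y - rStar Y) := by
  refine strictAnti_of_deriv_neg fun Y => ?_
  have h : HasDerivAt (fun Y => γ - Y - rStar Y) (-1 - -rStar Y / √(Y ^ 2 + 4)) Y :=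
    (by simpa using (hasDerivAt_id Y).const_sub γ : HasDerivAt (fun Y => γ - Y) (-1) Y).sub
      (hasDerivAt_rStar Y)
  rw [h.deriv]
  have h1 := sqrt_sq_add_four_pos Y
  have h2 := rStar_pos Y
  have h3 : rStar Y / √(Y ^ 2 + 4) < 1 := by
    rw [div_lt_one h1]
    have := abs_lt_sqrt_sq_add_four Y
    have := neg_abs_le Y
    unfold rStar; linarith
  rw [neg_div]; linarith

lemma sub_rStar_yMin {γ : ℝ} (hγ : 1 < γ) : γ - yMin γ - rStar (yMin γ) = 0 := by
  rw [rStar_yMin hγ, yMin]; ring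

lemma deriv_rateΦ_pos_of_lt_yMax {γ Y : ℝ} (hγ : 1 < γ) (hY : Y < yMax γ) :
    0 < deriv (rateΦ γ) Y := by
  have hm := yMax_lt_yMin hγ
  have hm' := yMin_lt hγ
  rw [(hasDerivAt_rateΦ (by linarith) (by linarith)).deriv]
  have h1 := strictAnti_sub_rStar (γ := γ) (hY.trans hm)
  have h2 := strictAnti_rStar_mul (γ := γ) (show Y ∈ Iio γ by simp; linarith)
    (show yMax γ ∈ Iio γ by simp; linarith) hY
  have h3 := rStar_yMax hγ
  have h4 := sub_rStar_yMin hγ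
  have h5 := rStar_pos Y
  have h6 : 0 < γ - Y := by linarith
  dsimp only at h1 h2
  refine div_pos (mul_pos (by linarith) (by linarith)) (by positivity)

lemma deriv_rateΦ_neg_of_mem_Ioo {γ Y : ℝ} (hγ : 1 < γ) (hY : Y ∈ Ioo (yMax γ) (yMin γ)) :
    deriv (rateΦ γ) Y < 0 := by
  obtain ⟨hY1, hY2⟩ := hY
  have hm := yMax_lt_yMin hγ
  have hm' := yMin_lt hγ
  rw [(hasDerivAt_rateΦ (by linarith) (by linarith)).deriv]
  have h1 := strictAnti_sub_rStar (γ := γ) hY2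
  have h2 := strictAnti_rStar_mul (γ := γ) (show yMax γ ∈ Iio γ by simp; linarith)
    (show Y ∈ Iio γ by simp; linarith) hY1
  have h3 := rStar_yMax hγ
  have h4 := sub_rStar_yMin hγ
  have h5 := rStar_pos Y
  have h6 : 0 < γ - Y := by linarith
  dsimp only at h1 h2
  refine div_neg_of_neg_of_pos (mul_neg_of_pos_of_neg (by linarith) (by linarith)) (by positivity)

lemma deriv_rateΦ_pos_of_yMin_lt {γ Y : ℝ} (hγ : 1 < γ) (hY : yMin γ < Y) (hYγ : Y < γ) :
    0 < deriv (rateΦ γ) Y := by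
  have hm := yMax_lt_yMin hγ
  rw [(hasDerivAt_rateΦ (by linarith) (by linarith)).deriv]
  have h1 := strictAnti_sub_rStar (γ := γ) hY
  have h2 := strictAnti_rStar_mul (γ := γ) (show yMax γ ∈ Iio γ by simp; linarith)
    (show Y ∈ Iio γ by simp; linarith) (hm.trans hY)
  have h3 := rStar_yMax hγ
  have h4 := sub_rStar_yMin hγ
  have h5 := rStar_pos Y
  have h6 : 0 < γ - Y := by linarith
  dsimp only at h1 h2
  refine div_pos (mul_pos_of_neg_of_neg (by linarith) (by linarith)) (by positivity)

lemma rateΦ_yMin {γ : ℝ} (hγ : 1 < γ) : rateΦ γ (yMin γ) = 0 := by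
  have h0 : 0 < γ := by linarith
  rw [rateΦ, rStar_yMin hγ, yMin]
  have : (γ - (γ - γ⁻¹)) / γ = γ⁻¹ * γ⁻¹ := by field_simp; ring
  rw [this, Real.log_mul (by positivity) (by positivity)]
  ring

lemma isLocalMax_rateΦ {γ : ℝ} (hγ : 1 < γ) : IsLocalMax (rateΦ γ) (yMax γ) := by
  have hm := yMax_lt_yMin hγ
  have hm' := yMin_lt hγ
  have h0 : 0 < γ := by linarith
  refine isLocalMax_of_deriv_Ioo (a := yMax γ - 1) (c := yMin γ) (by linarith) hm
    (hasDerivAt_rateΦ h0 (by linarith)).continuousAt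
    (fun Y hY => (hasDerivAt_rateΦ h0 (by linarith [hY.2])).differentiableAt.differentiableWithinAt)
    (fun Y hY => (hasDerivAt_rateΦ h0 (by linarith [hY.2])).differentiableAt.differentiableWithinAt)
    (fun Y hY => (deriv_rateΦ_pos_of_lt_yMax hγ hY.2).le)
    (fun Y hY => (deriv_rateΦ_neg_of_mem_Ioo hγ hY).le)

lemma isLocalMin_rateΦ {γ : ℝ} (hγ : 1 < γ) : IsLocalMin (rateΦ γ) (yMin γ) := by
  have hm := yMax_lt_yMin hγ
  have hm' := yMin_lt hγ
  have h0 : 0 < γ := by linarith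
  refine isLocalMin_of_deriv_Ioo (a := yMax γ) (c := γ) hm hm'
    (hasDerivAt_rateΦ h0 (by linarith)).continuousAt
    (fun Y hY => (hasDerivAt_rateΦ h0 (by linarith [hY.2])).differentiableAt.differentiableWithinAt)
    (fun Y hY => (hasDerivAt_rateΦ h0 (by linarith [hY.2])).differentiableAt.differentiableWithinAt)
    (fun Y hY => (deriv_rateΦ_neg_of_mem_Ioo hγ hY).le)
    (fun Y hY => (deriv_rateΦ_pos_of_yMin_lt hγ hY.1 hY.2).le)

lemma eq_yMin_or_yMax_of_isLocalExtr {γ Y : ℝ} (hγ : 1 < γ) (hY : Y ∈ Ioo 0 γ)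
    (h : IsLocalExtr (rateΦ γ) Y) : Y = yMin γ ∨ Y = yMax γ := by
  have hd := h.deriv_eq_zero
  by_contra hne
  push Not at hne
  rcases lt_trichotomy Y (yMax γ) with h1 | h1 | h1
  · exact (deriv_rateΦ_pos_of_lt_yMax hγ h1).ne' hd
  · exact hne.2 h1
  · rcases lt_trichotomy Y (yMin γ) with h2 | h2 | h2
    · exact (deriv_rateΦ_neg_of_mem_Ioo hγ ⟨h1, h2⟩).ne hd
    · exact hne.1 h2
    · exact (deriv_rateΦ_pos_of_yMin_lt hγ h2 hY.2).ne' hd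

/-- For γ > 1 the graph rises from the value 0 at 0 up to `yMax`, falls to the value 0 at `yMin`,
and rises afterwards. -/
lemma rateΦ_nonneg {γ Y : ℝ} (hγ : 0 < γ) (hY : Y ∈ Ico 0 γ) : 0 ≤ rateΦ γ Y := by
  rcases le_or_gt γ 1 with h1 | h1
  · rw [← rateΦ_zero hγ]
    exact (strictMonoOn_rateΦ hγ h1).monotoneOn ⟨le_rfl, hγ⟩ hY hY.1
  · have hm := yMax_lt_yMin h1
    have hm' := yMin_lt h1
    have hm0 := yMax_pos h1
    have hc := continuousOn_rateΦ hγ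
    rcases le_total Y (yMax γ) with h2 | h2
    · rw [← rateΦ_zero hγ]
      refine (strictMonoOn_of_deriv_pos (convex_Icc 0 (yMax γ))
        (hc.mono fun x hx => ⟨hx.1, by linarith [hx.2]⟩) fun x hx => ?_).monotoneOn
        ⟨le_rfl, hm0.le⟩ ⟨hY.1, h2⟩ hY.1
      rw [interior_Icc] at hx
      exact deriv_rateΦ_pos_of_lt_yMax h1 hx.2
    · rw [← rateΦ_yMin h1]
      rcases le_total Y (yMin γ) with h3 | h3
      · refine (strictAntiOn_of_deriv_neg (convex_Icc (yMax γ) (yMin γ))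
          (hc.mono fun x hx => ⟨by linarith [hx.1], by linarith [hx.2]⟩) fun x hx => ?_).antitoneOn
          ⟨h2, h3⟩ ⟨hm.le, le_rfl⟩ h3
        rw [interior_Icc] at hx
        exact deriv_rateΦ_neg_of_mem_Ioo h1 hx
      · refine (strictMonoOn_of_deriv_pos (convex_Ico (yMin γ) γ)
          (hc.mono fun x hx => ⟨by linarith [hx.1], hx.2⟩) fun x hx => ?_).monotoneOn
          ⟨le_rfl, hm'⟩ ⟨h3, hY.2⟩ h3
        rw [interior_Ico] at hx
        exact deriv_rateΦ_pos_of_yMin_lt h1 hx.1 hx.2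

end RateFunction

/-! ### Moment identities and moment bounds for the Laguerre weight. -/

section Laguerre

/-- The weight `C(N, k+1) x^k / k!`; the sum over `k < N` is the Laguerre polynomial
`L_{N-1}^{(1)}(-x)`. -/
def lagWeight (N : ℕ) (x : ℝ) (k : ℕ) : ℝ := (N.choose (k + 1) : ℝ) * x ^ k / (k.factorial : ℝ)

/-- The total mass of `lagWeight`. -/
def lagMass (N : ℕ) (x : ℝ) : ℝ := ∑ k ∈ Finset.range N, lagWeight N x k

/-- The expectation of `f` with respect to the normalised `lagWeight`. -/
def lagMean (N : ℕ) (x : ℝ) (f : ℕ → ℝ) : ℝ :=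
  (∑ k ∈ Finset.range N, lagWeight N x k * f k) / lagMass N x

variable {N : ℕ} {x : ℝ}

lemma lagWeight_nonneg (hx : 0 ≤ x) (k : ℕ) : 0 ≤ lagWeight N x k := by
  unfold lagWeight; positivity

lemma lagMass_pos (hN : 0 < N) (hx : 0 ≤ x) : 0 < lagMass N x := by
  refine Finset.sum_pos' (fun k _ => lagWeight_nonneg hx k) ⟨0, Finset.mem_range.2 hN, ?_⟩
  simp [lagWeight, hN]

/-- Consecutive weights have a rational ratio, from which all the moment identities descend. No
bound on k is needed, since past the end of the support both sides vanish. -/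
lemma lagWeight_succ (k : ℕ) :
    lagWeight N x (k + 1) * (k + 2) * (k + 1) = x * (lagWeight N x k * (N - 1 - k)) := by
  have h : ((N.choose (k + 2) : ℝ)) * (k + 2) = N.choose (k + 1) * (N - 1 - k) := by
    rcases le_or_gt (k + 1) N with h | h
    · have := Nat.choose_succ_right_eq N (k + 1)
      have h2 : ((N.choose (k + 1 + 1) * (k + 1 + 1) : ℕ) : ℝ) =
        (N.choose (k + 1) * (N - (k + 1)) : ℕ) := by rw [this]
      push_cast [Nat.cast_sub h] at h2
      linear_combination h2
    · simp [Nat.choose_eq_zero_of_lt h, Nat.choose_eq_zero_of_lt (h.trans (Nat.lt_succ_self _))]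
  unfold lagWeight
  rw [Nat.factorial_succ]
  push_cast
  have : (k.factorial : ℝ) ≠ 0 := by positivity
  field_simp
  rw [pow_succ]
  linear_combination (x ^ k * x) * h

lemma lagWeight_self : lagWeight N x N = 0 := by
  simp [lagWeight]

/-- Summation by parts: `lagWeight_self` allows one extra term at the top, the factor k removes the
term at 0, and the index is then shifted. -/
lemma sum_lagWeight_mul_shift (f : ℕ → ℝ) :
    ∑ k ∈ Finset.range N, lagWeight N x k * ((k + 1) * k * f k) =
      x * ∑ k ∈ Finset.range N, lagWeight N x k * ((N - 1 - k) * f (k + 1)) := by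
  have h1 : ∑ k ∈ Finset.range (N + 1), lagWeight N x k * ((k + 1) * k * f k) =
      ∑ k ∈ Finset.range N, lagWeight N x k * ((k + 1) * k * f k) := by
    rw [Finset.sum_range_succ, lagWeight_self]; ring
  rw [← h1, Finset.sum_range_succ', Finset.mul_sum]
  simp only [Nat.cast_zero, mul_zero, zero_mul, add_zero]
  refine Finset.sum_congr rfl fun k _ => ?_
  push_cast
  linear_combination f (k + 1) * lagWeight_succ (N := N) (x := x) k

/-- The same shift without the factor k + 1. For a Poisson law the coefficient of f(k + 1) would be
the constant mean; here it is (N − 1 − k)x/(k + 2), decreasing in k. -/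
lemma sum_lagWeight_mul_id_mul (f : ℕ → ℝ) :
    ∑ k ∈ Finset.range N, lagWeight N x k * (k * f k) =
      ∑ k ∈ Finset.range N, lagWeight N x k * ((N - 1 - k) * x / (k + 2) * f (k + 1)) := by
  have h1 : ∑ k ∈ Finset.range (N + 1), lagWeight N x k * (k * f k) =
      ∑ k ∈ Finset.range N, lagWeight N x k * (k * f k) := by
    rw [Finset.sum_range_succ, lagWeight_self]; ring
  rw [← h1, Finset.sum_range_succ']
  simp only [Nat.cast_zero, mul_zero, zero_mul, add_zero]
  refine Finset.sum_congr rfl fun k _ => ?_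
  push_cast
  have : (k : ℝ) + 2 ≠ 0 := by positivity
  field_simp
  linear_combination f (k + 1) * lagWeight_succ (N := N) (x := x) k

lemma lagMean_add (f g : ℕ → ℝ) :
    lagMean N x (fun k => f k + g k) = lagMean N x f + lagMean N x g := by
  simp only [lagMean, mul_add, Finset.sum_add_distrib, add_div]

lemma lagMean_sub (f g : ℕ → ℝ) :
    lagMean N x (fun k => f k - g k) = lagMean N x f - lagMean N x g := by
  simp only [lagMean, mul_sub, Finset.sum_sub_distrib, sub_div]

lemma lagMean_const_mul (c : ℝ) (f : ℕ → ℝ) :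
    lagMean N x (fun k => c * f k) = c * lagMean N x f := by
  simp only [lagMean, mul_left_comm _ c, ← Finset.mul_sum, mul_div_assoc]

lemma lagMean_const (hN : 0 < N) (hx : 0 ≤ x) (c : ℝ) : lagMean N x (fun _ => c) = c := by
  have := (lagMass_pos hN hx).ne'
  simp only [lagMean, ← Finset.sum_mul]
  change lagMass N x * c / lagMass N x = c
  field_simp

lemma lagMean_mono (hx : 0 ≤ x) {f g : ℕ → ℝ} (h : ∀ k, f k ≤ g k) :
    lagMean N x f ≤ lagMean N x g := by
  refine div_le_div_of_nonneg_right ?_ (Finset.sum_nonneg fun k _ => lagWeight_nonneg hx k)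
  exact Finset.sum_le_sum fun k _ => mul_le_mul_of_nonneg_left (h k) (lagWeight_nonneg hx k)

lemma lagMean_congr {f g : ℕ → ℝ} (h : ∀ k, f k = g k) : lagMean N x f = lagMean N x g := by
  rw [funext h]

lemma lagMean_shift (f : ℕ → ℝ) :
    lagMean N x (fun k => (k + 1) * k * f k) =
      x * lagMean N x (fun k => (N - 1 - k) * f (k + 1)) := by
  rw [lagMean, sum_lagWeight_mul_shift, lagMean, mul_div_assoc]

lemma lagMean_id_mul (f : ℕ → ℝ) :
    lagMean N x (fun k => k * f k) =
      lagMean N x (fun k => (N - 1 - k) * x / (k + 2) * f (k + 1)) := by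
  rw [lagMean, sum_lagWeight_mul_id_mul, lagMean]

/-- Chebyshev's association inequality. -/
lemma lagMean_mul_le (hN : 0 < N) (hx : 0 ≤ x) {f g : ℕ → ℝ}
    (h : ∀ j ∈ Finset.range N, ∀ k ∈ Finset.range N, j ≤ k → g k ≤ g j ∧ f j ≤ f k) :
    lagMean N x (fun k => g k * f k) ≤ lagMean N x g * lagMean N x f := by
  have hS := lagMass_pos hN hx
  -- Two independent copies j, k of the variable: each product of differences is nonnegative by
  -- opposite monotonicity, and the double sum is twice the gap in the inequality, up to
  -- normalisation.
  have key : 0 ≤ ∑ j ∈ Finset.range N, ∑ k ∈ Finset.range N,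
      lagWeight N x j * lagWeight N x k * ((g j - g k) * (f k - f j)) := by
    refine Finset.sum_nonneg fun j hj => Finset.sum_nonneg fun k hk => ?_
    refine mul_nonneg (mul_nonneg (lagWeight_nonneg hx j) (lagWeight_nonneg hx k)) ?_
    rcases le_total j k with hjk | hjk
    · have := h j hj k hk hjk
      exact mul_nonneg (by linarith) (by linarith)
    · have := h k hk j hj hjk
      exact mul_nonneg_of_nonpos_of_nonpos (by linarith) (by linarith)
  have expand : ∑ j ∈ Finset.range N, ∑ k ∈ Finset.range N,
      lagWeight N x j * lagWeight N x k * ((g j - g k) * (f k - f j)) =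
      2 * ((∑ k ∈ Finset.range N, lagWeight N x k * g k) *
        (∑ k ∈ Finset.range N, lagWeight N x k * f k)) -
      2 * (lagMass N x * ∑ k ∈ Finset.range N, lagWeight N x k * (g k * f k)) := by
    have e1 : ∑ j ∈ Finset.range N, ∑ k ∈ Finset.range N,
        lagWeight N x j * lagWeight N x k * ((g j - g k) * (f k - f j)) =
        ∑ j ∈ Finset.range N, ∑ k ∈ Finset.range N,
        ((lagWeight N x j * g j) * (lagWeight N x k * f k)
        + (lagWeight N x j * f j) * (lagWeight N x k * g k)
        - lagWeight N x j * (lagWeight N x k * (g k * f k))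
        - (lagWeight N x j * (g j * f j)) * lagWeight N x k) :=
      Finset.sum_congr rfl fun j _ => Finset.sum_congr rfl fun k _ => by ring
    rw [e1]
    simp only [Finset.sum_add_distrib, Finset.sum_sub_distrib, ← Finset.mul_sum, ← Finset.sum_mul]
    simp only [lagMass]
    ring
  rw [expand] at key
  unfold lagMean
  rw [div_mul_div_comm, div_le_div_iff₀ hS (by positivity)]
  nlinarith

/-- The mean of `k`. -/
def lagMu (N : ℕ) (x : ℝ) : ℝ := lagMean N x (fun k => (k : ℝ))

/-- The variance of `k`. -/
def lagVar (N : ℕ) (x : ℝ) : ℝ := lagMean N x (fun k => ((k : ℝ) - lagMu N x) ^ 2)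

lemma lagMu_nonneg (hN : 0 < N) (hx : 0 ≤ x) : 0 ≤ lagMu N x := by
  rw [← lagMean_const hN hx 0]
  exact lagMean_mono hx fun k => by positivity

lemma lagVar_nonneg (hN : 0 < N) (hx : 0 ≤ x) : 0 ≤ lagVar N x := by
  rw [← lagMean_const hN hx 0]
  exact lagMean_mono hx fun k => by positivity

lemma lagMean_sub_mu (hN : 0 < N) (hx : 0 ≤ x) :
    lagMean N x (fun k => (k : ℝ) - lagMu N x) = 0 := by
  rw [lagMean_sub, lagMean_const hN hx]; exact sub_self _

/-- The Poisson-type moment bound, a consequence of ultra-log-concavity. -/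
lemma lagMean_centered_mul_le (hN : 0 < N) (hx : 0 ≤ x) {f : ℕ → ℝ} (hf : Monotone f) :
    lagMean N x (fun k => ((k : ℝ) - lagMu N x) * f k) ≤
      lagMu N x * lagMean N x (fun k => f (k + 1) - f k) := by
  set μ := lagMu N x
  -- The decreasing ratio and the increasing f(k + 1) are negatively correlated. The mean of the
  -- ratio is μ, by the case f = 1 of `lagMean_id_mul`.
  have h1 : lagMean N x (fun k => (N - 1 - k) * x / (k + 2) * f (k + 1)) ≤
      lagMean N x (fun k => (N - 1 - k) * x / (k + 2)) * lagMean N x (fun k => f (k + 1)) := by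
    refine lagMean_mul_le hN hx fun j hj k hk hjk => ⟨?_, hf (by omega)⟩
    have hjk' : (j : ℝ) ≤ k := by exact_mod_cast hjk
    have hk' : (k : ℝ) + 1 ≤ N := by exact_mod_cast (Finset.mem_range.1 hk)
    refine div_le_div₀ (mul_nonneg (by linarith) hx) ?_ (by positivity) (by linarith)
    exact mul_le_mul_of_nonneg_right (by linarith) hx
  have h2 : lagMean N x (fun k => (N - 1 - k) * x / (k + 2)) = μ := by
    have := lagMean_id_mul (N := N) (x := x) (fun _ => 1)
    simp only [mul_one] at this
    exact this.symm
  rw [h2, ← lagMean_id_mul] at h1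
  have h3 : lagMean N x (fun k => ((k : ℝ) - μ) * f k) =
      lagMean N x (fun k => (k : ℝ) * f k) - μ * lagMean N x f := by
    rw [← lagMean_const_mul, ← lagMean_sub]
    exact lagMean_congr fun k => by ring
  rw [h3, lagMean_sub]
  linarith

/-- The Poisson-type bound for f(k) = k − μ, whose increments are 1. -/
lemma lagVar_le (hN : 0 < N) (hx : 0 ≤ x) : lagVar N x ≤ lagMu N x := by
  have h := lagMean_centered_mul_le hN hx (f := fun k => (k : ℝ) - lagMu N x)
    (fun a b hab => by simpa using hab)
  have h2 : lagMean N x (fun k => ((k + 1 : ℕ) : ℝ) - lagMu N x - ((k : ℝ) - lagMu N x)) = 1 := by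
    rw [← lagMean_const hN hx 1]
    exact lagMean_congr fun k => by push_cast; ring
  rw [h2, mul_one] at h
  refine le_trans (le_of_eq (lagMean_congr fun k => by ring)) h

/-- The Poisson-type bound for f = d³ with d = k − μ: the increments are 3d² + 3d + 1, and d has
mean zero. -/
lemma lagMean_fourth_le (hN : 0 < N) (hx : 0 ≤ x) :
    lagMean N x (fun k => ((k : ℝ) - lagMu N x) ^ 4) ≤ lagMu N x * (3 * lagVar N x + 1) := by
  have h := lagMean_centered_mul_le hN hx (f := fun k => ((k : ℝ) - lagMu N x) ^ 3)
    (fun a b hab => (Odd.strictMono_pow (by decide : Odd 3)).monotone (by simpa using hab))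
  have h2 : lagMean N x (fun k => (((k + 1 : ℕ) : ℝ) - lagMu N x) ^ 3 - ((k : ℝ) - lagMu N x) ^ 3)
      = 3 * lagVar N x + 1 := by
    have : lagMean N x (fun k => (((k + 1 : ℕ) : ℝ) - lagMu N x) ^ 3 - ((k : ℝ) - lagMu N x) ^ 3) =
        lagMean N x (fun k => 3 * ((k : ℝ) - lagMu N x) ^ 2 +
          (3 * ((k : ℝ) - lagMu N x) + 1)) :=
      lagMean_congr fun k => by push_cast; ring
    rw [this, lagMean_add, lagMean_add, lagMean_const_mul, lagMean_const_mul, lagMean_const hN hx,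
      lagMean_sub_mu hN hx]
    simp [lagVar]
  rw [h2] at h
  refine le_trans (le_of_eq (lagMean_congr fun k => by ring)) h

lemma lagMean_sq (hN : 0 < N) (hx : 0 ≤ x) :
    lagMean N x (fun k => (k : ℝ) ^ 2) = lagVar N x + lagMu N x ^ 2 := by
  have : lagMean N x (fun k => (k : ℝ) ^ 2) =
      lagMean N x (fun k => ((k : ℝ) - lagMu N x) ^ 2 +
        (2 * lagMu N x * ((k : ℝ) - lagMu N x) + lagMu N x ^ 2)) :=
    lagMean_congr fun k => by ring
  rw [this, lagMean_add, lagMean_add, lagMean_const_mul, lagMean_const hN hx, lagMean_sub_mu hN hx]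
  simp [lagVar]

/-- The shift identity with f = 1. Up to the lower-order terms V + μ this is the quadratic equation
μ² + xμ = x(N − 1). -/
lemma lagMu_identity (hN : 0 < N) (hx : 0 ≤ x) :
    lagMu N x ^ 2 + lagVar N x + lagMu N x = x * (N - 1 - lagMu N x) := by
  have h := lagMean_shift (N := N) (x := x) (fun _ => 1)
  have h1 : lagMean N x (fun k => ((k : ℝ) + 1) * k * 1) =
      lagMean N x (fun k => (k : ℝ) ^ 2 + k) := lagMean_congr fun k => by ring
  have h2 : lagMean N x (fun k => ((N : ℝ) - 1 - k) * 1) =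
      lagMean N x (fun k => ((N : ℝ) - 1) - k) := lagMean_congr fun k => by ring
  rw [h1, h2, lagMean_add, lagMean_sub, lagMean_sq hN hx, lagMean_const hN hx] at h
  change lagVar N x + lagMu N x ^ 2 + lagMu N x = x * (N - 1 - lagMu N x) at h
  linarith

/-- The shift identity with f(k) = k − μ. It determines the variance up to the third central moment,
which turns out to be of lower order. -/
lemma lagVar_identity (hN : 0 < N) (hx : 0 ≤ x) :
    lagVar N x * (2 * lagMu N x + 1 + x) = x * (N - 1 - lagMu N x) -
      lagMean N x (fun k => ((k : ℝ) - lagMu N x) ^ 3) := by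
  have h := lagMean_shift (N := N) (x := x) (fun k => (k : ℝ) - lagMu N x)
  have h1 : lagMean N x (fun k => ((k : ℝ) + 1) * k * ((k : ℝ) - lagMu N x)) =
      lagMean N x (fun k => ((k : ℝ) - lagMu N x) ^ 3 +
        ((2 * lagMu N x + 1) * ((k : ℝ) - lagMu N x) ^ 2 +
          (lagMu N x ^ 2 + lagMu N x) * ((k : ℝ) - lagMu N x))) :=
    lagMean_congr fun k => by ring
  have h2 : lagMean N x (fun k => ((N : ℝ) - 1 - k) * (((k + 1 : ℕ) : ℝ) - lagMu N x)) =
      lagMean N x (fun k => (-1) * ((k : ℝ) - lagMu N x) ^ 2 +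
        ((N - 2 - lagMu N x) * ((k : ℝ) - lagMu N x) + (N - 1 - lagMu N x))) :=
    lagMean_congr fun k => by push_cast; ring
  rw [h1, h2] at h
  simp only [lagMean_add, lagMean_const_mul, lagMean_sub_mu hN hx, lagMean_const hN hx] at h
  change _ + ((2 * lagMu N x + 1) * lagVar N x + _) = x * (-1 * lagVar N x + _) at h
  linarith

lemma abs_third_le {a d : ℝ} (ha : 0 < a) : |d ^ 3| ≤ (a * d ^ 2 + d ^ 4 / a) / 2 := by
  have h : 0 ≤ (a - |d|) ^ 2 := sq_nonneg _
  have h2 : |d| ^ 2 = d ^ 2 := sq_abs d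
  have e : |d ^ 3| = d ^ 2 * |d| := by rw [abs_pow, pow_succ, h2]
  rw [e, le_div_iff₀ two_pos, show a * d ^ 2 + d ^ 4 / a = (a ^ 2 + d ^ 2) * d ^ 2 / a by
    field_simp, le_div_iff₀ ha]
  have : 0 ≤ d ^ 2 * ((a - |d|) ^ 2) := by positivity
  nlinarith

/-- In `abs_third_le` the choice a = √q balances a variance of at most q against a fourth moment of
at most 4q². -/
lemma abs_lagMean_third_le (hN : 0 < N) (hx : 0 ≤ x) {q : ℝ} (hq : 1 ≤ q) (hμ : lagMu N x ≤ q) :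
    |lagMean N x (fun k => ((k : ℝ) - lagMu N x) ^ 3)| ≤ 5 / 2 * (q * √q) := by
  have hs : 1 ≤ √q := Real.one_le_sqrt.2 hq
  have hsq : √q ^ 2 = q := Real.sq_sqrt (by linarith)
  have hs0 : 0 < √q := by linarith
  have hμ0 := lagMu_nonneg hN hx
  have hV := lagVar_le hN hx
  have h4 := lagMean_fourth_le hN hx
  have bound : lagMean N x (fun k => (√q * ((k : ℝ) - lagMu N x) ^ 2 +
      ((k : ℝ) - lagMu N x) ^ 4 / √q) / 2) ≤ 5 / 2 * (q * √q) := by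
    have : lagMean N x (fun k => (√q * ((k : ℝ) - lagMu N x) ^ 2 +
      ((k : ℝ) - lagMu N x) ^ 4 / √q) / 2) = √q / 2 * lagVar N x + (2 * √q)⁻¹ *
        lagMean N x (fun k => ((k : ℝ) - lagMu N x) ^ 4) := by
      rw [lagVar, ← lagMean_const_mul, ← lagMean_const_mul, ← lagMean_add]
      exact lagMean_congr fun k => by field_simp
    rw [this]
    have h5 : lagMean N x (fun k => ((k : ℝ) - lagMu N x) ^ 4) ≤ 4 * q ^ 2 := by nlinarith
    have h6 : (2 * √q)⁻¹ * lagMean N x (fun k => ((k : ℝ) - lagMu N x) ^ 4) ≤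
        (2 * √q)⁻¹ * (4 * q ^ 2) := mul_le_mul_of_nonneg_left h5 (by positivity)
    have h7 : (2 * √q)⁻¹ * (4 * q ^ 2) = 2 * (q * √q) := by
      field_simp; linear_combination (-4) * hsq
    have h8 : √q / 2 * lagVar N x ≤ √q / 2 * q :=
      mul_le_mul_of_nonneg_left (hV.trans hμ) (by positivity)
    linarith
  refine abs_le.2 ⟨?_, ?_⟩
  · rw [neg_le, ← neg_one_mul, ← lagMean_const_mul]
    refine le_trans (lagMean_mono hx fun k => ?_) bound
    refine le_trans ?_ (abs_third_le hs0)
    rw [neg_one_mul]; exact neg_le_abs _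
  · refine le_trans (lagMean_mono hx fun k => ?_) bound
    exact le_trans (le_abs_self _) (abs_third_le hs0)

end Laguerre

/-! ### The mean of the Laguerre weight up to a vanishing error. -/

section LaguerreAsymptotics

variable {N : ℕ} {Y : ℝ}

/-- With x = NY², the number m = NY r_* solves m² + xm = xN. Subtracting this from `lagMu_identity`
gives (μ − m)(μ + m + x) = −(V + μ + x), and 0 ≤ V ≤ μ confines μ − m to [−2, 0]. -/
lemma lagMu_bounds (hN : 0 < N) (hY : 0 < Y) :
    N * Y * rStar Y - 2 ≤ lagMu N (N * Y ^ 2) ∧ lagMu N (N * Y ^ 2) ≤ N * Y * rStar Y := by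
  have hx : (0 : ℝ) ≤ N * Y ^ 2 := by positivity
  have hN' : (0 : ℝ) < N := by exact_mod_cast hN
  have h1 := lagMu_identity hN hx
  have h2 := lagVar_le hN hx
  have h3 := lagVar_nonneg hN hx
  have h4 := lagMu_nonneg hN hx
  have h5 := rStar_sq Y
  have h6 := rStar_pos Y
  set μ := lagMu N (N * Y ^ 2)
  set V := lagVar N (N * Y ^ 2)
  have key : (μ - N * Y * rStar Y) * (μ + N * Y * rStar Y + N * Y ^ 2) = -(V + μ + N * Y ^ 2) := by
    linear_combination h1 + (-(N ^ 2 * Y ^ 2) : ℝ) * h5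
  have hp : 0 < μ + N * Y * rStar Y + N * Y ^ 2 := by positivity
  have hxp : 0 < N * Y ^ 2 := by positivity
  have hq : 0 < N * Y * rStar Y := by positivity
  constructor
  · by_contra! hlt
    have : (μ - N * Y * rStar Y) * (μ + N * Y * rStar Y + N * Y ^ 2) <
        (-2) * (μ + N * Y * rStar Y + N * Y ^ 2) := mul_lt_mul_of_pos_right (by linarith) hp
    linarith
  · by_contra! hlt
    have : 0 < (μ - N * Y * rStar Y) * (μ + N * Y * rStar Y + N * Y ^ 2) :=
      mul_pos (by linarith) hp
    linarith

/-- Put q = NY, s = √(Y² + 4), D = μ − q r_*. The mean identity gives D(qs + D) = −(V + q r_* + D +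
qY), and the variance identity gives V = q r_*²/s + O(√q), because the third moment is O(q^(3/2)).
Hence D = −(r_*²/s + r_* + Y)/s + O(q^(-1/2)), and the main term is −(3/4 + Y²/(4s²)). -/
lemma abs_lagMu_sub_le (hN : 0 < N) (hY : 0 < Y) (hq : 3 ≤ N * Y) :
    |lagMu N (N * Y ^ 2) - N * Y * rStar Y + (3 / 4 + Y ^ 2 / (4 * (Y ^ 2 + 4)))| ≤
      10 / √(N * Y) := by
  have hx : (0 : ℝ) ≤ N * Y ^ 2 := by positivity
  have h1 := lagMu_identity hN hx
  have h2 := lagVar_identity hN hx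
  obtain ⟨hl, hu⟩ := lagMu_bounds hN hY
  have h5 := rStar_sq Y
  have h6 := rStar_pos Y
  have h7 := rStar_le_one hY.le
  have h8 := sqrt_eq_rStar Y
  have hs2 := sq_sqrt_sq_add_four Y
  have hs : 2 ≤ √(Y ^ 2 + 4) := by
    rw [Real.le_sqrt' (by norm_num)]; nlinarith [sq_nonneg Y]
  have hκ := abs_lagMean_third_le hN hx (q := N * Y) (by linarith)
    (hu.trans (by nlinarith [mul_le_of_le_one_right (by positivity : (0 : ℝ) ≤ N * Y) h7]))
  set μ := lagMu N (N * Y ^ 2)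
  set V := lagVar N (N * Y ^ 2)
  set κ := lagMean N (N * Y ^ 2) (fun k => ((k : ℝ) - μ) ^ 3)
  rw [← hs2]
  set s := √(Y ^ 2 + 4)
  obtain ⟨q, hqdef⟩ : ∃ q : ℝ, q = N * Y := ⟨_, rfl⟩
  rw [← hqdef] at hq hκ hl hu ⊢
  obtain ⟨r, hr⟩ : ∃ r : ℝ, r = rStar Y := ⟨_, rfl⟩
  rw [← hr] at h5 h6 h7 h8 hl hu ⊢
  obtain ⟨D, hD⟩ : ∃ D : ℝ, D = μ - q * r := ⟨_, rfl⟩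
  rw [← hD]
  have hμ : μ = q * r + D := by rw [hD]; ring
  have hxq : (N : ℝ) * Y ^ 2 = q * Y := by rw [hqdef]; ring
  rw [hxq] at h1 h2
  have hD0 : D ≤ 0 := by linarith
  have hD2 : -2 ≤ D := by linarith
  have hs0 : 0 < s := by linarith
  have hq0 : 0 < q := by linarith
  have hqN : q * Y * N = q ^ 2 := by rw [hqdef]; ring
  have hsq1 : 1 ≤ √q := Real.one_le_sqrt.2 (by linarith)
  have hsqq : √q ^ 2 = q := Real.sq_sqrt hq0.le
  have hsY : Y ≤ s := by linarith
  have hqs : 2 * q ≤ q * s := by linarith [mul_le_mul_of_nonneg_left hs hq0.le]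
  have e1 : D * (q * s + D) = -(V + q * r + D + q * Y) := by
    rw [hμ] at h1
    linear_combination h1 + q * D * h8 + hqN - q ^ 2 * h5
  have e2 : V * (q * s + 2 * D + 1) = q ^ 2 * r ^ 2 - q * Y * (1 + D) - κ := by
    rw [hμ] at h2
    linear_combination h2 + V * q * h8 + hqN - q ^ 2 * h5
  -- W is the error of the variance relative to its leading value q r²/s.
  set W := V - q * r ^ 2 / s with hW
  have e3 : W * (q * s + 2 * D + 1) = -(q * Y * (1 + D)) - κ - q * r ^ 2 / s * (2 * D + 1) := by
    rw [hW, sub_mul, e2]; field_simp; ring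
  -- Here q ≥ 3 enters: qs ≥ 2q and D ≥ −2 bound the right side below by 2q − 3.
  have hden : q ≤ q * s + 2 * D + 1 := by linarith
  have hden' : q * s ≤ 2 * (q * s + 2 * D + 1) := by linarith
  have hden0 : 0 < q * s + 2 * D + 1 := by linarith
  have hr2 : r ^ 2 / s ≤ s / 4 := by
    rw [div_le_div_iff₀ hs0 (by norm_num)]
    linarith [pow_le_one₀ (n := 2) h6.le h7, mul_le_mul hs hs (by norm_num) hs0.le]
  have hWb : |W| ≤ 6 * √q := by
    have a1 : |W| * (q * s + 2 * D + 1) ≤ q * Y + |κ| + 3 * (q * (r ^ 2 / s)) := by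
      rw [← abs_of_pos hden0, ← abs_mul, e3]
      have b1 : |q * Y * (1 + D)| ≤ q * Y := by
        rw [abs_mul, abs_of_pos (by positivity : 0 < q * Y)]
        exact mul_le_of_le_one_right (by positivity) (abs_le.2 ⟨by linarith, by linarith⟩)
      have b2 : |q * r ^ 2 / s * (2 * D + 1)| ≤ 3 * (q * (r ^ 2 / s)) := by
        rw [abs_mul, abs_of_nonneg (by positivity : 0 ≤ q * r ^ 2 / s), mul_comm, mul_div_assoc]
        exact mul_le_mul_of_nonneg_right (abs_le.2 ⟨by linarith, by linarith⟩) (by positivity)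
      calc |-(q * Y * (1 + D)) - κ - q * r ^ 2 / s * (2 * D + 1)|
          ≤ |-(q * Y * (1 + D)) - κ| + |q * r ^ 2 / s * (2 * D + 1)| := abs_sub _ _
        _ ≤ |-(q * Y * (1 + D))| + |κ| + |q * r ^ 2 / s * (2 * D + 1)| := by
            gcongr; exact abs_sub _ _
        _ ≤ _ := by rw [abs_neg]; gcongr
    have a2 : q * Y + |κ| + 3 * (q * (r ^ 2 / s)) ≤ 6 * √q * (q * s + 2 * D + 1) := by
      have c1 : q * Y ≤ q * s := by gcongr
      have c2 : q * (r ^ 2 / s) ≤ q * (s / 4) := by gcongr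
      have c3 : q * s * 1 ≤ q * s * √q := by gcongr
      have c4 : 2 * q * √q ≤ q * s * √q := by gcongr
      have c5 : √q * (q * s) ≤ √q * (2 * (q * s + 2 * D + 1)) := by gcongr
      linarith
    exact le_of_mul_le_mul_right (a1.trans a2) hden0
  obtain ⟨c, hc⟩ : ∃ c : ℝ, c = 3 / 4 + Y ^ 2 / (4 * s ^ 2) := ⟨_, rfl⟩
  rw [← hc]
  have hc0 : 0 ≤ c := by rw [hc]; positivity
  have hc1 : c ≤ 1 := by
    have : Y ^ 2 / (4 * s ^ 2) ≤ 1 / 4 := by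
      rw [div_le_div_iff₀ (by positivity) (by norm_num)]
      linarith [pow_le_pow_left₀ hY.le hsY 2]
    rw [hc]; linarith
  have hcq : c * (q * s) = q * r ^ 2 / s + q * r + q * Y := by
    have hr' : r = (s - Y) / 2 := by linarith
    rw [hc, hr']; field_simp; ring
  have e4 : (D + c) * (q * s + D) = -(W + D) + c * D := by
    rw [hW]; linear_combination e1 + hcq
  have hden3 : q ≤ q * s + D := by linarith
  have a3 : |D + c| * (q * s + D) ≤ 10 * √q := by
    rw [← abs_of_pos (by linarith : 0 < q * s + D), ← abs_mul, e4]
    have b1 : |c * D| ≤ 2 := by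
      rw [abs_mul, abs_of_nonneg hc0]
      have : |D| ≤ 2 := abs_le.2 ⟨hD2, by linarith⟩
      calc c * |D| ≤ 1 * 2 := mul_le_mul hc1 this (abs_nonneg D) (by norm_num)
        _ = 2 := by norm_num
    have b2 : |D| ≤ 2 := abs_le.2 ⟨hD2, by linarith⟩
    calc |-(W + D) + c * D| ≤ |-(W + D)| + |c * D| := abs_add_le _ _
      _ ≤ |W| + |D| + |c * D| := by rw [abs_neg]; gcongr; exact abs_add_le _ _
      _ ≤ _ := by linarith
  rw [le_div_iff₀ (by linarith)]
  have a4 : |D + c| * q ≤ 10 * √q := le_trans (by gcongr) a3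
  have a5 : (|D + c| * √q) * √q ≤ 10 * √q := by
    calc (|D + c| * √q) * √q = |D + c| * √q ^ 2 := by ring
      _ ≤ _ := by rw [hsqq]; exact a4
  exact le_of_mul_le_mul_right a5 (by linarith)

end LaguerreAsymptotics

/-! ### The size of the Laguerre mass, including its constant. -/

section LaguerreLimit

variable {N : ℕ} {Y : ℝ}

/-- The leading-order form of `lagMass N (N * Y ^ 2)`. -/
def lagMain (N : ℕ) (Y : ℝ) : ℝ :=
  1 / √(2 * Real.pi * N) * Y ^ (-(3 / 2) : ℝ) * (Y ^ 2 + 4) ^ (-(1 / 4) : ℝ) *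
    Real.exp (N * (Y * rStar Y - 2 * Real.log (rStar Y)))

/-- The logarithm of `lagMass N (N * Y ^ 2) / lagMain N Y`. -/
def lagLogRatio (N : ℕ) (Y : ℝ) : ℝ :=
  Real.log (lagMass N (N * Y ^ 2)) + 1 / 2 * Real.log (2 * Real.pi * N) + 3 / 2 * Real.log Y +
    1 / 4 * Real.log (Y ^ 2 + 4) - N * (Y * rStar Y - 2 * Real.log (rStar Y))

lemma lagMass_eq_exp_mul (hN : 0 < N) (hY : 0 < Y) :
    lagMass N (N * Y ^ 2) = Real.exp (lagLogRatio N Y) * lagMain N Y := by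
  have hS := lagMass_pos hN (by positivity : (0 : ℝ) ≤ N * Y ^ 2)
  have hN' : (0 : ℝ) < N := by exact_mod_cast hN
  have h1 : 1 / √(2 * Real.pi * N) = Real.exp (-(1 / 2 * Real.log (2 * Real.pi * N))) := by
    rw [Real.exp_neg, mul_comm (1 / 2 : ℝ), Real.exp_mul, Real.exp_log (by positivity), ← Real.sqrt_eq_rpow,
      one_div]
  rw [lagMain, h1, Real.rpow_def_of_pos hY, Real.rpow_def_of_pos (by positivity), ← Real.exp_add,
    ← Real.exp_add, ← Real.exp_add, ← Real.exp_add]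
  nth_rewrite 1 [← Real.exp_log hS]
  congr 1
  rw [lagLogRatio]
  ring

/-- The k-th term is a multiple of Y^(2k), so the logarithmic derivative is the mean of 2k/Y. -/
lemma hasDerivAt_lagMass (hN : 0 < N) (hY : 0 < Y) :
    HasDerivAt (fun Y : ℝ => lagMass N (N * Y ^ 2))
      (lagMass N (N * Y ^ 2) * (2 * lagMu N (N * Y ^ 2) / Y)) Y := by
  have hS := lagMass_pos hN (by positivity : (0 : ℝ) ≤ N * Y ^ 2)
  have h1 : ∀ k ∈ Finset.range N, HasDerivAt (fun Y : ℝ => lagWeight N (N * Y ^ 2) k)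
      (2 / Y * (lagWeight N (N * Y ^ 2) k * k)) Y := by
    intro k _
    have h2 : HasDerivAt (fun Y : ℝ => (N : ℝ) * Y ^ 2) (N * (2 * Y)) Y := by
      simpa using (hasDerivAt_pow 2 Y).const_mul (N : ℝ)
    have h3 := (((h2.pow k).const_mul (N.choose (k + 1) : ℝ)).div_const (k.factorial : ℝ))
    refine h3.congr_deriv ?_
    unfold lagWeight
    rcases k with _ | k
    · simp
    · simp only [Nat.add_sub_cancel]
      have : ((k + 1).factorial : ℝ) ≠ 0 := by positivity
      field_simp
      ring
  have h4 := HasDerivAt.fun_sum h1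
  refine h4.congr_deriv ?_
  rw [← Finset.mul_sum, lagMu, lagMean]
  generalize lagMass N (N * Y ^ 2) = S at hS
  have := hS.ne'
  field_simp

/-- The summand 3/4 + Y²/(4(Y² + 4)) comes from the factor Y^(-3/2) (Y² + 4)^(-1/4) of `lagMain`.
The powers there are the right ones because the bracket is then the small quantity of
`abs_lagMu_sub_le`. -/
lemma hasDerivAt_lagLogRatio (hN : 0 < N) (hY : 0 < Y) :
    HasDerivAt (lagLogRatio N) (2 / Y * (lagMu N (N * Y ^ 2) - N * Y * rStar Y +
      (3 / 4 + Y ^ 2 / (4 * (Y ^ 2 + 4))))) Y := by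
  have hS := lagMass_pos hN (by positivity : (0 : ℝ) ≤ N * Y ^ 2)
  have h1 := (hasDerivAt_lagMass hN hY).log hS.ne'
  have h2 := (Real.hasDerivAt_log hY.ne').const_mul (3 / 2)
  have h3 : HasDerivAt (fun Y : ℝ => Y ^ 2 + 4) (2 * Y) Y := by
    simpa using (hasDerivAt_pow 2 Y).add_const 4
  have h4 := (h3.log (by positivity)).const_mul (1 / 4)
  have h5 := (hasDerivAt_mul_rStar_sub_log Y).const_mul (N : ℝ)
  have h6 := ((((h1.add_const (1 / 2 * Real.log (2 * Real.pi * N))).add h2).add h4).sub h5)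
  refine h6.congr_deriv ?_
  field_simp
  ring

lemma abs_deriv_lagLogRatio_le (hN : 0 < N) (hY : 0 < Y) (hq : 3 ≤ N * Y) :
    |2 / Y * (lagMu N (N * Y ^ 2) - N * Y * rStar Y + (3 / 4 + Y ^ 2 / (4 * (Y ^ 2 + 4))))| ≤
      20 / √N * (√Y * Y)⁻¹ := by
  rw [abs_mul, abs_of_pos (by positivity : 0 < 2 / Y)]
  have hN' : (0 : ℝ) < N := by exact_mod_cast hN
  calc 2 / Y * |lagMu N (N * Y ^ 2) - N * Y * rStar Y + (3 / 4 + Y ^ 2 / (4 * (Y ^ 2 + 4)))|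
      ≤ 2 / Y * (10 / √(N * Y)) := by gcongr; exact abs_lagMu_sub_le hN hY hq
    _ = _ := by
      rw [Real.sqrt_mul hN'.le]
      have : 0 < √(N : ℝ) := by positivity
      have : 0 < √Y := by positivity
      field_simp; ring

lemma hasDerivAt_inv_sqrt (hY : 0 < Y) :
    HasDerivAt (fun Y : ℝ => (√Y)⁻¹) (-(1 / 2) * (√Y * Y)⁻¹) Y := by
  have h := (Real.hasDerivAt_sqrt hY.ne').inv (by positivity)
  refine h.congr_deriv ?_
  have h1 : 0 < √Y := by positivity
  have h2 : √Y ^ 2 = Y := Real.sq_sqrt hY.le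
  rw [h2]
  field_simp

/-- The derivative bound 20 Z^(-3/2)/√N integrates over [Y, ∞) to 40 Y^(-1/2)/√N. The integration
takes the form of monotonicity: adding or subtracting the tail integral makes the function antitone
or monotone. -/
lemma abs_lagLogRatio_sub_limit_le (hN : 0 < N) (hY : 0 < Y) (hq : 3 ≤ N * Y) {L : ℝ}
    (hL : Tendsto (lagLogRatio N) atTop (𝓝 L)) :
    |lagLogRatio N Y - L| ≤ 40 / √N * (√Y)⁻¹ := by
  have hN' : (0 : ℝ) < N := by exact_mod_cast hN
  have hd : ∀ Z ∈ Ici Y, 0 < Z ∧ 3 ≤ N * Z := fun Z hZ =>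
    ⟨hY.trans_le hZ, hq.trans (by gcongr; exact hZ)⟩
  have hinv : Tendsto (fun Z : ℝ => 40 / √N * (√Z)⁻¹) atTop (𝓝 0) := by
    have : Tendsto (fun Z : ℝ => (√Z)⁻¹) atTop (𝓝 0) :=
      tendsto_inv_atTop_zero.comp Real.tendsto_sqrt_atTop
    simpa using this.const_mul (40 / √(N : ℝ))
  have hder1 : ∀ Z ∈ Ici Y, HasDerivAt (fun Z => lagLogRatio N Z + 40 / √N * (√Z)⁻¹)
      (2 / Z * (lagMu N (N * Z ^ 2) - N * Z * rStar Z + (3 / 4 + Z ^ 2 / (4 * (Z ^ 2 + 4)))) +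
        40 / √N * (-(1 / 2) * (√Z * Z)⁻¹)) Z := fun Z hZ =>
    (hasDerivAt_lagLogRatio hN (hd Z hZ).1).add ((hasDerivAt_inv_sqrt (hd Z hZ).1).const_mul _)
  have hder2 : ∀ Z ∈ Ici Y, HasDerivAt (fun Z => lagLogRatio N Z - 40 / √N * (√Z)⁻¹)
      (2 / Z * (lagMu N (N * Z ^ 2) - N * Z * rStar Z + (3 / 4 + Z ^ 2 / (4 * (Z ^ 2 + 4)))) -
        40 / √N * (-(1 / 2) * (√Z * Z)⁻¹)) Z := fun Z hZ =>
    (hasDerivAt_lagLogRatio hN (hd Z hZ).1).sub ((hasDerivAt_inv_sqrt (hd Z hZ).1).const_mul _)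
  have hanti : AntitoneOn (fun Z => lagLogRatio N Z + 40 / √N * (√Z)⁻¹) (Ici Y) := by
    refine antitoneOn_of_deriv_nonpos (convex_Ici Y)
      (fun Z hZ => (hder1 Z hZ).continuousAt.continuousWithinAt)
      (fun Z hZ => (hder1 Z (interior_subset hZ)).differentiableAt.differentiableWithinAt)
      fun Z hZ => ?_
    have hZ' := interior_subset hZ
    rw [(hder1 Z hZ').deriv]
    have := (abs_le.1 (abs_deriv_lagLogRatio_le hN (hd Z hZ').1 (hd Z hZ').2)).2
    have e : 40 / √(N : ℝ) * (-(1 / 2) * (√Z * Z)⁻¹) = -(20 / √N * (√Z * Z)⁻¹) := by ring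
    linarith
  have hmono : MonotoneOn (fun Z => lagLogRatio N Z - 40 / √N * (√Z)⁻¹) (Ici Y) := by
    refine monotoneOn_of_deriv_nonneg (convex_Ici Y)
      (fun Z hZ => (hder2 Z hZ).continuousAt.continuousWithinAt)
      (fun Z hZ => (hder2 Z (interior_subset hZ)).differentiableAt.differentiableWithinAt)
      fun Z hZ => ?_
    have hZ' := interior_subset hZ
    rw [(hder2 Z hZ').deriv]
    have := (abs_le.1 (abs_deriv_lagLogRatio_le hN (hd Z hZ').1 (hd Z hZ').2)).1
    have e : 40 / √(N : ℝ) * (-(1 / 2) * (√Z * Z)⁻¹) = -(20 / √N * (√Z * Z)⁻¹) := by ring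
    linarith
  have l1 : L ≤ lagLogRatio N Y + 40 / √N * (√Y)⁻¹ := by
    refine le_of_tendsto (by simpa using hL.add hinv) ?_
    filter_upwards [eventually_ge_atTop Y] with Z hZ
    exact hanti self_mem_Ici hZ hZ
  have l2 : lagLogRatio N Y - 40 / √N * (√Y)⁻¹ ≤ L := by
    refine ge_of_tendsto (by simpa using hL.sub hinv) ?_
    filter_upwards [eventually_ge_atTop Y] with Z hZ
    exact hmono self_mem_Ici hZ hZ
  exact abs_le.2 ⟨by linarith, by linarith⟩

lemma tendsto_mul_rStar : Tendsto (fun Y : ℝ => Y * rStar Y) atTop (𝓝 1) := by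
  have h0 : Tendsto rStar atTop (𝓝 0) := by
    refine squeeze_zero' (Eventually.of_forall fun Y => (rStar_pos Y).le) ?_ tendsto_inv_atTop_zero
    filter_upwards [eventually_gt_atTop 0] with Y hY
    rw [le_inv_comm₀ (rStar_pos Y) hY, le_inv_comm₀ hY (rStar_pos Y), inv_eq_one_div,
      le_div_iff₀ hY]
    nlinarith [rStar_sq Y, sq_nonneg (rStar Y)]
  have h1 : (fun Y : ℝ => Y * rStar Y) = fun Y => 1 - rStar Y ^ 2 := by
    funext Y; rw [rStar_sq]; ring
  rw [h1]
  simpa using (h0.pow 2).const_sub 1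

/-- Only the top term k = N − 1 survives as Y → ∞. -/
lemma tendsto_lagMass_div (hN : 0 < N) :
    Tendsto (fun Y : ℝ => lagMass N (N * Y ^ 2) / Y ^ (2 * (N - 1))) atTop
      (𝓝 ((N : ℝ) ^ (N - 1) / ((N - 1).factorial : ℝ))) := by
  obtain ⟨n, rfl⟩ : ∃ n, N = n + 1 := ⟨N - 1, by omega⟩
  simp only [Nat.add_sub_cancel, lagMass, Finset.sum_div]
  rw [← zero_add (((n + 1 : ℕ) : ℝ) ^ n / (n.factorial : ℝ))]
  simp only [Finset.sum_range_succ]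
  refine Tendsto.add ?_ ?_
  · rw [← Finset.sum_const_zero (s := Finset.range n)]
    refine tendsto_finsetSum _ fun k hk => ?_
    have hk' := Finset.mem_range.1 hk
    have hlim : Tendsto (fun Y : ℝ => ((n + 1).choose (k + 1) : ℝ) * ((n + 1 : ℕ) : ℝ) ^ k /
        k.factorial * (Y ^ (2 * (n - k)))⁻¹) atTop (𝓝 0) := by
      have : Tendsto (fun Y : ℝ => (Y ^ (2 * (n - k)))⁻¹) atTop (𝓝 0) :=
        tendsto_inv_atTop_zero.comp (tendsto_pow_atTop (by omega))
      simpa using this.const_mul (((n + 1).choose (k + 1) : ℝ) * ((n + 1 : ℕ) : ℝ) ^ k /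
        k.factorial)
    refine hlim.congr' ?_
    filter_upwards [eventually_gt_atTop 0] with Y hY
    unfold lagWeight
    have e : Y ^ (2 * n) = (Y ^ 2) ^ k * Y ^ (2 * (n - k)) := by
      rw [← pow_mul, ← pow_add]; congr 1; omega
    rw [e, mul_pow]
    have : (k.factorial : ℝ) ≠ 0 := by positivity
    field_simp
  · refine tendsto_const_nhds.congr' ?_
    filter_upwards [eventually_gt_atTop 0] with Y hY
    unfold lagWeight
    rw [mul_pow, ← pow_mul]
    simp
    have : (n.factorial : ℝ) ≠ 0 := by positivity
    field_simp

/-- For fixed N the limit compares the top coefficient of the mass with `lagMain`. What remains is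
√(2πN) (N/e)^N / N!, the quotient of Stirling's approximation by the factorial. -/
lemma tendsto_lagLogRatio_atTop (hN : 0 < N) :
    Tendsto (lagLogRatio N) atTop (𝓝 (Real.log (√Real.pi / Stirling.stirlingSeq N))) := by
  have hN' : (0 : ℝ) < N := by exact_mod_cast hN
  have h1 := (tendsto_lagMass_div hN).log (by positivity)
  have h2 : Tendsto (fun Y : ℝ => Real.log (1 + 4 * (Y ^ 2)⁻¹)) atTop (𝓝 0) := by
    have : Tendsto (fun Y : ℝ => (Y ^ 2)⁻¹) atTop (𝓝 0) :=
      tendsto_inv_atTop_zero.comp (tendsto_pow_atTop (by norm_num))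
    have := ((this.const_mul 4).const_add 1).log (by norm_num)
    simpa using this
  have h3 := tendsto_mul_rStar.log one_ne_zero
  have h4 := (((h1.add_const (1 / 2 * Real.log (2 * Real.pi * N))).add (h2.const_mul (1 / 4))).add
    (h3.const_mul (2 * (N : ℝ)))).sub (tendsto_mul_rStar.const_mul (N : ℝ))
  have e : Real.log ((N : ℝ) ^ (N - 1) / ((N - 1).factorial : ℝ)) +
      1 / 2 * Real.log (2 * Real.pi * N) + 1 / 4 * 0 + 2 * N * Real.log 1 - N * 1 =
      Real.log (√Real.pi / Stirling.stirlingSeq N) := by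
    obtain ⟨n, rfl⟩ : ∃ n, N = n + 1 := ⟨N - 1, by omega⟩
    have hs : √Real.pi / Stirling.stirlingSeq (n + 1) =
        (((n + 1 : ℕ) : ℝ) ^ n / (n.factorial : ℝ)) * √(2 * Real.pi * (n + 1 : ℕ)) *
          Real.exp (-(n + 1 : ℕ)) := by
      rw [Stirling.stirlingSeq, Nat.factorial_succ, div_pow, ← Real.exp_nat_mul, mul_one,
        Real.exp_neg, show 2 * Real.pi * ((n + 1 : ℕ) : ℝ) = Real.pi * (2 * (n + 1 : ℕ)) by ring,
        Real.sqrt_mul Real.pi_pos.le]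
      have hss : √(2 * ((n + 1 : ℕ) : ℝ)) ^ 2 = 2 * (n + 1 : ℕ) := Real.sq_sqrt (by positivity)
      have : 0 < √(2 * ((n + 1 : ℕ) : ℝ)) := by positivity
      have hf : (n.factorial : ℝ) ≠ 0 := by positivity
      push_cast at *
      field_simp
      ring
    have hl : Real.log ((((n + 1 : ℕ) : ℝ) ^ n / (n.factorial : ℝ)) *
        √(2 * Real.pi * (n + 1 : ℕ)) * Real.exp (-(n + 1 : ℕ))) =
        Real.log (((n + 1 : ℕ) : ℝ) ^ n / (n.factorial : ℝ)) +
          Real.log (2 * Real.pi * (n + 1 : ℕ)) / 2 + -(n + 1 : ℕ) := by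
      rw [Real.log_mul (by positivity) (by positivity), Real.log_exp,
        Real.log_mul (by positivity) (by positivity), Real.log_sqrt (by positivity)]
    rw [hs, hl]
    simp
    ring
  rw [← e]
  refine h4.congr' ?_
  filter_upwards [eventually_gt_atTop 0] with Y hY
  have hS := lagMass_pos hN (by positivity : (0 : ℝ) ≤ N * Y ^ 2)
  have e1 : Real.log (Y ^ 2 + 4) = Real.log (1 + 4 * (Y ^ 2)⁻¹) + 2 * Real.log Y := by
    rw [show Y ^ 2 + 4 = (1 + 4 * (Y ^ 2)⁻¹) * Y ^ 2 by field_simp,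
      Real.log_mul (by positivity) (by positivity), Real.log_pow]
    norm_num
  rw [lagLogRatio, e1, Real.log_div hS.ne' (by positivity), Real.log_pow,
    Real.log_mul hY.ne' (rStar_pos Y).ne']
  push_cast [Nat.cast_sub (show 1 ≤ N from hN)]
  ring

/-- The distance to the limit at infinity is at most 40/√(NY), so Y may shrink with N as long as NY
→ ∞; Stirling's formula disposes of the limit itself. -/
lemma tendsto_lagLogRatio {Y : ℕ → ℝ} (hY : ∀ᶠ N in atTop, 0 < Y N)
    (hNY : Tendsto (fun N : ℕ => N * Y N) atTop atTop) :
    Tendsto (fun N : ℕ => lagLogRatio N (Y N)) atTop (𝓝 0) := by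
  have h1 : Tendsto (fun N : ℕ => Real.log (√Real.pi / Stirling.stirlingSeq N)) atTop (𝓝 0) := by
    have := ((tendsto_const_nhds (x := √Real.pi)).div Stirling.tendsto_stirlingSeq_sqrt_pi
      (by positivity)).log
      (by rw [div_self]; norm_num; positivity)
    rwa [div_self (by positivity), Real.log_one] at this
  have h2 : Tendsto (fun N : ℕ => lagLogRatio N (Y N) -
      Real.log (√Real.pi / Stirling.stirlingSeq N)) atTop (𝓝 0) := by
    have h3 : Tendsto (fun N : ℕ => 40 * (√(N * Y N))⁻¹) atTop (𝓝 0) := by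
      simpa using (tendsto_inv_atTop_zero.comp (Real.tendsto_sqrt_atTop.comp hNY)).const_mul 40
    refine squeeze_zero_norm' ?_ h3
    filter_upwards [hY, hNY.eventually_ge_atTop 3, eventually_gt_atTop 0] with N hY hq hN
    have := abs_lagLogRatio_sub_limit_le hN hY hq (tendsto_lagLogRatio_atTop hN)
    rw [Real.norm_eq_abs]
    refine this.trans (le_of_eq ?_)
    rw [Real.sqrt_mul (by positivity)]
    field_simp
  simpa using h2.add h1

end LaguerreLimit

/-! ### Asymptotics of the closed-form density. -/

section DensityAsymptotics

/-- The mean density of imaginary parts in closed form, through the Laguerre sums `lagMass`. -/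
def densityIm (N : ℕ) (γ Y : ℝ) : ℝ :=
  (γ - Y) ^ (N - 2) / γ ^ (N - 1) * Real.exp (-N * (Y * (γ - Y))) *
    (((N : ℝ) - 1) / N * lagMass N (N * Y ^ 2) + (γ - Y) ^ 2 * lagMass (N - 1) (N * Y ^ 2) -
      2 * (γ - Y) * Y * ∑ k ∈ Finset.range N, lagMass k (N * Y ^ 2))

/-- Together with `mul_sum_lagMass` this writes every Laguerre sum in `densityIm` through the mass
and the mean of the single weight `lagWeight N`. -/
lemma lagMass_pred (n : ℕ) (x : ℝ) :
    (n + 1) * lagMass n x = ∑ k ∈ Finset.range (n + 1), lagWeight (n + 1) x k * (n - k) := by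
  rw [Finset.sum_range_succ, sub_self, mul_zero, add_zero, lagMass, Finset.mul_sum]
  refine Finset.sum_congr rfl fun k hk => ?_
  have hk' := Finset.mem_range.1 hk
  have h := Nat.choose_mul_succ_eq n (k + 1)
  have h2 : ((n.choose (k + 1) * (n + 1) : ℕ) : ℝ) =
      ((n + 1).choose (k + 1) * (n + 1 - (k + 1)) : ℕ) := by rw [h]
  rw [show n + 1 - (k + 1) = n - k by omega] at h2
  push_cast [Nat.cast_sub hk'.le] at h2
  unfold lagWeight
  have : (k.factorial : ℝ) ≠ 0 := by positivity
  field_simp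
  linear_combination x ^ k * h2

/-- By Pascal's rule, raising N by one increases the first moment by x · `lagMass N x`. -/
lemma mul_sum_lagMass (N : ℕ) (x : ℝ) :
    x * ∑ k ∈ Finset.range N, lagMass k x = ∑ k ∈ Finset.range N, lagWeight N x k * k := by
  induction N with
  | zero => simp
  | succ n ih =>
    rw [Finset.sum_range_succ, mul_add, ih]
    have h1 : ∑ k ∈ Finset.range n, lagWeight n x k * k =
        ∑ k ∈ Finset.range (n + 1), lagWeight n x k * k := by
      rw [Finset.sum_range_succ, lagWeight_self]; ring
    rw [h1, Finset.sum_range_succ', Finset.sum_range_succ' (n := n), lagMass, Finset.mul_sum]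
    simp only [Nat.cast_zero, mul_zero, add_zero, ← Finset.sum_add_distrib]
    refine Finset.sum_congr rfl fun k _ => ?_
    unfold lagWeight
    rw [Nat.factorial_succ, Nat.choose_succ_succ n (k + 1)]
    push_cast
    have : (k.factorial : ℝ) ≠ 0 := by positivity
    field_simp
    ring

/-- The relative correction to the leading-order density. -/
def densityCorr (N : ℕ) (γ Y : ℝ) : ℝ :=
  ((γ - Y) ^ 2 + 2 * (γ - Y) / Y) * (Y * rStar Y - lagMu N (N * Y ^ 2) / N) -
    (1 + (γ - Y) ^ 2) / N

lemma abs_densityCorr_le {N : ℕ} {γ Y : ℝ} (hN : 0 < N) (hY : 0 < Y) (hYγ : Y < γ) :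
    |densityCorr N γ Y| ≤ ((γ ^ 2 + 2 * γ / Y) * 2 + (1 + γ ^ 2)) / N := by
  have hN' : (0 : ℝ) < N := by exact_mod_cast hN
  obtain ⟨hl, hu⟩ := lagMu_bounds hN hY
  have hg : 0 < γ - Y := by linarith
  have hγ : 0 < γ := hY.trans hYγ
  have h1 : 0 ≤ Y * rStar Y - lagMu N (N * Y ^ 2) / N := by
    rw [sub_nonneg, div_le_iff₀ hN']; linarith
  have h2 : Y * rStar Y - lagMu N (N * Y ^ 2) / N ≤ 2 / N := by
    rw [sub_le_iff_le_add, ← add_div, le_div_iff₀ hN']; linarith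
  have h3 : (γ - Y) ^ 2 ≤ γ ^ 2 := pow_le_pow_left₀ hg.le (by linarith) 2
  have h4 : 2 * (γ - Y) / Y ≤ 2 * γ / Y := by gcongr; linarith
  unfold densityCorr
  calc _ ≤ |((γ - Y) ^ 2 + 2 * (γ - Y) / Y) * (Y * rStar Y - lagMu N (N * Y ^ 2) / N)| +
        |(1 + (γ - Y) ^ 2) / N| := abs_sub _ _
    _ = ((γ - Y) ^ 2 + 2 * (γ - Y) / Y) * (Y * rStar Y - lagMu N (N * Y ^ 2) / N) +
        (1 + (γ - Y) ^ 2) / N := by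
      rw [abs_of_nonneg (by positivity), abs_of_nonneg (by positivity)]
    _ ≤ (γ ^ 2 + 2 * γ / Y) * (2 / N) + (1 + γ ^ 2) / N := by gcongr
    _ = _ := by ring

lemma densityIm_eq {N : ℕ} {γ Y : ℝ} (hN : 2 ≤ N) (hY : 0 < Y) (hYγ : Y < γ) :
    densityIm N γ Y = 1 / √N * (1 / √(2 * Real.pi) * (γ / (γ - Y) ^ 2) *
      (Y ^ (-(3 / 2) : ℝ) * (Y ^ 2 + 4) ^ (-(1 / 4) : ℝ))) * Real.exp (-N * rateΦ γ Y) *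
      (Real.exp (lagLogRatio N Y) * ((1 - rStar Y * (γ - Y)) ^ 2 + densityCorr N γ Y)) := by
  have hN0 : 0 < N := by omega
  have hN' : (0 : ℝ) < N := by exact_mod_cast hN0
  have hγ : 0 < γ := hY.trans hYγ
  have hg : 0 < γ - Y := by linarith
  have hS := lagMass_pos hN0 (by positivity : (0 : ℝ) ≤ N * Y ^ 2)
  have hr := rStar_sq Y
  have hmu : ∑ k ∈ Finset.range N, lagWeight N (N * Y ^ 2) k * k =
      lagMu N (N * Y ^ 2) * lagMass N (N * Y ^ 2) := by
    rw [lagMu, lagMean, div_mul_cancel₀ _ hS.ne']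
  have e1 : ∑ k ∈ Finset.range N, lagMass k (N * Y ^ 2) =
      lagMu N (N * Y ^ 2) * lagMass N (N * Y ^ 2) / (N * Y ^ 2) := by
    rw [eq_div_iff (by positivity), mul_comm, mul_sum_lagMass, hmu]
  have e2 : lagMass (N - 1) (N * Y ^ 2) =
      lagMass N (N * Y ^ 2) * (N - 1 - lagMu N (N * Y ^ 2)) / N := by
    rw [eq_div_iff (by positivity)]
    obtain ⟨n, rfl⟩ : ∃ n, N = n + 1 := ⟨N - 1, by omega⟩
    have h := lagMass_pred n (((n + 1 : ℕ) : ℝ) * Y ^ 2)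
    simp only [mul_sub, Finset.sum_sub_distrib, ← Finset.sum_mul] at h
    rw [hmu] at h
    change _ = lagMass (n + 1) _ * _ - _ at h
    simp only [Nat.add_sub_cancel]
    push_cast at *
    linear_combination h
  -- Divided by the mass and with μ/N replaced by Y r_*, the bracket tends to 1 + g²(1 − Y r_*) − 2g
  -- r_* = (1 − g r_*)², where g = γ − Y. What is left over is `densityCorr`.
  have e3 : ((N : ℝ) - 1) / N * lagMass N (N * Y ^ 2) +
      (γ - Y) ^ 2 * lagMass (N - 1) (N * Y ^ 2) -
      2 * (γ - Y) * Y * ∑ k ∈ Finset.range N, lagMass k (N * Y ^ 2) =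
      lagMass N (N * Y ^ 2) * ((1 - rStar Y * (γ - Y)) ^ 2 + densityCorr N γ Y) := by
    rw [e1, e2, densityCorr]
    field_simp
    linear_combination (-(N * Y * (γ - Y) ^ 2)) * hr
  -- Here (γ − Y)^(N−2)/γ^(N−1) = γ/(γ − Y)² · ((γ − Y)/γ)^N, and the N-th power is the logarithmic
  -- term of Φ.
  have e4 : (γ - Y) ^ (N - 2) / γ ^ (N - 1) * Real.exp (-N * (Y * (γ - Y))) *
      Real.exp (N * (Y * rStar Y - 2 * Real.log (rStar Y))) =
      γ / (γ - Y) ^ 2 * Real.exp (-N * rateΦ γ Y) := by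
    have : Real.exp (-N * rateΦ γ Y) = Real.exp (-N * (Y * (γ - Y))) *
      Real.exp (N * (Y * rStar Y - 2 * Real.log (rStar Y))) * ((γ - Y) / γ) ^ N := by
      have hp : ((γ - Y) / γ) ^ N = Real.exp (N * Real.log ((γ - Y) / γ)) := by
        rw [Real.exp_nat_mul, Real.exp_log (by positivity)]
      rw [hp, ← Real.exp_add, ← Real.exp_add, rateΦ]
      congr 1; ring
    rw [this]
    obtain ⟨n, rfl⟩ : ∃ n, N = n + 2 := ⟨N - 2, by omega⟩
    simp only [Nat.add_sub_cancel, show n + 2 - 1 = n + 1 by omega, div_pow]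
    field_simp
    ring
  rw [densityIm, e3, lagMass_eq_exp_mul hN0 hY, lagMain]
  have e5 : 1 / √(2 * Real.pi * N) = 1 / √(2 * Real.pi) * (1 / √N) := by
    rw [Real.sqrt_mul (by positivity)]; field_simp
  rw [e5]
  linear_combination (1 / √(2 * Real.pi) * (1 / √N) * Y ^ (-(3 / 2) : ℝ) *
    (Y ^ 2 + 4) ^ (-(1 / 4) : ℝ) * Real.exp (lagLogRatio N Y) *
    ((1 - rStar Y * (γ - Y)) ^ 2 + densityCorr N γ Y)) * e4

lemma prefactorΨ_eq {γ Y : ℝ} (hY : 0 < Y) :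
    prefactorΨ γ Y = 1 / √(2 * Real.pi) * (γ / (γ - Y) ^ 2) *
      (Y ^ (-(3 / 2) : ℝ) * (Y ^ 2 + 4) ^ (-(1 / 4) : ℝ)) * (1 - rStar Y * (γ - Y)) ^ 2 := by
  rw [prefactorΨ, Real.rpow_neg hY.le, Real.rpow_neg (by positivity)]
  field_simp

section Sequence

variable {γ : ℝ} {Y : ℕ → ℝ}

/-- Up to a common factor the error is e^(`lagLogRatio`)(Q + `densityCorr`) − Q with Q = (1 − r_*(γ
− Y))² bounded, so it tends to zero. Keeping Y below a fixed γ' < γ bounds γ/(γ − Y)². -/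
lemma densityIm_sub_isLittleO (hγ : 0 < γ) (hY : ∀ᶠ N in atTop, 0 < Y N)
    {γ' : ℝ} (hγ' : γ' < γ) (hYγ : ∀ᶠ N in atTop, Y N ≤ γ')
    (hNY : Tendsto (fun N : ℕ => N * Y N) atTop atTop) :
    (fun N : ℕ => densityIm N γ (Y N) - 1 / √(N : ℝ) * prefactorΨ γ (Y N) *
      Real.exp (-(N : ℝ) * rateΦ γ (Y N))) =o[atTop] fun N : ℕ =>
        1 / √(N : ℝ) * (Y N) ^ (-(3 / 2) : ℝ) * Real.exp (-(N : ℝ) * rateΦ γ (Y N)) := by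
  have hcorr : Tendsto (fun N => densityCorr N γ (Y N)) atTop (𝓝 0) := by
    have h1 : Tendsto (fun N : ℕ => 4 * γ * (N * Y N)⁻¹ + (3 * γ ^ 2 + 1) * (N : ℝ)⁻¹) atTop
        (𝓝 0) := by
      simpa using ((tendsto_inv_atTop_zero.comp hNY).const_mul (4 * γ)).add
        (tendsto_inv_atTop_nhds_zero_nat.const_mul (3 * γ ^ 2 + 1))
    refine squeeze_zero_norm' ?_ h1
    filter_upwards [hY, hYγ, eventually_gt_atTop 0] with N h0 h1 hN
    have hN' : (0 : ℝ) < N := by exact_mod_cast hN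
    refine (abs_densityCorr_le hN h0 (h1.trans_lt hγ')).trans (le_of_eq ?_)
    field_simp; ring
  have hG : Tendsto (fun N => Real.exp (lagLogRatio N (Y N))) atTop (𝓝 1) := by
    simpa using (tendsto_lagLogRatio hY hNY).rexp
  have hbdd : ∀ᶠ N in atTop, |(1 - rStar (Y N) * (γ - Y N)) ^ 2| ≤ (1 + γ) ^ 2 := by
    filter_upwards [hY, hYγ] with N h0 h1
    have h2 := rStar_pos (Y N)
    have h3 := rStar_le_one h0.le
    have h4 : 0 < γ - Y N := by linarith
    rw [abs_of_nonneg (sq_nonneg _), sq_le_sq, abs_of_pos (by positivity : 0 < 1 + γ)]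
    have h5 : rStar (Y N) * (γ - Y N) ≤ 1 * γ := mul_le_mul h3 (by linarith) h4.le (by norm_num)
    exact abs_le.2 ⟨by linarith, by linarith [mul_pos h2 h4]⟩
  have hdiff : Tendsto (fun N => Real.exp (lagLogRatio N (Y N)) *
      ((1 - rStar (Y N) * (γ - Y N)) ^ 2 + densityCorr N γ (Y N)) -
      (1 - rStar (Y N) * (γ - Y N)) ^ 2) atTop (𝓝 0) := by
    have h1 : Tendsto (fun N => |Real.exp (lagLogRatio N (Y N)) - 1| * (1 + γ) ^ 2 +
        |Real.exp (lagLogRatio N (Y N)) * densityCorr N γ (Y N)|) atTop (𝓝 0) := by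
      have a := ((hG.sub_const 1).abs.mul_const ((1 + γ) ^ 2)).add (hG.mul hcorr).abs
      simpa using a
    refine squeeze_zero_norm' ?_ h1
    filter_upwards [hbdd] with N hb
    rw [Real.norm_eq_abs]
    calc _ = |(Real.exp (lagLogRatio N (Y N)) - 1) * (1 - rStar (Y N) * (γ - Y N)) ^ 2 +
          Real.exp (lagLogRatio N (Y N)) * densityCorr N γ (Y N)| := by ring_nf
      _ ≤ _ := abs_add_le _ _
      _ ≤ _ := by rw [abs_mul]; gcongr
  rw [isLittleO_iff]
  intro c hc
  have hK : 0 < 1 / √(2 * Real.pi) * (γ / (γ - γ') ^ 2) := by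
    have : 0 < γ - γ' := by linarith
    positivity
  have hsmall := (tendsto_order.1 hdiff.abs).2 (c / (1 / √(2 * Real.pi) * (γ / (γ - γ') ^ 2)))
    (by rw [abs_zero]; positivity)
  filter_upwards [hsmall, hY, hYγ, eventually_ge_atTop 2] with N hs h0 h1 hN
  have hγY : 0 < γ - γ' := by linarith
  rw [densityIm_eq hN h0 (h1.trans_lt hγ'), prefactorΨ_eq h0]
  set D := Real.exp (lagLogRatio N (Y N)) *
      ((1 - rStar (Y N) * (γ - Y N)) ^ 2 + densityCorr N γ (Y N)) -
      (1 - rStar (Y N) * (γ - Y N)) ^ 2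
  have e : ∀ a b p q E F Q : ℝ, a * (b * (p * q)) * E * F - a * (b * (p * q) * Q) * E =
      (a * p * E) * (b * q * (F - Q)) := by intros; ring
  rw [e, norm_mul, mul_comm]
  refine mul_le_mul_of_nonneg_right ?_ (norm_nonneg _)
  change ‖_ * D‖ ≤ c
  rw [norm_mul, norm_mul, Real.norm_of_nonneg (show 0 ≤ 1 / √(2 * Real.pi) * (γ / (γ - Y N) ^ 2) by
    positivity), Real.norm_of_nonneg (by positivity)]
  have h5 : (Y N ^ 2 + 4) ^ (-(1 / 4) : ℝ) ≤ 1 :=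
    Real.rpow_le_one_of_one_le_of_nonpos (by nlinarith [sq_nonneg (Y N)]) (by norm_num)
  have h6 : γ / (γ - Y N) ^ 2 ≤ γ / (γ - γ') ^ 2 := by
    gcongr
  calc 1 / √(2 * Real.pi) * (γ / (γ - Y N) ^ 2) * (Y N ^ 2 + 4) ^ (-(1 / 4) : ℝ) * ‖D‖
      ≤ 1 / √(2 * Real.pi) * (γ / (γ - γ') ^ 2) * 1 *
        (c / (1 / √(2 * Real.pi) * (γ / (γ - γ') ^ 2))) := by
        gcongr
        exact hs.le
    _ = c := by field_simp

/-- For the ratio to tend to one, the correction O(1/(NY)) must be negligible against the square (1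
− r_*(γ − Y))² itself; `hdom` says exactly that. -/
lemma densityIm_isEquivalent (hγ : 0 < γ) (hY : ∀ᶠ N in atTop, 0 < Y N)
    (hYγ : ∀ᶠ N in atTop, Y N < γ) (hNY : Tendsto (fun N : ℕ => N * Y N) atTop atTop)
    (h0 : ∀ᶠ N in atTop, (1 - rStar (Y N) * (γ - Y N)) ^ 2 ≠ 0)
    (hdom : Tendsto (fun N : ℕ => (N * Y N * (1 - rStar (Y N) * (γ - Y N)) ^ 2)⁻¹) atTop (𝓝 0)) :
    IsEquivalent atTop (fun N : ℕ => densityIm N γ (Y N))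
      (fun N : ℕ => 1 / √(N : ℝ) * prefactorΨ γ (Y N) * Real.exp (-(N : ℝ) * rateΦ γ (Y N))) := by
  have hG : Tendsto (fun N => Real.exp (lagLogRatio N (Y N))) atTop (𝓝 1) := by
    simpa using (tendsto_lagLogRatio hY hNY).rexp
  have hcorr : Tendsto (fun N => densityCorr N γ (Y N) / (1 - rStar (Y N) * (γ - Y N)) ^ 2) atTop
      (𝓝 0) := by
    have h1 : Tendsto (fun N : ℕ => (4 * γ + (3 * γ ^ 2 + 1) * γ) *
        (N * Y N * (1 - rStar (Y N) * (γ - Y N)) ^ 2)⁻¹) atTop (𝓝 0) := by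
      simpa using hdom.const_mul (4 * γ + (3 * γ ^ 2 + 1) * γ)
    refine squeeze_zero_norm' ?_ h1
    filter_upwards [hY, hYγ, eventually_gt_atTop 0, h0] with N h0 h1 hN h2
    have hN' : (0 : ℝ) < N := by exact_mod_cast hN
    have h3 : 0 < (1 - rStar (Y N) * (γ - Y N)) ^ 2 := lt_of_le_of_ne (sq_nonneg _) (Ne.symm h2)
    rw [norm_div, Real.norm_of_nonneg h3.le, mul_inv, ← mul_assoc, ← div_eq_mul_inv _ (_ ^ 2)]
    refine div_le_div_of_nonneg_right ?_ h3.le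
    refine (abs_densityCorr_le hN h0 h1).trans ?_
    rw [← div_eq_mul_inv, div_le_div_iff₀ hN' (by positivity)]
    have : ((γ ^ 2 + 2 * γ / Y N) * 2 + (1 + γ ^ 2)) * (N * Y N) =
        (4 * γ + (3 * γ ^ 2 + 1) * Y N) * N := by field_simp; ring
    rw [this]
    gcongr
  have hev : ∀ᶠ N : ℕ in atTop, 1 / √(N : ℝ) * prefactorΨ γ (Y N) *
      Real.exp (-(N : ℝ) * rateΦ γ (Y N)) ≠ 0 := by
    filter_upwards [hY, hYγ, eventually_gt_atTop 0, h0] with N h0 h1 hN h2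
    have hN' : (0 : ℝ) < N := by exact_mod_cast hN
    have hg : 0 < γ - Y N := by linarith
    rw [prefactorΨ_eq h0]
    refine mul_ne_zero (mul_ne_zero (by positivity) (mul_ne_zero (by positivity) h2))
      (Real.exp_pos _).ne'
  rw [isEquivalent_iff_tendsto_one hev]
  have hlim : Tendsto (fun N => Real.exp (lagLogRatio N (Y N)) *
      (1 + densityCorr N γ (Y N) / (1 - rStar (Y N) * (γ - Y N)) ^ 2)) atTop (𝓝 1) := by
    simpa using hG.mul (hcorr.const_add 1)
  refine hlim.congr' ?_
  filter_upwards [hY, hYγ, eventually_ge_atTop 2, h0] with N h0 h1 hN h2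
  have hN' : (0 : ℝ) < N := by exact_mod_cast (by omega : 0 < N)
  have hg : 0 < γ - Y N := by linarith
  simp only [Pi.div_apply]
  rw [densityIm_eq hN h0 h1, prefactorΨ_eq h0]
  set Q := (1 - rStar (Y N) * (γ - Y N)) ^ 2
  have h7 : Y N ^ (-(3 / 2) : ℝ) ≠ 0 := by positivity
  have h8 : (Y N ^ 2 + 4) ^ (-(1 / 4) : ℝ) ≠ 0 := by positivity
  have h9 : 1 / √(2 * Real.pi) * (γ / (γ - Y N) ^ 2) ≠ 0 := by positivity
  generalize 1 / √(2 * Real.pi) * (γ / (γ - Y N) ^ 2) = b at *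
  generalize Y N ^ (-(3 / 2) : ℝ) = p at *
  generalize (Y N ^ 2 + 4) ^ (-(1 / 4) : ℝ) = q at *
  field_simp

end Sequence

lemma scaledY_pos {ε y : ℝ} (hy : 0 < y) {N : ℕ} (hN : 0 < N) : 0 < scaledY ε y N := by
  have hN' : (0 : ℝ) < N := by exact_mod_cast hN
  unfold scaledY; positivity

lemma mul_scaledY {ε y : ℝ} {N : ℕ} (hN : 0 < N) :
    N * scaledY ε y N = y * (N : ℝ) ^ ε := by
  have hN' : (0 : ℝ) < N := by exact_mod_cast hN
  rw [scaledY, mul_left_comm]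
  congr 1
  nth_rewrite 1 [← Real.rpow_one (N : ℝ)]
  rw [← Real.rpow_add hN']
  congr 1; ring

lemma tendsto_natCast_rpow_atTop {ε : ℝ} (hε : 0 < ε) :
    Tendsto (fun N : ℕ => (N : ℝ) ^ ε) atTop atTop :=
  (tendsto_rpow_atTop hε).comp tendsto_natCast_atTop_atTop

lemma tendsto_mul_scaledY {ε y : ℝ} (hε : 0 < ε) (hy : 0 < y) :
    Tendsto (fun N : ℕ => N * scaledY ε y N) atTop atTop := by
  refine ((tendsto_natCast_rpow_atTop hε).const_mul_atTop hy).congr' ?_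
  filter_upwards [eventually_gt_atTop 0] with N hN
  rw [mul_scaledY hN]

lemma scaledY_one {y : ℝ} (N : ℕ) : scaledY 1 y N = y := by simp [scaledY]

lemma tendsto_scaledY_zero {ε y : ℝ} (hε1 : ε < 1) :
    Tendsto (fun N : ℕ => scaledY ε y N) atTop (𝓝 0) := by
  have := ((tendsto_rpow_neg_atTop (sub_pos.2 hε1)).comp tendsto_natCast_atTop_atTop).const_mul y
  simpa [scaledY] using this

lemma scaledY_eventually_le {ε y γ : ℝ} (hγ : 0 < γ) (hε1 : ε ≤ 1) (hyγ : ε = 1 → y < γ) :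
    ∃ γ' < γ, ∀ᶠ N : ℕ in atTop, scaledY ε y N ≤ γ' := by
  rcases hε1.eq_or_lt with rfl | h
  · exact ⟨y, hyγ rfl, Eventually.of_forall fun N => (scaledY_one N).le⟩
  · exact ⟨γ / 2, by linarith, (tendsto_scaledY_zero h).eventually_le_const (by linarith)⟩

/-- The square converges to a nonzero limit when ε = 1, where it is constant and vanishes only at
`yMax`, and also when ε < 1 and γ ≠ 1, where the limit is (1 − γ)². Only γ = 1 with ε < 1 requires a
rate. -/
lemma densityIm_scaledY_isEquivalent {ε y γ : ℝ} (hγ : 0 < γ) (hε : 0 < ε) (hε1 : ε ≤ 1)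
    (hy : 0 < y) (hyγ : ε = 1 → y < γ) (hd1 : γ = 1 → 2 / 3 < ε)
    (hd2 : ¬ (1 < γ ∧ ε = 1 ∧ y = yMax γ)) :
    IsEquivalent atTop (fun N : ℕ => densityIm N γ (scaledY ε y N))
      (fun N : ℕ => 1 / √(N : ℝ) * prefactorΨ γ (scaledY ε y N) *
        Real.exp (-(N : ℝ) * rateΦ γ (scaledY ε y N))) := by
  obtain ⟨γ', hγ', hle⟩ := scaledY_eventually_le hγ hε1 hyγ
  have hpos : ∀ᶠ N : ℕ in atTop, 0 < scaledY ε y N := by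
    filter_upwards [eventually_gt_atTop 0] with N hN using scaledY_pos hy hN
  have hlt : ∀ᶠ N : ℕ in atTop, scaledY ε y N < γ := hle.mono fun N h => h.trans_lt hγ'
  have hNY := tendsto_mul_scaledY hε hy
  have of_limit : ∀ l : ℝ, l ≠ 0 → Tendsto (fun N : ℕ =>
      (1 - rStar (scaledY ε y N) * (γ - scaledY ε y N)) ^ 2) atTop (𝓝 l) →
      IsEquivalent atTop (fun N : ℕ => densityIm N γ (scaledY ε y N))
      (fun N : ℕ => 1 / √(N : ℝ) * prefactorΨ γ (scaledY ε y N) *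
        Real.exp (-(N : ℝ) * rateΦ γ (scaledY ε y N))) := by
    intro l hl ht
    refine densityIm_isEquivalent hγ hpos hlt hNY (ht.eventually_ne hl) ?_
    have := (tendsto_inv_atTop_zero.comp hNY).mul (ht.inv₀ hl)
    rw [zero_mul] at this
    refine this.congr fun N => ?_
    simp [mul_comm]
  rcases hε1.eq_or_lt with rfl | h
  · refine of_limit ((1 - rStar y * (γ - y)) ^ 2) ?_ 
      (by simp only [scaledY_one]; exact tendsto_const_nhds)
    have hyγ' := hyγ rfl
    refine pow_ne_zero 2 fun h0 => ?_
    rcases le_or_gt γ 1 with h1 | h1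
    · have := rStar_lt_one hy
      have := rStar_pos y
      nlinarith
    · refine hd2 ⟨h1, rfl, ?_⟩
      have hm := (yMax_lt_yMin h1).trans (yMin_lt h1)
      refine (strictAnti_rStar_mul (γ := γ)).injOn (show y ∈ Iio γ from hyγ')
        (show yMax γ ∈ Iio γ from hm) ?_
      rw [rStar_yMax h1]; linarith
  · have hY0 := tendsto_scaledY_zero (y := y) h
    by_cases h1 : γ = 1
    · subst h1
      have hε' := hd1 rfl
      -- As r_* ≤ 1, the square is at least Y², so NY times it is at least NY³ = y³N^(3ε−2). This is
      -- the source of the threshold 2/3.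
      have hge : ∀ Y : ℝ, 0 < Y → Y < 1 → Y ≤ 1 - rStar Y * (1 - Y) := by
        intro Y h0 h2
        have h3 := rStar_le_one h0.le
        nlinarith
      refine densityIm_isEquivalent one_pos hpos hlt hNY ?_ ?_
      · filter_upwards [hpos, hlt] with N h2 h3
        exact pow_ne_zero 2 (lt_of_lt_of_le h2 (hge _ h2 h3)).ne'
      · have hlim : Tendsto (fun N : ℕ => (y ^ 3 * (N : ℝ) ^ (3 * ε - 2))⁻¹) atTop (𝓝 0) :=
          tendsto_inv_atTop_zero.comp
            ((tendsto_natCast_rpow_atTop (by linarith)).const_mul_atTop (by positivity))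
        refine squeeze_zero' (Eventually.of_forall fun N => ?_) ?_ hlim
        · unfold scaledY; positivity
        · filter_upwards [hpos, hlt, eventually_gt_atTop 0] with N h2 h3 hN
          have hN' : (0 : ℝ) < N := by exact_mod_cast hN
          have e : y ^ 3 * (N : ℝ) ^ (3 * ε - 2) = N * scaledY ε y N * scaledY ε y N ^ 2 := by
            have : N * scaledY ε y N * scaledY ε y N ^ 2 = (N * scaledY ε y N) ^ 3 / N ^ 2 := by
              field_simp
            rw [this, mul_scaledY hN, mul_pow, ← Real.rpow_natCast ((N : ℝ) ^ ε),
              ← Real.rpow_mul hN'.le, Real.rpow_sub hN', mul_div_assoc]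
            congr 2
            · congr 1; push_cast; ring
            · norm_num
          rw [e]
          gcongr
          exact hge _ h2 h3
    · refine of_limit ((1 - γ) ^ 2) (pow_ne_zero 2 (sub_ne_zero.2 (Ne.symm h1))) ?_
      have hc : Continuous fun Y : ℝ => (1 - rStar Y * (γ - Y)) ^ 2 := by
        have : Continuous rStar := contDiff_rStar (n := 0).continuous
        fun_prop
      have h2 : Tendsto _ _ (𝓝 ((1 - rStar 0 * (γ - 0)) ^ 2)) := (hc.tendsto 0).comp hY0
      rw [rStar_zero, sub_zero, one_mul] at h2
      exact h2

end DensityAsymptotics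

/-! ### The area formula with multiplicity. -/

section AreaFormula

variable {E : Type*} [NormedAddCommGroup E] [NormedSpace ℝ E] [FiniteDimensional ℝ E]
  [MeasurableSpace E] [BorelSpace E]

/-- On small pieces f is approximated by an invertible linear map A with error constant below
1/‖A⁻¹‖, which forces injectivity; countably many pieces suffice. -/
lemma exists_partition_injOn {s : Set E} {f : E → E} {f' : E → E →L[ℝ] E}
    (hs : MeasurableSet s) (hf : ∀ x ∈ s, HasFDerivAt f (f' x) x)
    (hdet : ∀ x ∈ s, (f' x).det ≠ 0) :
    ∃ u : ℕ → Set E, Pairwise (Function.onFun Disjoint u) ∧ (∀ n, MeasurableSet (u n)) ∧ (⋃ n, u n) = s ∧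
      ∀ n, InjOn f (u n) := by
  classical
  let r : (E →L[ℝ] E) → NNReal := fun A =>
    if h : A.det ≠ 0 then
      (if Subsingleton E then 1 else ‖((A.toContinuousLinearEquivOfDetNeZero h).symm : E →L[ℝ] E)‖₊⁻¹ / 2)
    else 1
  have hr : ∀ A, r A ≠ 0 := by
    intro A
    by_cases h : A.det ≠ 0
    · by_cases h2 : Subsingleton E
      · simp [r, h2]
      · have : Nontrivial E := not_subsingleton_iff_nontrivial.1 h2
        have := (A.toContinuousLinearEquivOfDetNeZero h).nnnorm_symm_pos
        simp only [r, dif_pos h, if_neg h2]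
        positivity
    · simp only [r, dif_neg h]; exact one_ne_zero
  obtain ⟨t, A, ht1, ht2, ht3, ht4, ht5⟩ := exists_partition_approximatesLinearOn_of_hasFDerivWithinAt
    f s f' (fun x hx => (hf x hx).hasFDerivWithinAt) r hr
  refine ⟨fun n => s ∩ t n, fun i j hij => (ht1 hij).mono inter_subset_right inter_subset_right,
    fun n => hs.inter (ht2 n), ?_, fun n => ?_⟩
  · rw [← inter_iUnion]; exact inter_eq_left.2 ht3
  · rcases s.eq_empty_or_nonempty with h | h
    · simp [h]
    obtain ⟨y, hy, hA⟩ := ht5 h n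
    have hd : (A n).det ≠ 0 := hA ▸ hdet y hy
    have h4 := ht4 n
    by_cases h2 : Subsingleton E
    · exact fun a _ b _ _ => Subsingleton.elim a b
    have h2' : Nontrivial E := not_subsingleton_iff_nontrivial.1 h2
    have hr' : r (A n) < ‖(((A n).toContinuousLinearEquivOfDetNeZero hd).symm : E →L[ℝ] E)‖₊⁻¹ := by
      have := ((A n).toContinuousLinearEquivOfDetNeZero hd).nnnorm_symm_pos
      simp only [r, dif_pos hd, if_neg h2]
      exact NNReal.half_lt_self (by positivity)
    rw [← (A n).coe_toContinuousLinearEquivOfDetNeZero hd] at h4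
    refine h4.injOn (Or.inr ?_)
    rwa [(A n).coe_toContinuousLinearEquivOfDetNeZero hd]

/-- The area formula, with multiplicity. -/
theorem lintegral_abs_det_mul_eq_lintegral_count (μ : Measure E) [μ.IsAddHaarMeasure]
    {f : E → E} {f' : E → E →L[ℝ] E} (hf : ∀ x, HasFDerivAt f (f' x) x)
    {C : Set E} (hC : MeasurableSet C) {W : E → ℝ≥0∞} (hW : Measurable W) :
    ∫⁻ x in C, ENNReal.ofReal |(f' x).det| * W (f x) ∂μ =
      ∫⁻ y, Measure.count (f ⁻¹' {y} ∩ C) * W y ∂μ := by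
  have hf'm : Measurable f' := by
    have : f' = fderiv ℝ f := funext fun x => (hf x).fderiv.symm
    rw [this]; exact measurable_fderiv ℝ f
  have hdm : Measurable fun x => (f' x).det := ContinuousLinearMap.continuous_det.measurable.comp hf'm
  have hcont : Continuous f := continuous_iff_continuousAt.2 fun x => (hf x).continuousAt
  set Z : Set E := {x | (f' x).det = 0} with hZdef
  have hZ : MeasurableSet Z := hdm (measurableSet_singleton 0)
  -- Critical values form a null set, so fibres over them are irrelevant; critical points also
  -- contribute nothing to the left side.
  have hZimg : μ (f '' Z) = 0 := addHaar_image_eq_zero_of_det_fderivWithin_eq_zero μ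
    (fun x _ => (hf x).hasFDerivWithinAt) fun x hx => hx
  set s := C \ Z with hs
  have hsm : MeasurableSet s := hC.diff hZ
  obtain ⟨u, hu1, hu2, hu3, hu4⟩ := exists_partition_injOn hsm (fun x _ => hf x)
    (fun x hx => hx.2)
  have hCs : ∫⁻ x in C, ENNReal.ofReal |(f' x).det| * W (f x) ∂μ =
      ∫⁻ x in s, ENNReal.ofReal |(f' x).det| * W (f x) ∂μ := by
    have h1 : ∀ x ∈ C ∩ Z, ENNReal.ofReal |(f' x).det| * W (f x) = 0 := by
      intro x hx
      rw [show (f' x).det = 0 from hx.2]; simp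
    rw [← lintegral_inter_add_sdiff _ C hZ, setLIntegral_congr_fun (hC.inter hZ) h1]
    simp [hs]
  have himg : ∀ n, MeasurableSet (f '' u n) := fun n =>
    measurable_image_of_fderivWithin (hu2 n) (fun x _ => (hf x).hasFDerivWithinAt) (hu4 n)
  -- A fibre meets each piece in at most one point, so its cardinality is the number of pieces whose
  -- image contains y.
  have hcount : ∀ y, Measure.count (f ⁻¹' {y} ∩ s) = ∑' n, (f '' u n).indicator 1 y := by
    intro y
    have hm : MeasurableSet (f ⁻¹' {y}) := hcont.measurable (measurableSet_singleton y)
    rw [← hu3, inter_iUnion, measure_iUnion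
      (fun i j hij => (hu1 hij).mono inter_subset_right inter_subset_right)
      (fun n => hm.inter (hu2 n))]
    refine tsum_congr fun n => ?_
    by_cases hy : y ∈ f '' u n
    · obtain ⟨x, hx, rfl⟩ := hy
      have : f ⁻¹' {f x} ∩ u n = {x} := by
        ext z
        constructor
        · rintro ⟨h1, h2⟩; exact hu4 n h2 hx h1
        · rintro rfl; exact ⟨rfl, hx⟩
      rw [this, Measure.count_singleton, indicator_of_mem (mem_image_of_mem f hx)]; rfl
    · have : f ⁻¹' {y} ∩ u n = ∅ := by
        ext z
        simp only [mem_inter_iff, mem_preimage, mem_singleton_iff, mem_empty_iff_false, iff_false]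
        rintro ⟨h1, h2⟩
        exact hy ⟨z, h2, h1⟩
      rw [this, measure_empty, indicator_of_notMem hy]
  have hae : ∀ᵐ y ∂μ, Measure.count (f ⁻¹' {y} ∩ C) * W y =
      ∑' n, (f '' u n).indicator W y := by
    have : ∀ᵐ y ∂μ, y ∉ f '' Z := measure_eq_zero_iff_ae_notMem.1 hZimg
    filter_upwards [this] with y hy
    have h1 : f ⁻¹' {y} ∩ C = f ⁻¹' {y} ∩ s := by
      ext x
      simp only [hs, mem_inter_iff, mem_preimage, mem_singleton_iff, Set.mem_sdiff]
      constructor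
      · rintro ⟨h1, h2⟩
        exact ⟨h1, h2, fun h3 => hy ⟨x, h3, h1⟩⟩
      · rintro ⟨h1, h2, _⟩
        exact ⟨h1, h2⟩
    rw [h1, hcount, ← ENNReal.tsum_mul_right]
    refine tsum_congr fun n => ?_
    by_cases hy : y ∈ f '' u n
    · simp [indicator_of_mem hy]
    · simp [indicator_of_notMem hy]
  rw [hCs, lintegral_congr_ae hae, lintegral_tsum fun n => (hW.indicator (himg n)).aemeasurable,
    ← hu3, lintegral_iUnion hu2 hu1]
  refine tsum_congr fun n => ?_
  rw [lintegral_indicator (himg n), lintegral_image_eq_lintegral_abs_det_fderiv_mul μ (hu2 n)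
    (fun x _ => (hf x).hasFDerivWithinAt) (hu4 n)]

end AreaFormula

/-! ### Real coordinates on Hermitian matrices, unitary conjugation and bordering. -/

section HermitianCoordinates

open Matrix

variable {n : ℕ}

lemma hermitianOf_isHermitian (x : Fin n → Fin n → ℝ) : (hermitianOf x).IsHermitian := by
  ext i j
  rw [conjTranspose_apply]
  simp only [hermitianOf, of_apply]
  rcases lt_trichotomy i j with h | h | h
  · simp [h.ne, h.ne', h, h.not_gt, sub_eq_add_neg]
  · subst h; simp
  · simp [h.ne, h.ne', h, h.not_gt, sub_eq_add_neg]

/-- The coordinates of a Hermitian matrix, inverse to `hermitianOf`. -/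
def hermCoord (M : Matrix (Fin n) (Fin n) ℂ) (i j : Fin n) : ℝ :=
  if i = j then (M i i).re else if i < j then (M i j).re else (M j i).im

lemma hermCoord_hermitianOf (x : Fin n → Fin n → ℝ) : hermCoord (hermitianOf x) = x := by
  ext i j
  simp only [hermCoord, hermitianOf, of_apply]
  rcases lt_trichotomy i j with h | h | h
  · simp [h.ne, h]
  · subst h; simp
  · simp [h.ne, h.ne', h, h.not_gt]

lemma hermitianOf_hermCoord {M : Matrix (Fin n) (Fin n) ℂ} (hM : M.IsHermitian) :
    hermitianOf (hermCoord M) = M := by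
  ext i j
  simp only [hermCoord, hermitianOf, of_apply]
  rcases lt_trichotomy i j with h | h | h
  · simp [h.ne, h.ne', h, h.not_gt, Complex.re_add_im]
  · subst h
    have := hM.apply i i
    simpa using (Complex.conj_eq_iff_re.1 this)
  · rw [← hM.apply i j]
    simp only [h.ne', h.ne, h, h.not_gt, if_true, if_false]
    apply Complex.ext <;> simp

lemma hermitianOf_add (x y : Fin n → Fin n → ℝ) :
    hermitianOf (x + y) = hermitianOf x + hermitianOf y := by
  ext i j
  simp only [hermitianOf, of_apply, Matrix.add_apply, Pi.add_apply]
  split_ifs <;> push_cast <;> ring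

lemma hermitianOf_smul (c : ℝ) (x : Fin n → Fin n → ℝ) :
    hermitianOf (c • x) = (c : ℂ) • hermitianOf x := by
  ext i j
  simp only [hermitianOf, of_apply, Matrix.smul_apply, Pi.smul_apply, smul_eq_mul]
  split_ifs <;> push_cast <;> ring

lemma continuous_hermitianOf : Continuous (hermitianOf (N := n)) := by
  refine continuous_matrix fun i j => ?_
  simp only [hermitianOf, of_apply]
  split_ifs <;> fun_prop

/-- `Tr H²` in coordinates. -/
def trSq (x : Fin n → Fin n → ℝ) : ℝ := ((hermitianOf x * hermitianOf x).trace).re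

lemma continuous_trSq : Continuous (trSq (n := n)) := by
  have := continuous_hermitianOf (n := n)
  unfold trSq
  fun_prop

/-- Conjugation of a Hermitian matrix by a unitary matrix, in coordinates. -/
def conjCoord (U : Matrix (Fin n) (Fin n) ℂ) : (Fin n → Fin n → ℝ) →ₗ[ℝ] (Fin n → Fin n → ℝ) where
  toFun x := hermCoord (U * hermitianOf x * Uᴴ)
  map_add' x y := by
    rw [hermitianOf_add, Matrix.mul_add, Matrix.add_mul]
    ext i j
    simp only [hermCoord, Matrix.add_apply, Pi.add_apply, Complex.add_re, Complex.add_im]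
    split_ifs <;> rfl
  map_smul' c x := by
    rw [hermitianOf_smul, Matrix.mul_smul, Matrix.smul_mul]
    ext i j
    simp only [hermCoord, Matrix.smul_apply, Pi.smul_apply, smul_eq_mul, RingHom.id_apply]
    split_ifs <;> simp

lemma hermitianOf_conjCoord (U : Matrix (Fin n) (Fin n) ℂ) (x : Fin n → Fin n → ℝ) :
    hermitianOf (conjCoord U x) = U * hermitianOf x * Uᴴ := by
  refine hermitianOf_hermCoord ?_
  rw [IsHermitian, conjTranspose_mul, conjTranspose_mul, conjTranspose_conjTranspose,
    (hermitianOf_isHermitian x).eq, Matrix.mul_assoc]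

lemma trSq_conjCoord {U : Matrix (Fin n) (Fin n) ℂ} (hU : Uᴴ * U = 1) (x : Fin n → Fin n → ℝ) :
    trSq (conjCoord U x) = trSq x := by
  rw [trSq, hermitianOf_conjCoord, trSq]
  congr 1
  calc (U * hermitianOf x * Uᴴ * (U * hermitianOf x * Uᴴ)).trace
      = (U * (hermitianOf x * (Uᴴ * U) * hermitianOf x) * Uᴴ).trace := by
        simp only [Matrix.mul_assoc]
    _ = _ := by
        rw [hU, Matrix.mul_one, trace_mul_comm, ← Matrix.mul_assoc, hU, Matrix.one_mul]

/-- The coordinates of the Hermitian matrix with first column `(a, v)` and remaining block `x`. -/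
def border (a : ℝ) (v : Fin n → ℂ) (x : Fin n → Fin n → ℝ) : Fin (n + 1) → Fin (n + 1) → ℝ :=
  Fin.cons (Fin.cons a fun j => (v j).re) fun i => Fin.cons (-(v i).im) (x i)

variable (a : ℝ) (v : Fin n → ℂ) (x : Fin n → Fin n → ℝ)

@[simp] lemma hermitianOf_border_zero_zero : hermitianOf (border a v x) 0 0 = a := by
  simp [hermitianOf, border]

@[simp] lemma hermitianOf_border_zero_succ (j : Fin n) :
    hermitianOf (border a v x) 0 j.succ = star (v j) := by
  simp only [hermitianOf, border, of_apply]
  simp [(Fin.succ_ne_zero j).symm, Fin.succ_pos]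
  apply Complex.ext <;> simp

@[simp] lemma hermitianOf_border_succ_zero (i : Fin n) :
    hermitianOf (border a v x) i.succ 0 = v i := by
  rw [← (hermitianOf_isHermitian _).apply, hermitianOf_border_zero_succ, star_star]

@[simp] lemma hermitianOf_border_succ_succ (i j : Fin n) :
    hermitianOf (border a v x) i.succ j.succ = hermitianOf x i j := by
  simp [hermitianOf, border]

lemma trSq_border : trSq (border a v x) = a ^ 2 + 2 * ∑ i, ‖v i‖ ^ 2 + trSq x := by
  have h : ∀ i, star (v i) * v i = ((‖v i‖ ^ 2 : ℝ) : ℂ) := fun i => by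
    rw [mul_comm]; simpa using Complex.mul_conj' (v i)
  have h' : ∀ i, v i * star (v i) = ((‖v i‖ ^ 2 : ℝ) : ℂ) := fun i => by
    simpa using Complex.mul_conj' (v i)
  have : (hermitianOf (border a v x) * hermitianOf (border a v x)).trace =
      ((a ^ 2 + 2 * ∑ i, ‖v i‖ ^ 2 : ℝ) : ℂ) + (hermitianOf x * hermitianOf x).trace := by
    simp only [trace, diag_apply, Matrix.mul_apply, Fin.sum_univ_succ,
      hermitianOf_border_zero_zero, hermitianOf_border_zero_succ, hermitianOf_border_succ_zero,
      hermitianOf_border_succ_succ, Finset.sum_add_distrib, h, h']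
    push_cast
    ring
  rw [trSq, this, Complex.add_re, Complex.ofReal_re, trSq]

/-- Bordering only regroups the real coordinates, apart from a reflection in the imaginary parts of
v. -/
lemma measurePreserving_border :
    MeasurePreserving (fun p : ℝ × ((Fin n → ℂ) × (Fin n → Fin n → ℝ)) => border p.1 p.2.1 p.2.2)
      volume volume := by
  have hV : MeasurePreserving (fun v : Fin n → ℂ => ((fun j => (v j).re, fun j => -(v j).im) :
      (Fin n → ℝ) × (Fin n → ℝ))) volume volume := by
    have h1 : MeasurePreserving (fun z : ℂ => ((z.re, -z.im) : ℝ × ℝ)) volume volume :=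
      Complex.volume_preserving_equiv_real_prod.comp Complex.conjLIE.measurePreserving
    have h2 := volume_preserving_pi (fun _ : Fin n => h1)
    exact (volume_measurePreserving_arrowProdEquivProdArrow ℝ ℝ (Fin n)).comp h2
  have hrow : MeasurePreserving (fun p : ℝ × (Fin n → ℝ) => (Fin.cons p.1 p.2 : Fin (n + 1) → ℝ))
      volume volume := by
    have h : (fun p : ℝ × (Fin n → ℝ) => (Fin.cons p.1 p.2 : Fin (n + 1) → ℝ)) =
        (MeasurableEquiv.piFinSuccAbove (fun _ : Fin (n + 1) => ℝ) 0).symm := by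
      funext p
      exact (Fin.insertNth_zero (α := fun _ => ℝ) p.1 p.2).symm
    rw [h]
    exact (volume_preserving_piFinSuccAbove (fun _ : Fin (n + 1) => ℝ) 0).symm
  have hcols : MeasurePreserving (fun p : (Fin n → ℝ) × (Fin n → Fin n → ℝ) =>
      (fun i => Fin.cons (p.1 i) (p.2 i) : Fin n → Fin (n + 1) → ℝ)) volume volume := by
    have h1 := (volume_measurePreserving_arrowProdEquivProdArrow ℝ (Fin n → ℝ) (Fin n)).symm
    exact (volume_preserving_pi (fun _ : Fin n => hrow)).comp h1
  have hall : MeasurePreserving (fun p : (Fin (n + 1) → ℝ) × (Fin n → Fin (n + 1) → ℝ) =>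
      (Fin.cons p.1 p.2 : Fin (n + 1) → Fin (n + 1) → ℝ)) volume volume := by
    have h : (fun p : (Fin (n + 1) → ℝ) × (Fin n → Fin (n + 1) → ℝ) =>
        (Fin.cons p.1 p.2 : Fin (n + 1) → Fin (n + 1) → ℝ)) =
        (MeasurableEquiv.piFinSuccAbove (fun _ : Fin (n + 1) => Fin (n + 1) → ℝ) 0).symm := by
      funext p
      exact (Fin.insertNth_zero (α := fun _ => Fin (n + 1) → ℝ) p.1 p.2).symm
    rw [h]
    exact (volume_preserving_piFinSuccAbove (fun _ : Fin (n + 1) => Fin (n + 1) → ℝ) 0).symm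
  have hshuf : MeasurePreserving (fun p : ℝ × (((Fin n → ℝ) × (Fin n → ℝ)) × (Fin n → Fin n → ℝ)) =>
      ((p.1, p.2.1.1), (p.2.1.2, p.2.2))) volume volume := by
    have h1 : MeasurePreserving (Prod.map (id : ℝ → ℝ) (MeasurableEquiv.prodAssoc :
      ((Fin n → ℝ) × (Fin n → ℝ)) × (Fin n → Fin n → ℝ) ≃ᵐ _)) volume volume :=
      (MeasurePreserving.id volume).prod volume_preserving_prodAssoc
    exact (volume_preserving_prodAssoc.symm).comp h1
  have h3 : MeasurePreserving (Prod.map (id : ℝ → ℝ) (Prod.map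
      (fun v : Fin n → ℂ => ((fun j => (v j).re, fun j => -(v j).im) :
      (Fin n → ℝ) × (Fin n → ℝ))) (id : (Fin n → Fin n → ℝ) → _))) volume volume :=
    (MeasurePreserving.id volume).prod (hV.prod (MeasurePreserving.id volume))
  exact hall.comp ((hrow.prod hcols).comp (hshuf.comp h3))

end HermitianCoordinates

/-! ### Radial integration over complex vectors. -/

section GaussianWeight

open Matrix

variable {n : ℕ}

lemma lintegral_border {F : (Fin (n + 1) → Fin (n + 1) → ℝ) → ℝ≥0∞} (hF : Measurable F) :
    ∫⁻ x, F x = ∫⁻ a, ∫⁻ v, ∫⁻ x, F (border a v x) := by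
  have hb := measurePreserving_border (n := n)
  rw [← hb.lintegral_comp hF]
  have hm : Measurable fun p : ℝ × ((Fin n → ℂ) × (Fin n → Fin n → ℝ)) =>
      F (border p.1 p.2.1 p.2.2) := hF.comp hb.measurable
  rw [Measure.volume_eq_prod, lintegral_prod _ hm.aemeasurable]
  refine lintegral_congr fun a => ?_
  have hm' : Measurable fun p : (Fin n → ℂ) × (Fin n → Fin n → ℝ) => F (border a p.1 p.2) :=
    hm.comp measurable_prodMk_left
  exact lintegral_prod _ hm'.aemeasurable

/-- Polar coordinates and the substitution t = r². -/
lemma lintegral_complex_norm_sq {f : ℝ → ℝ≥0∞} (hf : Measurable f) :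
    ∫⁻ z : ℂ, f (‖z‖ ^ 2) = ENNReal.ofReal Real.pi * ∫⁻ t in Ioi 0, f t := by
  rw [← Complex.lintegral_comp_polarCoord_symm, polarCoord_target]
  have h1 : ∀ p ∈ Ioi (0 : ℝ) ×ˢ Ioo (-Real.pi) Real.pi,
      ENNReal.ofReal p.1 • f (‖Complex.polarCoord.symm p‖ ^ 2) =
        ENNReal.ofReal p.1 * f (p.1 ^ 2) := by
    intro p _
    rw [Complex.norm_polarCoord_symm, sq_abs, smul_eq_mul]
  rw [setLIntegral_congr_fun (measurableSet_Ioi.prod measurableSet_Ioo) h1,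
    Measure.volume_eq_prod, ← Measure.prod_restrict, lintegral_prod _ (by fun_prop)]
  simp only [lintegral_const, Measure.restrict_apply MeasurableSet.univ, univ_inter, Real.volume_Ioo]
  have himg : (fun r : ℝ => r ^ 2) '' Ioi 0 = Ioi 0 := by
    ext t
    constructor
    · rintro ⟨r, hr, rfl⟩; exact pow_pos (mem_Ioi.1 hr) 2
    · intro ht; exact ⟨√t, Real.sqrt_pos.2 ht, Real.sq_sqrt (le_of_lt ht)⟩
  have hcv := lintegral_image_eq_lintegral_abs_deriv_mul (s := Ioi (0 : ℝ)) measurableSet_Ioi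
    (f := fun r => r ^ 2) (f' := fun r => 2 * r)
    (fun r _ => by simpa using (hasDerivAt_pow 2 r).hasDerivWithinAt)
    (fun a ha b hb h => (pow_left_inj₀ (le_of_lt ha) (le_of_lt hb) two_ne_zero).1 h) f
  rw [himg] at hcv
  rw [hcv, lintegral_mul_const _ (by fun_prop), mul_comm]
  have h2 : ∀ r ∈ Ioi (0 : ℝ), ENNReal.ofReal |2 * r| * f (r ^ 2) =
      2 * (ENNReal.ofReal r * f (r ^ 2)) := by
    intro r hr
    rw [abs_of_pos (mul_pos two_pos hr), ENNReal.ofReal_mul (by norm_num), mul_assoc]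
    norm_num
  rw [setLIntegral_congr_fun measurableSet_Ioi h2, lintegral_const_mul _ (by fun_prop), ← mul_assoc]
  congr 1
  rw [sub_neg_eq_add, ← two_mul, ENNReal.ofReal_mul two_pos.le, ENNReal.ofReal_ofNat, mul_comm]

/-- Substituting s = u + t and integrating t^m over 0 < t < s. This is the inductive step of
`lintegral_sum_norm_sq`, where each new complex coordinate contributes one variable u. -/
lemma lintegral_Ioi_add {f : ℝ → ℝ≥0∞} (hf : Measurable f) (m : ℕ) :
    ∫⁻ u in Ioi (0 : ℝ), ∫⁻ t in Ioi (0 : ℝ), ENNReal.ofReal (t ^ m) * f (u + t) =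
      ∫⁻ s in Ioi (0 : ℝ), ENNReal.ofReal (s ^ (m + 1) / (m + 1)) * f s := by
  have hm : Measurable fun p : ℝ × ℝ => (Ioi (0 : ℝ)).indicator (fun _ => (1 : ℝ≥0∞)) p.1 *
      (Ioi (0 : ℝ)).indicator (fun t => ENNReal.ofReal (t ^ m)) p.2 * f (p.1 + p.2) := by
    have h1 : Measurable ((Ioi (0 : ℝ)).indicator (fun _ => (1 : ℝ≥0∞))) :=
      measurable_const.indicator measurableSet_Ioi
    have h2 : Measurable ((Ioi (0 : ℝ)).indicator (fun t : ℝ => ENNReal.ofReal (t ^ m))) :=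
      Measurable.indicator (by fun_prop) measurableSet_Ioi
    exact ((h1.comp measurable_fst).mul (h2.comp measurable_snd)).mul
      (hf.comp (measurable_fst.add measurable_snd))
  have e1 : ∫⁻ u in Ioi (0 : ℝ), ∫⁻ t in Ioi (0 : ℝ), ENNReal.ofReal (t ^ m) * f (u + t) =
      ∫⁻ t : ℝ, ∫⁻ u : ℝ, (Ioi (0 : ℝ)).indicator (fun _ => (1 : ℝ≥0∞)) u *
        (Ioi (0 : ℝ)).indicator (fun t => ENNReal.ofReal (t ^ m)) t * f (u + t) := by
    rw [lintegral_lintegral_swap (f := fun t u => (Ioi (0 : ℝ)).indicator (fun _ => (1 : ℝ≥0∞)) u *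
      (Ioi (0 : ℝ)).indicator (fun t => ENNReal.ofReal (t ^ m)) t * f (u + t))
      (hm.comp measurable_swap).aemeasurable, ← lintegral_indicator measurableSet_Ioi]
    refine lintegral_congr fun u => ?_
    by_cases hu : u ∈ Ioi (0 : ℝ)
    · rw [indicator_of_mem hu, ← lintegral_indicator measurableSet_Ioi]
      refine lintegral_congr fun t => ?_
      by_cases ht : t ∈ Ioi (0 : ℝ)
      · simp only [indicator_of_mem ht, indicator_of_mem hu, one_mul]
      · simp only [indicator_of_notMem ht, mul_zero, zero_mul]
    · simp [indicator_of_notMem hu]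
  have e2 : ∀ t : ℝ, ∫⁻ u : ℝ, (Ioi (0 : ℝ)).indicator (fun _ => (1 : ℝ≥0∞)) u *
        (Ioi (0 : ℝ)).indicator (fun t => ENNReal.ofReal (t ^ m)) t * f (u + t) =
      ∫⁻ s : ℝ, (Ioi (0 : ℝ)).indicator (fun _ => (1 : ℝ≥0∞)) (s - t) *
        (Ioi (0 : ℝ)).indicator (fun t => ENNReal.ofReal (t ^ m)) t * f s := by
    intro t
    rw [← lintegral_sub_right_eq_self _ t]
    refine lintegral_congr fun u => ?_
    rw [sub_add_cancel]
  rw [e1, lintegral_congr e2]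
  have hm2 : Measurable fun p : ℝ × ℝ => (Ioi (0 : ℝ)).indicator (fun _ => (1 : ℝ≥0∞)) (p.2 - p.1) *
      (Ioi (0 : ℝ)).indicator (fun t => ENNReal.ofReal (t ^ m)) p.1 * f p.2 := by
    have h1 : Measurable ((Ioi (0 : ℝ)).indicator (fun _ => (1 : ℝ≥0∞))) :=
      measurable_const.indicator measurableSet_Ioi
    have h2 : Measurable ((Ioi (0 : ℝ)).indicator (fun t : ℝ => ENNReal.ofReal (t ^ m))) :=
      Measurable.indicator (by fun_prop) measurableSet_Ioi
    exact ((h1.comp (measurable_snd.sub measurable_fst)).mul (h2.comp measurable_fst)).mul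
      (hf.comp measurable_snd)
  rw [lintegral_lintegral_swap hm2.aemeasurable, ← lintegral_indicator measurableSet_Ioi]
  refine lintegral_congr fun s => ?_
  have e3 : ∀ t : ℝ, (Ioi (0 : ℝ)).indicator (fun _ => (1 : ℝ≥0∞)) (s - t) *
      (Ioi (0 : ℝ)).indicator (fun t => ENNReal.ofReal (t ^ m)) t * f s =
      (Ioo 0 s).indicator (fun t => ENNReal.ofReal (t ^ m)) t * f s := by
    intro t
    by_cases h1 : t ∈ Ioo 0 s
    · have h2 : t ∈ Ioi (0 : ℝ) := h1.1
      have h3 : s - t ∈ Ioi (0 : ℝ) := sub_pos.2 h1.2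
      simp only [indicator_of_mem h1, indicator_of_mem h2, indicator_of_mem h3, one_mul]
    · rw [indicator_of_notMem h1]
      by_cases h2 : t ∈ Ioi (0 : ℝ)
      · have h3 : s - t ∉ Ioi (0 : ℝ) := fun h => h1 ⟨h2, sub_pos.1 h⟩
        simp [indicator_of_notMem h3]
      · simp [indicator_of_notMem h2]
  rw [lintegral_congr e3, lintegral_mul_const _ (Measurable.indicator (by fun_prop) measurableSet_Ioo),
    lintegral_indicator measurableSet_Ioo]
  by_cases hs : s ∈ Ioi (0 : ℝ)
  · rw [indicator_of_mem hs]
    congr 1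
    have hs' : (0 : ℝ) ≤ s := le_of_lt hs
    rw [← ofReal_integral_eq_lintegral_ofReal, ← integral_Ioc_eq_integral_Ioo,
      ← intervalIntegral.integral_of_le hs', integral_pow]
    · congr 1; simp
    · exact (continuous_pow m).integrableOn_Icc.mono_set Ioo_subset_Icc_self
    · filter_upwards [self_mem_ae_restrict measurableSet_Ioo] with t ht
      exact pow_nonneg ht.1.le m
  · have : Ioo 0 s = ∅ := Ioo_eq_empty fun h => hs h
    simp [indicator_of_notMem hs, this]

lemma lintegral_sum_norm_sq (m : ℕ) {f : ℝ → ℝ≥0∞} (hf : Measurable f) :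
    ∫⁻ v : Fin (m + 1) → ℂ, f (∑ i, ‖v i‖ ^ 2) =
      ENNReal.ofReal (Real.pi ^ (m + 1) / m.factorial) *
        ∫⁻ t in Ioi 0, ENNReal.ofReal (t ^ m) * f t := by
  induction m generalizing f with
  | zero =>
    have h := volume_preserving_funUnique (Fin 1) ℂ
    have := h.lintegral_comp (f := fun z => f (‖z‖ ^ 2)) (by fun_prop)
    simp only [Nat.reduceAdd, Finset.univ_unique, Finset.sum_singleton]
    refine this.trans ?_
    rw [lintegral_complex_norm_sq hf]
    simp
  | succ m ih =>
    have h := volume_preserving_piFinSuccAbove (fun _ : Fin (m + 2) => ℂ) 0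
    have h1 : ∀ v : Fin (m + 2) → ℂ, f (∑ i, ‖v i‖ ^ 2) =
        (fun p : ℂ × (Fin (m + 1) → ℂ) => f (‖p.1‖ ^ 2 + ∑ i, ‖p.2 i‖ ^ 2))
          (MeasurableEquiv.piFinSuccAbove (fun _ : Fin (m + 2) => ℂ) 0 v) := by
      intro v
      rw [Fin.sum_univ_succ]
      rfl
    have hF : Measurable fun p : ℂ × (Fin (m + 1) → ℂ) => f (‖p.1‖ ^ 2 + ∑ i, ‖p.2 i‖ ^ 2) := by
      fun_prop
    rw [lintegral_congr h1, h.lintegral_comp hF, Measure.volume_eq_prod,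
      lintegral_prod _ hF.aemeasurable]
    have h2 : ∀ z : ℂ, ∫⁻ v : Fin (m + 1) → ℂ, f (‖z‖ ^ 2 + ∑ i, ‖v i‖ ^ 2) =
        ENNReal.ofReal (Real.pi ^ (m + 1) / m.factorial) *
        ∫⁻ t in Ioi 0, ENNReal.ofReal (t ^ m) * f (‖z‖ ^ 2 + t) := fun z =>
      ih (f := fun t => f (‖z‖ ^ 2 + t)) (by fun_prop)
    have hm : Measurable fun u : ℝ => ∫⁻ t in Ioi (0 : ℝ), ENNReal.ofReal (t ^ m) * f (u + t) :=
      Measurable.lintegral_prod_right' (f := fun p : ℝ × ℝ => ENNReal.ofReal (p.2 ^ m) * f (p.1 + p.2))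
        (by fun_prop)
    have hm' : Measurable fun z : ℂ => ∫⁻ t in Ioi (0 : ℝ), ENNReal.ofReal (t ^ m) *
        f (‖z‖ ^ 2 + t) := hm.comp (by fun_prop : Measurable fun z : ℂ => ‖z‖ ^ 2)
    rw [lintegral_congr h2, lintegral_const_mul _ hm',
      lintegral_complex_norm_sq hm, lintegral_Ioi_add hf, ← mul_assoc,
      ← ENNReal.ofReal_mul (by positivity)]
    have h3 : ∀ s ∈ Ioi (0 : ℝ), ENNReal.ofReal (s ^ (m + 1) / (m + 1)) * f s =
        ENNReal.ofReal (1 / (m + 1)) * (ENNReal.ofReal (s ^ (m + 1)) * f s) := by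
      intro s hs
      rw [← mul_assoc, ← ENNReal.ofReal_mul (by positivity)]
      congr 2; ring
    rw [setLIntegral_congr_fun measurableSet_Ioi h3, lintegral_const_mul _ (by fun_prop), ← mul_assoc,
      ← ENNReal.ofReal_mul (by positivity)]
    congr 2
    rw [Nat.factorial_succ]
    push_cast
    field_simp
    ring

end GaussianWeight

/-! ### Partition functions and unitary invariance of the Gaussian measure. -/

section Invariance

open Matrix

variable {n : ℕ}

/-- The Gaussian weight `exp (-(c/2) Tr H²)`. -/
def gaussW (c : ℝ) (x : Fin n → Fin n → ℝ) : ℝ≥0∞ := ENNReal.ofReal (Real.exp (-(c / 2) * trSq x))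

/-- The Gaussian weight of the entry on the diagonal. -/
def gaussA (c a : ℝ) : ℝ≥0∞ := ENNReal.ofReal (Real.exp (-(c / 2) * a ^ 2))

/-- The Gaussian weight of the entries off the diagonal, as a function of their squared norm. -/
def gaussV (c t : ℝ) : ℝ≥0∞ := ENNReal.ofReal (Real.exp (-c * t))

lemma measurable_gaussW (c : ℝ) : Measurable (gaussW (n := n) c) := by
  have := (continuous_trSq (n := n)).measurable
  unfold gaussW; fun_prop

lemma measurable_gaussA (c : ℝ) : Measurable (gaussA c) := by unfold gaussA; fun_prop

lemma measurable_gaussV (c : ℝ) : Measurable (gaussV c) := by unfold gaussV; fun_prop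

lemma gaussW_border (c a : ℝ) (v : Fin n → ℂ) (x : Fin n → Fin n → ℝ) :
    gaussW c (border a v x) = gaussA c a * gaussV c (∑ i, ‖v i‖ ^ 2) * gaussW c x := by
  unfold gaussW gaussA gaussV
  rw [← ENNReal.ofReal_mul (by positivity), ← Real.exp_add, ← ENNReal.ofReal_mul (by positivity),
    ← Real.exp_add, trSq_border]
  congr 2; ring

/-- The partition function. -/
def partZ (c : ℝ) (n : ℕ) : ℝ≥0∞ := ∫⁻ x : Fin n → Fin n → ℝ, gaussW c x

lemma lintegral_gaussA {c : ℝ} (hc : 0 < c) :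
    ∫⁻ a, gaussA c a = ENNReal.ofReal √(2 * Real.pi / c) := by
  unfold gaussA
  rw [← ofReal_integral_eq_lintegral_ofReal (integrable_exp_neg_mul_sq (by positivity))
    (Eventually.of_forall fun a => by positivity), integral_gaussian]
  congr 2
  field_simp

lemma lintegral_Ioi_pow_mul_gaussV {c : ℝ} (hc : 0 < c) (m : ℕ) :
    ∫⁻ t in Ioi (0 : ℝ), ENNReal.ofReal (t ^ m) * gaussV c t =
      ENNReal.ofReal (m.factorial / c ^ (m + 1)) := by
  have hint : ∫ t in Ioi (0 : ℝ), t ^ m * Real.exp (-c * t) = m.factorial / c ^ (m + 1) := by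
    have := Real.integral_rpow_mul_exp_neg_mul_Ioi (a := m + 1) (r := c) (by positivity) hc
    rw [Real.Gamma_nat_eq_factorial] at this
    rw [show (m : ℝ) + 1 = ((m + 1 : ℕ) : ℝ) by push_cast; ring, Real.rpow_natCast] at this
    rw [div_eq_inv_mul, ← inv_pow, ← one_div, ← this]
    refine setIntegral_congr_fun measurableSet_Ioi fun t ht => ?_
    simp
  have hi : IntegrableOn (fun t : ℝ => t ^ m * Real.exp (-c * t)) (Ioi 0) := by
    by_contra h
    rw [integral_undef h] at hint
    have : (0 : ℝ) < m.factorial / c ^ (m + 1) := by positivity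
    linarith
  rw [← hint, ofReal_integral_eq_lintegral_ofReal hi]
  · refine setLIntegral_congr_fun measurableSet_Ioi fun t ht => ?_
    simp only [gaussV]
    rw [ENNReal.ofReal_mul (pow_nonneg (le_of_lt ht) m)]
  · filter_upwards [self_mem_ae_restrict measurableSet_Ioi] with t ht
    exact mul_nonneg (pow_nonneg (le_of_lt ht) m) (Real.exp_pos _).le

lemma lintegral_gaussV {c : ℝ} (hc : 0 < c) (n : ℕ) :
    ∫⁻ v : Fin n → ℂ, gaussV c (∑ i, ‖v i‖ ^ 2) = ENNReal.ofReal ((Real.pi / c) ^ n) := by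
  rcases n with _ | m
  · simp [gaussV, volume_pi]
  · rw [lintegral_sum_norm_sq m (measurable_gaussV c), lintegral_Ioi_pow_mul_gaussV hc,
      ← ENNReal.ofReal_mul (by positivity)]
    congr 1
    rw [div_pow]
    have : (m.factorial : ℝ) ≠ 0 := by positivity
    field_simp

lemma partZ_succ {c : ℝ} (hc : 0 < c) (n : ℕ) :
    partZ c (n + 1) = ENNReal.ofReal (√(2 * Real.pi / c) * (Real.pi / c) ^ n) * partZ c n := by
  rw [partZ, lintegral_border (measurable_gaussW c)]
  have hm := measurable_gaussW c (n := n)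
  have hA := measurable_gaussA c
  have hV : Measurable fun v : Fin n → ℂ => gaussV c (∑ i, ‖v i‖ ^ 2) :=
    (measurable_gaussV c).comp (by fun_prop)
  simp only [gaussW_border, lintegral_const_mul _ hm]
  have e : ∀ a, ∫⁻ v : Fin n → ℂ, gaussA c a * gaussV c (∑ i, ‖v i‖ ^ 2) *
      ∫⁻ x : Fin n → Fin n → ℝ, gaussW c x =
      gaussA c a * (ENNReal.ofReal ((Real.pi / c) ^ n) * partZ c n) := by
    intro a
    rw [lintegral_mul_const _ (hV.const_mul _), lintegral_const_mul _ hV, lintegral_gaussV hc,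
      mul_assoc]
    rfl
  rw [lintegral_congr e, lintegral_mul_const _ hA, lintegral_gaussA hc, ← mul_assoc,
    ← ENNReal.ofReal_mul (by positivity)]

lemma partZ_ne_zero_ne_top {c : ℝ} (hc : 0 < c) (n : ℕ) : partZ c n ≠ 0 ∧ partZ c n ≠ ∞ := by
  induction n with
  | zero =>
    have h : ∀ x : Fin 0 → Fin 0 → ℝ, gaussW c x = 1 := fun x => by simp [gaussW, trSq]
    have h2 : (volume : Measure (Fin 0 → Fin 0 → ℝ)) univ = 1 := by
      rw [volume_pi, Measure.pi_univ]; simp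
    rw [partZ, lintegral_congr h, lintegral_one, h2]
    simp
  | succ n ih =>
    rw [partZ_succ hc]
    refine ⟨mul_ne_zero ?_ ih.1, ENNReal.mul_ne_top ENNReal.ofReal_ne_top ih.2⟩
    rw [ne_eq, ENNReal.ofReal_eq_zero, not_le]
    positivity

/-- An invertible linear map scales Lebesgue measure by a constant. Conjugation leaves the Gaussian
weight unchanged, and its integral is neither zero nor infinite, so the constant is 1. -/
lemma measurePreserving_conjCoord {U : Matrix (Fin n) (Fin n) ℂ} (hU : Uᴴ * U = 1) :
    MeasurePreserving (conjCoord U) volume volume := by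
  have hU' : U * Uᴴ = 1 := mul_eq_one_comm.1 hU
  have hcomp : conjCoord U ∘ₗ conjCoord Uᴴ = LinearMap.id := by
    refine LinearMap.ext fun x => ?_
    simp only [LinearMap.comp_apply, LinearMap.id_apply]
    rw [← hermCoord_hermitianOf (conjCoord U _), hermitianOf_conjCoord, hermitianOf_conjCoord,
      conjTranspose_conjTranspose]
    have : U * (Uᴴ * hermitianOf x * U) * Uᴴ = (U * Uᴴ) * hermitianOf x * (U * Uᴴ) := by
      simp only [Matrix.mul_assoc]
    rw [this, hU', Matrix.one_mul, Matrix.mul_one, hermCoord_hermitianOf]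
  have hdet : LinearMap.det (conjCoord U) ≠ 0 := by
    intro h
    have := congrArg LinearMap.det hcomp
    rw [LinearMap.det_comp, h, zero_mul, LinearMap.det_id] at this
    exact zero_ne_one this
  have hmap := Measure.map_linearMap_addHaar_eq_smul_addHaar
    (volume : Measure (Fin n → Fin n → ℝ)) hdet
  have hmeas : Measurable (conjCoord U) := (conjCoord U).continuous_of_finiteDimensional.measurable
  have hZ := partZ_ne_zero_ne_top one_pos n
  have h1 : partZ 1 n = ENNReal.ofReal |(LinearMap.det (conjCoord U))⁻¹| * partZ 1 n := by
    have h2 : ∫⁻ x, gaussW 1 x ∂(Measure.map (conjCoord U) volume) = partZ 1 n := by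
      rw [lintegral_map (measurable_gaussW 1) hmeas]
      simp only [gaussW, trSq_conjCoord hU]
      rfl
    rw [hmap, lintegral_smul_measure] at h2
    exact h2.symm
  have h3 : ENNReal.ofReal |(LinearMap.det (conjCoord U))⁻¹| = 1 := by
    have := (ENNReal.mul_left_inj hZ.1 hZ.2).1 ((one_mul _).trans h1)
    exact this.symm
  refine ⟨hmeas, ?_⟩
  rw [hmap, h3, one_smul]

/-- A unitary matrix that moves the first basis vector to the direction of `v`. -/
lemma exists_unitary_mulVec_single {m : ℕ} (v : Fin (m + 1) → ℂ) :
    ∃ U : Matrix (Fin (m + 1)) (Fin (m + 1)) ℂ, Uᴴ * U = 1 ∧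
      U *ᵥ (Pi.single 0 ((√(∑ i, ‖v i‖ ^ 2) : ℝ) : ℂ)) = v := by
  by_cases hv : v = 0
  · refine ⟨1, by simp, ?_⟩
    simp [hv]
  set w : EuclideanSpace ℂ (Fin (m + 1)) := WithLp.toLp 2 v with hw
  have hwn : ‖w‖ = √(∑ i, ‖v i‖ ^ 2) := EuclideanSpace.norm_eq w
  have hw0 : w ≠ 0 := by
    intro h; apply hv; funext i
    have := congrArg (fun u : EuclideanSpace ℂ (Fin (m + 1)) => u i) h
    simpa [hw] using this
  have hwn0 : ‖w‖ ≠ 0 := norm_ne_zero_iff.2 hw0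
  set f : Fin (m + 1) → EuclideanSpace ℂ (Fin (m + 1)) := fun _ => ((‖w‖ : ℂ)⁻¹) • w with hf
  have horth : Orthonormal ℂ (({0} : Set (Fin (m + 1))).domRestrict f) := by
    rw [orthonormal_iff_ite]
    rintro ⟨i, hi⟩ ⟨j, hj⟩
    have hi' : i = 0 := hi
    have hj' : j = 0 := hj
    subst hi' hj'
    simp only [Set.domRestrict_apply, hf, if_true]
    rw [inner_self_eq_norm_sq_to_K, norm_smul]
    simp [hwn0]
  obtain ⟨b, hb⟩ := horth.exists_orthonormalBasis_extension_of_card_eq (by simp)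
  have hb0 : b 0 = ((‖w‖ : ℂ)⁻¹) • w := hb 0 rfl
  set U : Matrix (Fin (m + 1)) (Fin (m + 1)) ℂ :=
    (EuclideanSpace.basisFun (Fin (m + 1)) ℂ).toBasis.toMatrix b with hUdef
  have hUu := (EuclideanSpace.basisFun (Fin (m + 1)) ℂ).toMatrix_orthonormalBasis_mem_unitary b
  refine ⟨U, (Matrix.mem_unitaryGroup_iff').1 hUu, ?_⟩
  funext i
  rw [mulVec_single]
  simp only [Pi.smul_apply, MulOpposite.smul_eq_mul_unop, MulOpposite.unop_op, col_apply, hUdef,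
    Module.Basis.toMatrix_apply, hb0]
  rw [← hwn]
  have hwn0' : (‖w‖ : ℂ) ≠ 0 := by exact_mod_cast hwn0
  simp [hw]
  field_simp
  exact mul_div_cancel_left₀ _ hwn0'

end Invariance

/-! ### Recursion for characteristic determinants under bordering. -/

section CharDet

open Matrix

variable {n : ℕ}

/-- The characteristic polynomial of `hermitianOf x` at `z`. -/
def charDet (z : ℂ) (x : Fin n → Fin n → ℝ) : ℂ := (z • (1 : Matrix (Fin n) (Fin n) ℂ) - hermitianOf x).det

/-- The coordinates of the block that remains when the first row and column are deleted. -/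
def minorCoord (x : Fin (n + 1) → Fin (n + 1) → ℝ) (i j : Fin n) : ℝ := x i.succ j.succ

@[simp] lemma minorCoord_border (a : ℝ) (v : Fin n → ℂ) (x : Fin n → Fin n → ℝ) :
    minorCoord (border a v x) = x := by
  ext i j; simp [minorCoord, border]

lemma hermitianOf_minorCoord (x : Fin (n + 1) → Fin (n + 1) → ℝ) :
    hermitianOf (minorCoord x) = (hermitianOf x).submatrix Fin.succ Fin.succ := by
  ext i j; simp [minorCoord, hermitianOf]

lemma continuous_charDet (z : ℂ) : Continuous (charDet (n := n) z) := by
  have := continuous_hermitianOf (n := n)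
  unfold charDet
  fun_prop

lemma continuous_minorCoord : Continuous (minorCoord (n := n)) := by
  unfold minorCoord; fun_prop

lemma det_of_border_single {m : ℕ} (M : Matrix (Fin (m + 2)) (Fin (m + 2)) ℂ)
    (h1 : ∀ j : Fin m, M 0 j.succ.succ = 0) (h2 : ∀ i : Fin m, M i.succ.succ 0 = 0) :
    M.det = M 0 0 * (M.submatrix Fin.succ Fin.succ).det - M 0 1 * M 1 0 *
      (M.submatrix (fun i : Fin m => i.succ.succ) (fun j : Fin m => j.succ.succ)).det := by
  rw [det_succ_row_zero, Fin.sum_univ_succ, Fin.sum_univ_succ]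
  have hz : ∑ j : Fin m, (-1) ^ ((j.succ.succ : Fin (m + 2)) : ℕ) * M 0 j.succ.succ *
      (M.submatrix Fin.succ (Fin.succAbove j.succ.succ)).det = 0 :=
    Finset.sum_eq_zero fun j _ => by rw [h1]; ring
  rw [hz, det_succ_column_zero (M.submatrix Fin.succ (Fin.succAbove (Fin.succ 0))),
    Fin.sum_univ_succ]
  have hz2 : ∑ i : Fin m, (-1) ^ ((i.succ : Fin (m + 1)) : ℕ) *
      (M.submatrix Fin.succ (Fin.succAbove (Fin.succ 0))) i.succ 0 *
      ((M.submatrix Fin.succ (Fin.succAbove (Fin.succ 0))).submatrix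
        (Fin.succAbove i.succ) Fin.succ).det = 0 :=
    Finset.sum_eq_zero fun i _ => by
      have : (M.submatrix Fin.succ (Fin.succAbove (Fin.succ 0))) i.succ 0 = 0 := by
        simp [h2]
      rw [this]; ring
  rw [hz2]
  have e1 : (M.submatrix Fin.succ (Fin.succAbove 0)) = M.submatrix Fin.succ Fin.succ := by
    simp
  have e2 : ((M.submatrix Fin.succ (Fin.succAbove (Fin.succ 0))).submatrix
      (Fin.succAbove 0) Fin.succ) =
      M.submatrix (fun i : Fin m => i.succ.succ) (fun j : Fin m => j.succ.succ) := by
    ext i j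
    simp
  rw [e1, e2]
  simp
  ring

/-- The block matrix `diag(1, U)`. -/
def augment (U : Matrix (Fin n) (Fin n) ℂ) : Matrix (Fin (n + 1)) (Fin (n + 1)) ℂ :=
  Matrix.of (Fin.cons (Fin.cons 1 0) fun i => Fin.cons 0 (U i))

@[simp] lemma augment_zero_zero (U : Matrix (Fin n) (Fin n) ℂ) : augment U 0 0 = 1 := rfl
@[simp] lemma augment_zero_succ (U : Matrix (Fin n) (Fin n) ℂ) (j : Fin n) :
    augment U 0 j.succ = 0 := rfl
@[simp] lemma augment_succ_zero (U : Matrix (Fin n) (Fin n) ℂ) (i : Fin n) :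
    augment U i.succ 0 = 0 := rfl
@[simp] lemma augment_succ_succ (U : Matrix (Fin n) (Fin n) ℂ) (i j : Fin n) :
    augment U i.succ j.succ = U i j := rfl

lemma augment_mul_conjTranspose {U : Matrix (Fin n) (Fin n) ℂ} (hU : U * Uᴴ = 1) :
    augment U * (augment U)ᴴ = 1 := by
  have h : ∀ i j, ∑ k, U i k * star (U j k) = (1 : Matrix (Fin n) (Fin n) ℂ) i j := fun i j => by
    rw [← hU]; rfl
  ext i j
  refine Fin.cases ?_ (fun i => ?_) i <;> refine Fin.cases ?_ (fun j => ?_) j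
  · simp [Matrix.mul_apply, Fin.sum_univ_succ]
  · simp [Matrix.mul_apply, Fin.sum_univ_succ, (Fin.succ_ne_zero j).symm]
  · simp [Matrix.mul_apply, Fin.sum_univ_succ]
  · rw [Matrix.mul_apply, Fin.sum_univ_succ]
    simp only [conjTranspose_apply, augment_succ_zero, zero_mul, augment_succ_succ, zero_add, h]
    simp [Matrix.one_apply]

lemma hermitianOf_border_conj (U : Matrix (Fin n) (Fin n) ℂ) (a : ℝ) (v : Fin n → ℂ)
    (x : Fin n → Fin n → ℝ) :
    hermitianOf (border a (U *ᵥ v) (conjCoord U x)) =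
      augment U * hermitianOf (border a v x) * (augment U)ᴴ := by
  have h : ∀ i j, hermitianOf (conjCoord U x) i j =
      ∑ k, (∑ l, U i l * hermitianOf x l k) * star (U j k) := fun i j => by
    rw [hermitianOf_conjCoord]; rfl
  ext i j
  refine Fin.cases ?_ (fun i => ?_) i <;> refine Fin.cases ?_ (fun j => ?_) j
  · simp [Matrix.mul_apply, Fin.sum_univ_succ]
  · simp [Matrix.mul_apply, Fin.sum_univ_succ, mulVec, dotProduct, mul_comm]
  · simp [Matrix.mul_apply, Fin.sum_univ_succ, mulVec, dotProduct]
  · simp [Matrix.mul_apply, Fin.sum_univ_succ, h]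

lemma det_smul_one_sub_conj {U : Matrix (Fin n) (Fin n) ℂ} (hU : U * Uᴴ = 1) (z : ℂ)
    (M : Matrix (Fin n) (Fin n) ℂ) :
    (z • (1 : Matrix (Fin n) (Fin n) ℂ) - U * M * Uᴴ).det = (z • (1 : Matrix (Fin n) (Fin n) ℂ) - M).det := by
  have : z • (1 : Matrix (Fin n) (Fin n) ℂ) - U * M * Uᴴ = U * (z • (1 : Matrix (Fin n) (Fin n) ℂ) - M) * Uᴴ := by
    rw [Matrix.mul_sub, Matrix.sub_mul, Matrix.mul_smul, Matrix.smul_mul, Matrix.mul_one, hU]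
  rw [this, det_mul, det_mul, mul_right_comm, ← det_mul, hU, det_one, one_mul]

lemma charDet_conjCoord {U : Matrix (Fin n) (Fin n) ℂ} (hU : U * Uᴴ = 1) (z : ℂ)
    (x : Fin n → Fin n → ℝ) : charDet z (conjCoord U x) = charDet z x := by
  rw [charDet, hermitianOf_conjCoord, det_smul_one_sub_conj hU, charDet]

lemma charDet_border_conj {U : Matrix (Fin n) (Fin n) ℂ} (hU : U * Uᴴ = 1) (z : ℂ) (a : ℝ)
    (v : Fin n → ℂ) (x : Fin n → Fin n → ℝ) :
    charDet z (border a (U *ᵥ v) (conjCoord U x)) = charDet z (border a v x) := by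
  rw [charDet, hermitianOf_border_conj, det_smul_one_sub_conj (augment_mul_conjTranspose hU),
    charDet]

/-- When the border is concentrated in one coordinate, the determinants satisfy the three-term
recurrence of a tridiagonal matrix. -/
lemma charDet_border_single {m : ℕ} (z : ℂ) (a s : ℝ) (x : Fin (m + 1) → Fin (m + 1) → ℝ) :
    charDet z (border a (Pi.single 0 (s : ℂ)) x) =
      (z - a) * charDet z x - (s : ℂ) ^ 2 * charDet z (minorCoord x) := by
  rw [charDet, det_of_border_single]
  · have e1 : (z • (1 : Matrix (Fin (m + 2)) (Fin (m + 2)) ℂ) -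
        hermitianOf (border a (Pi.single 0 (s : ℂ)) x)).submatrix Fin.succ Fin.succ =
        z • (1 : Matrix (Fin (m + 1)) (Fin (m + 1)) ℂ) - hermitianOf x := by
      ext i j; simp [Matrix.one_apply]
    have e2 : (z • (1 : Matrix (Fin (m + 2)) (Fin (m + 2)) ℂ) -
        hermitianOf (border a (Pi.single 0 (s : ℂ)) x)).submatrix
          (fun i : Fin m => i.succ.succ) (fun j : Fin m => j.succ.succ) =
        z • (1 : Matrix (Fin m) (Fin m) ℂ) - hermitianOf (minorCoord x) := by
      ext i j; simp [Matrix.one_apply, hermitianOf_minorCoord]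
    have h01 : hermitianOf (border a (Pi.single 0 (s : ℂ)) x) 0 1 = s := by
      have := hermitianOf_border_zero_succ a (Pi.single 0 (s : ℂ)) x 0
      simpa using this
    have h10 : hermitianOf (border a (Pi.single 0 (s : ℂ)) x) 1 0 = s := by
      have := hermitianOf_border_succ_zero a (Pi.single 0 (s : ℂ)) x 0
      simpa using this
    rw [e1, e2]
    have n01 : (1 : Matrix (Fin (m + 2)) (Fin (m + 2)) ℂ) 0 1 = 0 := by simp
    have n10 : (1 : Matrix (Fin (m + 2)) (Fin (m + 2)) ℂ) 1 0 = 0 := by simp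
    simp only [Matrix.sub_apply, Matrix.smul_apply, hermitianOf_border_zero_zero, h01, h10,
      Matrix.one_apply_eq, smul_eq_mul, mul_one, n01, n10, charDet]
    ring
  · intro j
    simp [(Fin.succ_ne_zero _).symm]
  · intro i
    simp

/-- The one-step recursion for the pair (characteristic polynomial, characteristic polynomial of the
first minor), integrated against the Gaussian weight. -/
lemma lintegral_charDet_succ {m : ℕ} (c : ℝ) (z : ℂ) {F : ℂ × ℂ → ℝ≥0∞} (hF : Measurable F) :
    ∫⁻ x : Fin (m + 2) → Fin (m + 2) → ℝ, F (charDet z x, charDet z (minorCoord x)) * gaussW c x =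
      ∫⁻ a : ℝ, ∫⁻ v : Fin (m + 1) → ℂ, ∫⁻ x : Fin (m + 1) → Fin (m + 1) → ℝ,
        F ((z - a) * charDet z x - ((∑ i, ‖v i‖ ^ 2 : ℝ) : ℂ) * charDet z (minorCoord x),
          charDet z x) * (gaussA c a * gaussV c (∑ i, ‖v i‖ ^ 2) * gaussW c x) := by
  have hm1 : ∀ k, Measurable (charDet (n := k) z) := fun k => (continuous_charDet z).measurable
  have hm2 : ∀ k, Measurable (minorCoord (n := k)) := fun k => continuous_minorCoord.measurable
  have hm3 : ∀ k, Measurable (gaussW (n := k) c) := fun k => measurable_gaussW c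
  have hmeas : Measurable fun x : Fin (m + 2) → Fin (m + 2) → ℝ =>
      F (charDet z x, charDet z (minorCoord x)) * gaussW c x :=
    (hF.comp ((hm1 _).prodMk ((hm1 _).comp (hm2 _)))).mul (hm3 _)
  rw [lintegral_border hmeas]
  refine lintegral_congr fun a => lintegral_congr fun v => ?_
  -- For fixed v the block x is rotated by a unitary U that carries |v| e₀ to v. Weight and
  -- determinants are invariant, so v may be replaced by |v| e₀.
  obtain ⟨U, hU, hv⟩ := exists_unitary_mulVec_single v
  have hU' : U * Uᴴ = 1 := mul_eq_one_comm.1 hU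
  set s := √(∑ i, ‖v i‖ ^ 2)
  have hs : (s : ℂ) ^ 2 = ((∑ i, ‖v i‖ ^ 2 : ℝ) : ℂ) := by
    rw [← Complex.ofReal_pow, Real.sq_sqrt (Finset.sum_nonneg fun i _ => by positivity)]
  have hmp := measurePreserving_conjCoord hU
  have hb : Measurable fun x : Fin (m + 1) → Fin (m + 1) → ℝ => border a v x :=
    measurePreserving_border.measurable.comp
      (measurable_const.prodMk (measurable_const.prodMk measurable_id))
  refine (hmp.lintegral_comp (hmeas.comp hb)).symm.trans (lintegral_congr fun x => ?_)
  simp only [Function.comp, minorCoord_border, gaussW_border]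
  rw [charDet_conjCoord hU', show gaussW c (conjCoord U x) = gaussW c x by
    rw [gaussW, trSq_conjCoord hU, gaussW]]
  nth_rewrite 1 [← hv]
  rw [charDet_border_conj hU', charDet_border_single, hs]

end CharDet

/-! ### The joint law of consecutive characteristic determinants. -/

section CharLaw

open ProbabilityTheory

/-- The Gaussian probability measure on Hermitian matrices of size `n`, with weight
`exp (-(c/2) Tr H²)`. -/
def gueMeas (c : ℝ) (n : ℕ) : Measure (Fin n → Fin n → ℝ) :=
  (partZ c n)⁻¹ • volume.withDensity (gaussW c)

lemma lintegral_gueMeas (c : ℝ) (n : ℕ) {f : (Fin n → Fin n → ℝ) → ℝ≥0∞} (hf : Measurable f) :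
    ∫⁻ x, f x ∂(gueMeas c n) = (partZ c n)⁻¹ * ∫⁻ x, f x * gaussW c x := by
  rw [gueMeas, lintegral_smul_measure, lintegral_withDensity_eq_lintegral_mul _ (measurable_gaussW c) hf]
  simp [mul_comm]

/-- The law of a diagonal entry. -/
def diagLaw (c : ℝ) : Measure ℝ := gaussianReal 0 (Real.toNNReal (1 / c))

/-- The law of the squared norm of `m + 1` off-diagonal entries. -/
def sqNormLaw (c : ℝ) (m : ℕ) : Measure ℝ :=
  (volume.restrict (Ioi 0)).withDensity
    (fun t => ENNReal.ofReal (c ^ (m + 1) / m.factorial) * (ENNReal.ofReal (t ^ m) * gaussV c t))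

instance (c : ℝ) : IsProbabilityMeasure (diagLaw c) := by unfold diagLaw; infer_instance

lemma measurable_sqNormDensity (c : ℝ) (m : ℕ) : Measurable fun t : ℝ =>
    ENNReal.ofReal (c ^ (m + 1) / m.factorial) * (ENNReal.ofReal (t ^ m) * gaussV c t) := by
  have := measurable_gaussV c
  fun_prop

lemma lintegral_diagLaw {c : ℝ} (hc : 0 < c) {f : ℝ → ℝ≥0∞} (hf : Measurable f) :
    ∫⁻ a, f a ∂(diagLaw c) = (ENNReal.ofReal √(2 * Real.pi / c))⁻¹ * ∫⁻ a, f a * gaussA c a := by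
  have hA := measurable_gaussA c
  have hfA : Measurable fun a => f a * gaussA c a := hf.mul hA
  have hv : Real.toNNReal (1 / c) ≠ 0 := by
    rw [ne_eq, Real.toNNReal_eq_zero, not_le]; positivity
  rw [diagLaw, gaussianReal_of_var_ne_zero 0 hv,
    lintegral_withDensity_eq_lintegral_mul _ (measurable_gaussianPDF _ _) hf,
    ← lintegral_const_mul _ hfA]
  refine lintegral_congr fun a => ?_
  have : gaussianPDF 0 (Real.toNNReal (1 / c)) a = (ENNReal.ofReal √(2 * Real.pi / c))⁻¹ * gaussA c a := by
    rw [gaussianPDF, gaussianPDFReal, gaussA, Real.coe_toNNReal _ (by positivity),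
      ENNReal.ofReal_mul (by positivity), ENNReal.ofReal_inv_of_pos (by positivity)]
    congr 3
    · ring_nf
    · field_simp; ring_nf
  simp only [Pi.mul_apply]
  rw [this]
  ring

lemma lintegral_sqNormLaw (c : ℝ) (m : ℕ) {f : ℝ → ℝ≥0∞} (hf : Measurable f) :
    ∫⁻ t, f t ∂(sqNormLaw c m) = ENNReal.ofReal (c ^ (m + 1) / m.factorial) *
      ∫⁻ t in Ioi 0, ENNReal.ofReal (t ^ m) * (f t * gaussV c t) := by
  have hV := measurable_gaussV c
  rw [sqNormLaw, lintegral_withDensity_eq_lintegral_mul _ (measurable_sqNormDensity c m) hf,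
    ← lintegral_const_mul _ (by fun_prop)]
  refine lintegral_congr fun t => ?_
  simp only [Pi.mul_apply]
  ring

lemma lintegral_pow_sqNormLaw {c : ℝ} (hc : 0 < c) (m k : ℕ) :
    ∫⁻ t, ENNReal.ofReal (t ^ k) ∂(sqNormLaw c m) =
      ENNReal.ofReal ((m + k).factorial / (m.factorial * c ^ k)) := by
  rw [lintegral_sqNormLaw c m (by fun_prop)]
  have h : ∀ t ∈ Ioi (0 : ℝ), ENNReal.ofReal (t ^ m) * (ENNReal.ofReal (t ^ k) * gaussV c t) =
      ENNReal.ofReal (t ^ (m + k)) * gaussV c t := by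
    intro t ht
    have ht' : (0 : ℝ) < t := ht
    rw [← mul_assoc, ← ENNReal.ofReal_mul (by positivity), pow_add]
  rw [setLIntegral_congr_fun measurableSet_Ioi h, lintegral_Ioi_pow_mul_gaussV hc,
    ← ENNReal.ofReal_mul (by positivity)]
  congr 1
  have : (m.factorial : ℝ) ≠ 0 := by positivity
  field_simp
  ring

lemma isProbabilityMeasure_sqNormLaw {c : ℝ} (hc : 0 < c) (m : ℕ) :
    IsProbabilityMeasure (sqNormLaw c m) := by
  constructor
  have := lintegral_pow_sqNormLaw hc m 0
  have h : (m.factorial : ℝ) ≠ 0 := by positivity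
  simpa [h] using this

lemma sqNormLaw_ae_pos (c : ℝ) (m : ℕ) : ∀ᵐ t ∂(sqNormLaw c m), 0 < t := by
  refine (withDensity_absolutelyContinuous _ _).ae_le ?_
  exact self_mem_ae_restrict measurableSet_Ioi

lemma integrable_pow_sqNormLaw {c : ℝ} (hc : 0 < c) (m k : ℕ) :
    Integrable (fun t : ℝ => t ^ k) (sqNormLaw c m) := by
  refine ⟨by fun_prop, ?_⟩
  rw [hasFiniteIntegral_iff_ofReal]
  · rw [lintegral_pow_sqNormLaw hc]; exact ENNReal.ofReal_lt_top
  · filter_upwards [sqNormLaw_ae_pos c m] with t ht using pow_nonneg ht.le k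

lemma integral_pow_sqNormLaw {c : ℝ} (hc : 0 < c) (m k : ℕ) :
    ∫ t, t ^ k ∂(sqNormLaw c m) = (m + k).factorial / (m.factorial * c ^ k) := by
  rw [integral_eq_lintegral_of_nonneg_ae, lintegral_pow_sqNormLaw hc, ENNReal.toReal_ofReal]
  · positivity
  · filter_upwards [sqNormLaw_ae_pos c m] with t ht using pow_nonneg ht.le k
  · fun_prop

/-- The joint law of the characteristic polynomial at `z` of a Gaussian Hermitian matrix of size
`m + 1` and that of its first minor. -/
def charLaw (c : ℝ) (z : ℂ) (m : ℕ) : Measure (ℂ × ℂ) :=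
  (gueMeas c (m + 1)).map fun x => (charDet z x, charDet z (minorCoord x))

lemma measurable_charPair (z : ℂ) (m : ℕ) :
    Measurable fun x : Fin (m + 1) → Fin (m + 1) → ℝ => (charDet z x, charDet z (minorCoord x)) :=
  (continuous_charDet z).measurable.prodMk
    ((continuous_charDet z).measurable.comp continuous_minorCoord.measurable)

lemma isProbabilityMeasure_gueMeas {c : ℝ} (hc : 0 < c) (n : ℕ) :
    IsProbabilityMeasure (gueMeas c n) := by
  constructor
  have h := lintegral_gueMeas c n (f := fun _ => 1) measurable_const
  simp only [lintegral_one, one_mul] at h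
  rw [h]
  exact ENNReal.inv_mul_cancel (partZ_ne_zero_ne_top hc n).1 (partZ_ne_zero_ne_top hc n).2

lemma isProbabilityMeasure_charLaw {c : ℝ} (hc : 0 < c) (z : ℂ) (m : ℕ) :
    IsProbabilityMeasure (charLaw c z m) := by
  have := isProbabilityMeasure_gueMeas hc (m + 1)
  exact Measure.isProbabilityMeasure_map (measurable_charPair z m).aemeasurable

lemma lintegral_charLaw (c : ℝ) (z : ℂ) (m : ℕ) {F : ℂ × ℂ → ℝ≥0∞} (hF : Measurable F) :
    ∫⁻ p, F p ∂(charLaw c z m) =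
      (partZ c (m + 1))⁻¹ * ∫⁻ x : Fin (m + 1) → Fin (m + 1) → ℝ,
        F (charDet z x, charDet z (minorCoord x)) * gaussW c x := by
  have hFm : Measurable fun x : Fin (m + 1) → Fin (m + 1) → ℝ =>
      F (charDet z x, charDet z (minorCoord x)) := hF.comp (measurable_charPair z m)
  rw [charLaw, lintegral_map hF (measurable_charPair z m), lintegral_gueMeas _ _ hFm]

lemma lintegral_charLaw_succ {c : ℝ} (hc : 0 < c) (z : ℂ) (m : ℕ) {F : ℂ × ℂ → ℝ≥0∞}
    (hF : Measurable F) :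
    ∫⁻ p, F p ∂(charLaw c z (m + 1)) = ∫⁻ a, ∫⁻ t, ∫⁻ p,
      F ((z - (a : ℂ)) * p.1 - (t : ℂ) * p.2, p.1) ∂(charLaw c z m) ∂(sqNormLaw c m) ∂(diagLaw c) := by
  have := isProbabilityMeasure_charLaw hc z m
  have := isProbabilityMeasure_sqNormLaw hc m
  have hG : Measurable fun q : (ℝ × ℝ) × (ℂ × ℂ) =>
      F ((z - (q.1.1 : ℂ)) * q.2.1 - (q.1.2 : ℂ) * q.2.2, q.2.1) := by
    refine hF.comp (Measurable.prodMk ?_ (by fun_prop))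
    fun_prop
  have hG1 : Measurable fun q : ℝ × ℝ => ∫⁻ p,
      F ((z - (q.1 : ℂ)) * p.1 - (q.2 : ℂ) * p.2, p.1) ∂(charLaw c z m) :=
    hG.lintegral_prod_right'
  have hG2 : Measurable fun a : ℝ => ∫⁻ t, ∫⁻ p,
      F ((z - (a : ℂ)) * p.1 - (t : ℂ) * p.2, p.1) ∂(charLaw c z m) ∂(sqNormLaw c m) :=
    hG1.lintegral_prod_right'
  have hG3 : Measurable fun a : ℝ => (∫⁻ t, ∫⁻ p,
      F ((z - (a : ℂ)) * p.1 - (t : ℂ) * p.2, p.1) ∂(charLaw c z m) ∂(sqNormLaw c m)) *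
        gaussA c a := hG2.mul (measurable_gaussA c)
  rw [lintegral_diagLaw hc hG2, lintegral_charLaw c z (m + 1) hF, lintegral_charDet_succ c z hF,
    partZ_succ hc (m + 1)]
  have hZ := partZ_ne_zero_ne_top hc (m + 1)
  have inner : ∀ a : ℝ, ∫⁻ v : Fin (m + 1) → ℂ, ∫⁻ x : Fin (m + 1) → Fin (m + 1) → ℝ,
        F ((z - a) * charDet z x - ((∑ i, ‖v i‖ ^ 2 : ℝ) : ℂ) * charDet z (minorCoord x),
          charDet z x) * (gaussA c a * gaussV c (∑ i, ‖v i‖ ^ 2) * gaussW c x) =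
      ENNReal.ofReal ((Real.pi / c) ^ (m + 1)) * partZ c (m + 1) * ((∫⁻ t, ∫⁻ p,
      F ((z - (a : ℂ)) * p.1 - (t : ℂ) * p.2, p.1) ∂(charLaw c z m) ∂(sqNormLaw c m)) *
        gaussA c a) := by
    intro a
    have hGa : Measurable fun t : ℝ => ∫⁻ p,
      F ((z - (a : ℂ)) * p.1 - (t : ℂ) * p.2, p.1) ∂(charLaw c z m) :=
      hG1.comp measurable_prodMk_left
    have e1 : ∀ v : Fin (m + 1) → ℂ, ∫⁻ x : Fin (m + 1) → Fin (m + 1) → ℝ,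
        F ((z - a) * charDet z x - ((∑ i, ‖v i‖ ^ 2 : ℝ) : ℂ) * charDet z (minorCoord x),
          charDet z x) * (gaussA c a * gaussV c (∑ i, ‖v i‖ ^ 2) * gaussW c x) =
        (fun t : ℝ => partZ c (m + 1) * gaussA c a * ((∫⁻ p,
          F ((z - (a : ℂ)) * p.1 - (t : ℂ) * p.2, p.1) ∂(charLaw c z m)) * gaussV c t))
          (∑ i, ‖v i‖ ^ 2) := by
      intro v
      dsimp only
      have hFa : Measurable fun p : ℂ × ℂ =>
          F ((z - (a : ℂ)) * p.1 - ((∑ i, ‖v i‖ ^ 2 : ℝ) : ℂ) * p.2, p.1) :=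
        hF.comp (by fun_prop)
      rw [lintegral_charLaw c z m hFa]
      have hFx : Measurable fun x : Fin (m + 1) → Fin (m + 1) → ℝ =>
          F ((z - (a : ℂ)) * charDet z x - ((∑ i, ‖v i‖ ^ 2 : ℝ) : ℂ) * charDet z (minorCoord x),
          charDet z x) * gaussW c x := (hFa.comp (measurable_charPair z m)).mul (measurable_gaussW c)
      have e2 : ∀ x : Fin (m + 1) → Fin (m + 1) → ℝ,
        F ((z - a) * charDet z x - ((∑ i, ‖v i‖ ^ 2 : ℝ) : ℂ) * charDet z (minorCoord x),
          charDet z x) * (gaussA c a * gaussV c (∑ i, ‖v i‖ ^ 2) * gaussW c x) =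
          (gaussA c a * gaussV c (∑ i, ‖v i‖ ^ 2)) *
          (F ((z - a) * charDet z x - ((∑ i, ‖v i‖ ^ 2 : ℝ) : ℂ) * charDet z (minorCoord x),
          charDet z x) * gaussW c x) := fun x => by ring
      rw [lintegral_congr e2, lintegral_const_mul _ hFx]
      generalize (∫⁻ x : Fin (m + 1) → Fin (m + 1) → ℝ, F ((z - (a : ℂ)) * charDet z x -
        ((∑ i, ‖v i‖ ^ 2 : ℝ) : ℂ) * charDet z (minorCoord x), charDet z x) * gaussW c x) = I
      calc _ = partZ c (m + 1) * (partZ c (m + 1))⁻¹ *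
            (gaussA c a * gaussV c (∑ i, ‖v i‖ ^ 2) * I) := by
            rw [ENNReal.mul_inv_cancel hZ.1 hZ.2, one_mul]
        _ = _ := by ring
    have hV := measurable_gaussV c
    rw [lintegral_congr e1, lintegral_sum_norm_sq m (f := fun t : ℝ => partZ c (m + 1) * gaussA c a *
      ((∫⁻ p, F ((z - (a : ℂ)) * p.1 - (t : ℂ) * p.2, p.1) ∂(charLaw c z m)) * gaussV c t))
      (by fun_prop), lintegral_sqNormLaw c m hGa]
    have e3 : ∀ t : ℝ, ENNReal.ofReal (t ^ m) * (partZ c (m + 1) * gaussA c a * ((∫⁻ p,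
          F ((z - (a : ℂ)) * p.1 - (t : ℂ) * p.2, p.1) ∂(charLaw c z m)) * gaussV c t)) =
        partZ c (m + 1) * gaussA c a * (ENNReal.ofReal (t ^ m) * ((∫⁻ p,
          F ((z - (a : ℂ)) * p.1 - (t : ℂ) * p.2, p.1) ∂(charLaw c z m)) * gaussV c t)) :=
      fun t => by ring
    rw [lintegral_congr e3, lintegral_const_mul _ (by fun_prop)]
    have e4 : ENNReal.ofReal (Real.pi ^ (m + 1) / m.factorial) =
        ENNReal.ofReal ((Real.pi / c) ^ (m + 1)) * ENNReal.ofReal (c ^ (m + 1) / m.factorial) := by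
      rw [← ENNReal.ofReal_mul (by positivity)]
      congr 1
      rw [div_pow]; field_simp
    rw [e4]
    ring
  rw [lintegral_congr inner, lintegral_const_mul _ hG3, ← mul_assoc,
    ENNReal.ofReal_mul (by positivity)]
  congr 1
  have hπ : ENNReal.ofReal ((Real.pi / c) ^ (m + 1)) ≠ 0 := by
    rw [ne_eq, ENNReal.ofReal_eq_zero, not_le]; positivity
  rw [mul_assoc (ENNReal.ofReal √(2 * Real.pi / c)), ENNReal.mul_inv
    (Or.inr (ENNReal.mul_ne_top ENNReal.ofReal_ne_top hZ.2)) (Or.inl ENNReal.ofReal_ne_top), mul_assoc,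
    ENNReal.inv_mul_cancel (mul_ne_zero hπ hZ.1) (ENNReal.mul_ne_top ENNReal.ofReal_ne_top hZ.2),
    mul_one]

/-- Consecutive determinants form a Markov chain driven by an independent Gaussian diagonal entry
and an independent Gamma variable, as in the tridiagonal model of the GUE. -/
lemma charLaw_succ {c : ℝ} (hc : 0 < c) (z : ℂ) (m : ℕ) :
    charLaw c z (m + 1) = ((diagLaw c).prod ((sqNormLaw c m).prod (charLaw c z m))).map
      fun q => ((z - (q.1 : ℂ)) * q.2.2.1 - (q.2.1 : ℂ) * q.2.2.2, q.2.2.1) := by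
  have := isProbabilityMeasure_charLaw hc z m
  have := isProbabilityMeasure_sqNormLaw hc m
  refine Measure.ext_of_lintegral _ fun F hF => ?_
  have hm : Measurable fun q : ℝ × ℝ × ℂ × ℂ =>
      ((z - (q.1 : ℂ)) * q.2.2.1 - (q.2.1 : ℂ) * q.2.2.2, q.2.2.1) := by fun_prop
  have hFm : Measurable fun q : ℝ × ℝ × ℂ × ℂ =>
      F ((z - (q.1 : ℂ)) * q.2.2.1 - (q.2.1 : ℂ) * q.2.2.2, q.2.2.1) := hF.comp hm
  rw [lintegral_charLaw_succ hc z m hF, lintegral_map hF hm, lintegral_prod _ hFm.aemeasurable]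
  refine lintegral_congr fun a => ?_
  have hm2 : Measurable fun q : ℝ × ℂ × ℂ =>
      F ((z - (a : ℂ)) * q.2.1 - (q.1 : ℂ) * q.2.2, q.2.1) := hF.comp (by fun_prop)
  exact (lintegral_prod _ hm2.aemeasurable).symm

lemma charLaw_zero {c : ℝ} (hc : 0 < c) (z : ℂ) :
    charLaw c z 0 = (diagLaw c).map fun a : ℝ => (z - (a : ℂ), 1) := by
  refine Measure.ext_of_lintegral _ fun F hF => ?_
  have hm : Measurable fun a : ℝ => (z - (a : ℂ), (1 : ℂ)) := by fun_prop
  have hFm : Measurable fun a : ℝ => F (z - (a : ℂ), (1 : ℂ)) := hF.comp hm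
  have hFA : Measurable fun a : ℝ => F (z - (a : ℂ), (1 : ℂ)) * gaussA c a :=
    hFm.mul (measurable_gaussA c)
  have hFW : Measurable fun x : Fin 1 → Fin 1 → ℝ =>
      F (charDet z x, charDet z (minorCoord x)) * gaussW c x :=
    (hF.comp (measurable_charPair z 0)).mul (measurable_gaussW c)
  rw [lintegral_map hF hm, lintegral_diagLaw hc hFm, lintegral_charLaw c z 0 hF,
    lintegral_border hFW,
    partZ_succ hc 0]
  have h1 : ∀ (a : ℝ) (v : Fin 0 → ℂ) (x : Fin 0 → Fin 0 → ℝ), charDet z (border a v x) = z - a := by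
    intro a v x
    simp [charDet]
  have h2 : ∀ (x : Fin 0 → Fin 0 → ℝ), charDet z x = 1 := by
    intro x; simp [charDet]
  have hV := lintegral_gaussV hc 0
  have hVm : Measurable fun v : Fin 0 → ℂ => gaussV c (∑ i, ‖v i‖ ^ 2) :=
    (measurable_gaussV c).comp (by fun_prop)
  have hZ := partZ_ne_zero_ne_top hc 0
  have e : ∀ a : ℝ, ∫⁻ v : Fin 0 → ℂ, ∫⁻ x : Fin 0 → Fin 0 → ℝ,
      F (charDet z (border a v x), charDet z (minorCoord (border a v x))) * gaussW c (border a v x) =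
      partZ c 0 * (F (z - a, 1) * gaussA c a) := by
    intro a
    have : ∀ v : Fin 0 → ℂ, ∫⁻ x : Fin 0 → Fin 0 → ℝ,
        F (charDet z (border a v x), charDet z (minorCoord (border a v x))) *
          gaussW c (border a v x) =
        (F (z - a, 1) * gaussA c a * partZ c 0) * gaussV c (∑ i, ‖v i‖ ^ 2) := by
      intro v
      simp only [h1, h2, gaussW_border]
      rw [lintegral_const_mul _ ((measurable_gaussW c).const_mul _),
        lintegral_const_mul _ (measurable_gaussW c)]
      change _ * (_ * partZ c 0) = _
      ring
    rw [lintegral_congr this, lintegral_const_mul _ hVm, hV]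
    simp
    ring
  rw [lintegral_congr e, lintegral_const_mul _ hFA, pow_zero, mul_one,
    ← mul_assoc, ENNReal.mul_inv (Or.inr hZ.2) (Or.inl ENNReal.ofReal_ne_top), mul_assoc _ _ (partZ c 0),
    ENNReal.inv_mul_cancel hZ.1 hZ.2, mul_one]

end CharLaw

/-! ### Hermite polynomials at complex-shifted Gaussian arguments. -/

section GaussianPolynomials

open ProbabilityTheory Polynomial

variable {c : ℝ}

lemma integrable_pow_diagLaw (c : ℝ) (k : ℕ) : Integrable (fun a : ℝ => a ^ k) (diagLaw c) := by
  have h := (memLp_id_gaussianReal (μ := 0) (v := (1 / c).toNNReal) (k : NNReal)).integrable_norm_pow'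
  refine (h.mono' (by fun_prop) (Eventually.of_forall fun a => ?_))
  simp

/-- Integration of the derivative of a^k φ(a), φ being the Gaussian density. At k = 0 the factor k
annihilates the term with the truncated exponent. -/
lemma integral_pow_add_two_diagLaw (hc : 0 < c) (k : ℕ) :
    ∫ a, a ^ (k + 1) ∂(diagLaw c) = k / c * ∫ a, a ^ (k - 1) ∂(diagLaw c) := by
  have hv : Real.toNNReal (1 / c) ≠ 0 := by
    rw [ne_eq, Real.toNNReal_eq_zero, not_le]; positivity
  set φ : ℝ → ℝ := gaussianPDFReal 0 (Real.toNNReal (1 / c)) with hφ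
  have hφ' : ∀ a, HasDerivAt φ (-(c * a) * φ a) a := by
    intro a
    rw [hφ, gaussianPDFReal_def, Real.coe_toNNReal _ (by positivity)]
    have h1 : HasDerivAt (fun x : ℝ => -(x - 0) ^ 2 / (2 * (1 / c))) (-(c * a)) a := by
      have := (((hasDerivAt_id a).sub_const 0).pow 2).neg.div_const (2 * (1 / c))
      refine this.congr_deriv ?_
      simp; field_simp
    refine (h1.exp.const_mul _).congr_deriv ?_
    ring
  have hint : ∀ j : ℕ, Integrable fun a => a ^ j * φ a := by
    intro j
    have h := integrable_pow_diagLaw c j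
    rw [diagLaw, gaussianReal_of_var_ne_zero 0 hv, integrable_withDensity_iff_integrable_smul'
      (measurable_gaussianPDF _ _) (Eventually.of_forall fun _ => gaussianPDF_lt_top)] at h
    refine h.congr (Eventually.of_forall fun a => ?_)
    simp [toReal_gaussianPDF, hφ, mul_comm]
  have hI : ∀ j : ℕ, ∫ a, a ^ j ∂(diagLaw c) = ∫ a, a ^ j * φ a := by
    intro j
    rw [diagLaw, integral_gaussianReal_eq_integral_smul hv]
    simp [hφ, mul_comm]
  have hd : ∀ a, HasDerivAt (fun a => a ^ k * φ a)
      (k * (a ^ (k - 1) * φ a) - c * (a ^ (k + 1) * φ a)) a := by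
    intro a
    refine ((hasDerivAt_pow k a).mul (hφ' a)).congr_deriv ?_
    ring
  have h0 := integral_eq_zero_of_hasDerivAt_of_integrable hd
    (((hint _).const_mul _).sub ((hint _).const_mul _)) (hint k)
  rw [integral_sub ((hint _).const_mul _) ((hint _).const_mul _), integral_const_mul,
    integral_const_mul] at h0
  rw [hI, hI]
  field_simp
  linarith

lemma integrable_eval_diagLaw (c : ℝ) (f : ℂ[X]) :
    Integrable (fun a : ℝ => f.eval (a : ℂ)) (diagLaw c) := by
  simp only [eval_eq_sum_range]
  refine integrable_finsetSum _ fun k _ => Integrable.const_mul ?_ _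
  have := (integrable_pow_diagLaw c k).ofReal (𝕜 := ℂ)
  simpa using this

/-- The expectation of a polynomial in a centred Gaussian variable of variance `1 / c`. -/
def gaussE (c : ℝ) : ℂ[X] →ₗ[ℂ] ℂ where
  toFun f := ∫ a : ℝ, f.eval (a : ℂ) ∂(diagLaw c)
  map_add' f g := by
    simp only [eval_add]
    exact integral_add (integrable_eval_diagLaw c f) (integrable_eval_diagLaw c g)
  map_smul' r f := by
    simp only [eval_smul, RingHom.id_apply]
    exact integral_smul r _

lemma gaussE_apply (c : ℝ) (f : ℂ[X]) : gaussE c f = ∫ a : ℝ, f.eval (a : ℂ) ∂(diagLaw c) := rfl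

lemma gaussE_one (c : ℝ) : gaussE c 1 = 1 := by simp [gaussE_apply]

/-- Gaussian integration by parts, extended linearly from monomials. -/
lemma gaussE_X_mul (hc : 0 < c) (f : ℂ[X]) : gaussE c (X * f) = 1 / c * gaussE c (derivative f) := by
  induction f using Polynomial.induction_on' with
  | add p q hp hq => rw [mul_add, map_add, map_add, map_add, hp, hq]; ring
  | monomial k a =>
    have e : ∀ j : ℕ, ∫ x : ℝ, (x : ℂ) ^ j ∂(diagLaw c) = ((∫ x : ℝ, x ^ j ∂(diagLaw c) : ℝ) : ℂ) := by
      intro j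
      rw [← integral_complex_ofReal]
      simp
    rw [derivative_monomial, X_mul_monomial, gaussE_apply, gaussE_apply]
    simp only [eval_monomial]
    rw [integral_const_mul, integral_const_mul, e, e, integral_pow_add_two_diagLaw hc]
    push_cast
    ring

/-- The monic orthogonal polynomials of the Gaussian weight `exp (-c x² / 2)`. -/
def monicHermite (c : ℝ) : ℕ → ℂ[X]
  | 0 => 1
  | 1 => X
  | k + 2 => X * monicHermite c (k + 1) - C ((k + 1 : ℂ) / c) * monicHermite c k

lemma monicHermite_succ (c : ℝ) (k : ℕ) : monicHermite c (k + 1) =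
    X * monicHermite c k - C ((k : ℂ) / c) * monicHermite c (k - 1) := by
  rcases k with _ | k
  · simp [monicHermite]
  · rw [monicHermite]; simp

lemma derivative_monicHermite (c : ℝ) (k : ℕ) :
    derivative (monicHermite c k) = C (k : ℂ) * monicHermite c (k - 1) := by
  induction k using Nat.strong_induction_on with
  | _ k ih =>
    match k with
    | 0 => simp [monicHermite]
    | 1 => simp [monicHermite]
    | k + 2 =>
      rw [monicHermite, derivative_sub, derivative_mul, derivative_X, derivative_mul, derivative_C,
        ih (k + 1) (by omega), ih k (by omega)]
      have h := monicHermite_succ c k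
      simp only [Nat.add_sub_cancel, show k + 2 - 1 = k + 1 by omega, Nat.cast_add, Nat.cast_one,
        Nat.cast_ofNat, map_add, map_one, map_natCast, div_eq_mul_inv, map_mul] at h ⊢
      linear_combination (-((k : ℂ[X]) + 1)) * h -
        monicHermite c (k + 1) * (map_ofNat C 2 : (C (2 : ℂ) : ℂ[X]) = 2)

lemma eval_monicHermite_conj (c : ℝ) (k : ℕ) (z : ℂ) :
    (monicHermite c k).eval (starRingEnd ℂ z) = starRingEnd ℂ ((monicHermite c k).eval z) := by
  induction k using Nat.strong_induction_on with
  | _ k ih =>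
    match k with
    | 0 => simp [monicHermite]
    | 1 => simp [monicHermite]
    | k + 2 =>
      simp [monicHermite, ih (k + 1) (by omega), ih k (by omega)]

/-- The squared norm of `monicHermite c k`. -/
def hermiteNorm (c : ℝ) (k : ℕ) : ℝ := k.factorial / c ^ k

lemma hermiteNorm_pos (hc : 0 < c) (k : ℕ) : 0 < hermiteNorm c k := by
  unfold hermiteNorm; positivity

lemma hermiteNorm_succ (c : ℝ) (k : ℕ) :
    hermiteNorm c (k + 1) = (k + 1) / c * hermiteNorm c k := by
  unfold hermiteNorm
  rw [Nat.factorial_succ]; push_cast; rw [pow_succ]; field_simp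

lemma lagMass_succ_sub (k : ℕ) (x : ℝ) :
    lagMass (k + 1) x - lagMass k x = ∑ j ∈ Finset.range (k + 1), (k.choose j : ℝ) * x ^ j / j.factorial := by
  have h : lagMass k x = ∑ j ∈ Finset.range (k + 1), (k.choose (j + 1) : ℝ) * x ^ j / j.factorial := by
    rw [Finset.sum_range_succ]
    simp [lagMass, lagWeight]
  rw [h, lagMass, ← Finset.sum_sub_distrib]
  refine Finset.sum_congr rfl fun j _ => ?_
  rw [lagWeight, Nat.choose_succ_succ]
  push_cast
  ring

/-- The first differences of `lagMass` in k are the ordinary Laguerre polynomials at −x, and this is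
(k + 1)(L_{k+1} − L_k)(−x) = x L_k^{(1)}(−x). -/
lemma lagMass_second_diff (k : ℕ) (x : ℝ) :
    (k + 1) * (lagMass (k + 2) x - lagMass (k + 1) x) =
      (k + 1) * (lagMass (k + 1) x - lagMass k x) + x * lagMass (k + 1) x := by
  rw [lagMass_succ_sub, lagMass_succ_sub, Finset.sum_range_succ']
  have h0 : ∑ j ∈ Finset.range (k + 1), (k.choose j : ℝ) * x ^ j / j.factorial =
      ∑ j ∈ Finset.range (k + 1), (k.choose (j + 1) : ℝ) * x ^ (j + 1) / (j + 1).factorial + 1 := by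
    rw [Finset.sum_range_succ' (n := k), Finset.sum_range_succ (n := k)]
    simp
  rw [h0, lagMass, Finset.mul_sum]
  simp only [Nat.choose_zero_right, pow_zero, Nat.factorial_zero, Nat.cast_one, mul_one, div_one]
  rw [mul_add, mul_add, Finset.mul_sum, Finset.mul_sum, add_right_comm, ← Finset.sum_add_distrib]
  congr 1
  refine Finset.sum_congr rfl fun j _ => ?_
  have h1 : ((k + 1).choose (j + 1) : ℝ) * (j + 1) = (k + 1) * k.choose j := by
    exact_mod_cast (Nat.add_one_mul_choose_eq k j).symm
  rw [lagWeight, Nat.factorial_succ, pow_succ]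
  have h2 : ((k + 1).choose (j + 1) : ℝ) = k.choose j + k.choose (j + 1) := by
    exact_mod_cast Nat.choose_succ_succ k j
  have h3 : (j.factorial : ℝ) ≠ 0 := by positivity
  push_cast
  field_simp
  rw [h2] at h1 ⊢
  linear_combination (-x ^ (j + 1)) * h1

/-- The mixed moment `E [p_k (X + iY) p_l (X - iY)]` of the orthogonal polynomials. -/
def hermiteMoment (c Y : ℝ) (k l : ℕ) : ℂ :=
  gaussE c ((monicHermite c k).comp (X + C (Complex.I * Y)) *
    (monicHermite c l).comp (X - C (Complex.I * Y)))

lemma gaussE_X_mul_mixed (hc : 0 < c) (w : ℂ) (k l : ℕ) :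
    gaussE c (X * ((monicHermite c k).comp (X + C w) * (monicHermite c l).comp (X - C w))) =
      1 / c * (k * gaussE c ((monicHermite c (k - 1)).comp (X + C w) *
          (monicHermite c l).comp (X - C w)) +
        l * gaussE c ((monicHermite c k).comp (X + C w) *
          (monicHermite c (l - 1)).comp (X - C w))) := by
  rw [gaussE_X_mul hc, derivative_mul, derivative_comp, derivative_comp, derivative_monicHermite,
    derivative_monicHermite]
  simp only [derivative_add, derivative_sub, derivative_X, derivative_C, mul_comp, C_comp]
  have e : ∀ A B A' B' : ℂ[X], gaussE c ((1 + 0) * (C (k : ℂ) * A) * B + A' * ((1 - 0) * (C (l : ℂ) * B'))) =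
      k * gaussE c (A * B) + l * gaussE c (A' * B') := by
    intro A B A' B'
    rw [← smul_eq_mul (k : ℂ), ← smul_eq_mul (l : ℂ), ← map_smul, ← map_smul, ← map_add]
    congr 1
    rw [smul_eq_C_mul, smul_eq_C_mul]; ring
  rw [e]

/-- Integration by parts on the factor X lowers one index or the other; the term lowering k cancels
against the three-term recurrence. -/
lemma hermiteMoment_succ_left (hc : 0 < c) (Y : ℝ) (k l : ℕ) :
    hermiteMoment c Y (k + 1) l = Complex.I * Y * hermiteMoment c Y k l +
      (l : ℂ) / c * hermiteMoment c Y k (l - 1) := by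
  have h := gaussE_X_mul_mixed hc (Complex.I * Y) k l
  unfold hermiteMoment
  set w : ℂ := Complex.I * Y
  have e : (monicHermite c (k + 1)).comp (X + C w) * (monicHermite c l).comp (X - C w) =
      X * ((monicHermite c k).comp (X + C w) * (monicHermite c l).comp (X - C w)) +
      w • ((monicHermite c k).comp (X + C w) * (monicHermite c l).comp (X - C w)) -
      ((k : ℂ) / c) • ((monicHermite c (k - 1)).comp (X + C w) * (monicHermite c l).comp (X - C w)) := by
    rw [monicHermite_succ, smul_eq_C_mul, smul_eq_C_mul]
    simp only [sub_comp, mul_comp, X_comp, C_comp]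
    ring
  rw [e, map_sub, map_add, map_smul, map_smul, h]
  simp only [smul_eq_mul]
  ring

lemma hermiteMoment_comm (c Y : ℝ) (k l : ℕ) :
    hermiteMoment c (-Y) k l = hermiteMoment c Y l k := by
  unfold hermiteMoment
  congr 1
  push_cast
  rw [mul_comm]
  simp [sub_eq_add_neg]

/-- The diagonal and the first off-diagonal moments are found together, and for all Y at once: the
recursion needs the moment with swapped indices, which is the one at −Y. -/
lemma hermiteMoment_eq (hc : 0 < c) (k : ℕ) : ∀ Y : ℝ,
    hermiteMoment c Y k k = hermiteNorm c k *
      ((lagMass (k + 1) (c * Y ^ 2) - lagMass k (c * Y ^ 2) : ℝ) : ℂ) ∧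
    hermiteMoment c Y (k + 1) k = Complex.I * (hermiteNorm c k * (Y * lagMass (k + 1) (c * Y ^ 2)) : ℝ) := by
  induction k with
  | zero =>
    intro Y
    have h0 : hermiteMoment c Y 0 0 = 1 := by simp [hermiteMoment, monicHermite, gaussE_one]
    refine ⟨by simp [h0, hermiteNorm, lagMass, lagWeight], ?_⟩
    rw [hermiteMoment_succ_left hc, h0]
    simp [hermiteNorm, lagMass, lagWeight]
  | succ k ih =>
    have h1 : ∀ Y : ℝ, hermiteMoment c Y (k + 1) (k + 1) = hermiteNorm c (k + 1) *
      ((lagMass (k + 2) (c * Y ^ 2) - lagMass (k + 1) (c * Y ^ 2) : ℝ) : ℂ) := by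
      intro Y
      rw [hermiteMoment_succ_left hc, ← hermiteMoment_comm, (ih (-Y)).2, Nat.add_sub_cancel, (ih Y).1,
        hermiteNorm_succ, neg_sq]
      have h := lagMass_second_diff k (c * Y ^ 2)
      have h2 : (lagMass (k + 2) (c * Y ^ 2) - lagMass (k + 1) (c * Y ^ 2)) * ((k + 1) / c) =
        (k + 1) / c * (lagMass (k + 1) (c * Y ^ 2) - lagMass k (c * Y ^ 2)) +
          Y ^ 2 * lagMass (k + 1) (c * Y ^ 2) := by
        field_simp
        linear_combination h
      have h3 : (((lagMass (k + 2) (c * Y ^ 2) - lagMass (k + 1) (c * Y ^ 2) : ℝ) : ℂ)) * ((k + 1) / c) =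
        (k + 1) / c * ((lagMass (k + 1) (c * Y ^ 2) - lagMass k (c * Y ^ 2) : ℝ) : ℂ) +
          Y ^ 2 * lagMass (k + 1) (c * Y ^ 2) := by
        exact_mod_cast congrArg (fun r : ℝ => (r : ℂ)) h2
      push_cast at h3 ⊢
      linear_combination (-(hermiteNorm c k : ℂ)) * h3 -
        (Y : ℂ) ^ 2 * hermiteNorm c k * lagMass (k + 1) (c * Y ^ 2) * Complex.I_sq
    intro Y
    refine ⟨h1 Y, ?_⟩
    rw [hermiteMoment_succ_left hc, h1, Nat.add_sub_cancel, (ih Y).2, hermiteNorm_succ]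
    push_cast
    ring

end GaussianPolynomials

/-! ### Second moments of the determinants through Hermite kernels. -/

section CharMoments

open Polynomial

variable {c : ℝ}

local notation "conj" => starRingEnd ℂ

/-- The second moments of a pair of complex random variables. -/
structure HasSecondMoments (μ : Measure (ℂ × ℂ)) (K L Q : ℂ) : Prop where
  integrable_fst : Integrable (fun p => p.1 * conj p.1) μ
  integrable_mixed : Integrable (fun p => p.1 * conj p.2) μ
  integrable_snd : Integrable (fun p => p.2 * conj p.2) μ
  integral_fst : ∫ p, p.1 * conj p.1 ∂μ = K
  integral_mixed : ∫ p, p.1 * conj p.2 ∂μ = L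
  integral_snd : ∫ p, p.2 * conj p.2 ∂μ = Q

lemma HasSecondMoments.integrable_mixed' {μ : Measure (ℂ × ℂ)} {K L Q : ℂ}
    (h : HasSecondMoments μ K L Q) : Integrable (fun p => conj p.1 * p.2) μ := by
  refine h.integrable_mixed.mono (by fun_prop) (Eventually.of_forall fun p => ?_)
  simp

lemma HasSecondMoments.integral_mixed' {μ : Measure (ℂ × ℂ)} {K L Q : ℂ}
    (h : HasSecondMoments μ K L Q) : ∫ p, conj p.1 * p.2 ∂μ = conj L := by
  rw [← h.integral_mixed, ← integral_conj]
  simp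

/-- The Christoffel–Darboux type sum `∑_{k ≤ m} p_k(z) p_k(w) / h_k`. -/
def hermiteKernel (c : ℝ) (z w : ℂ) (m : ℕ) : ℂ :=
  ∑ k ∈ Finset.range (m + 1), (monicHermite c k).eval z * (monicHermite c k).eval w / hermiteNorm c k

/-- The sum `∑_{k ≤ m} p_{k+1}(z) p_k(w) / h_k`. -/
def hermiteKernelShift (c : ℝ) (z w : ℂ) (m : ℕ) : ℂ :=
  ∑ k ∈ Finset.range (m + 1),
    (monicHermite c (k + 1)).eval z * (monicHermite c k).eval w / hermiteNorm c k

lemma hermiteKernel_add_one (z w : ℂ) (m : ℕ) : hermiteKernel c z w (m + 1) =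
    hermiteKernel c z w m +
      (monicHermite c (m + 1)).eval z * (monicHermite c (m + 1)).eval w / hermiteNorm c (m + 1) :=
  Finset.sum_range_succ _ _

lemma hermiteKernelShift_add_one (z w : ℂ) (m : ℕ) : hermiteKernelShift c z w (m + 1) =
    hermiteKernelShift c z w m +
      (monicHermite c (m + 2)).eval z * (monicHermite c (m + 1)).eval w / hermiteNorm c (m + 1) :=
  Finset.sum_range_succ _ _

lemma conj_hermiteKernelShift (z : ℂ) (m : ℕ) :
    conj (hermiteKernelShift c z (conj z) m) = hermiteKernelShift c (conj z) z m := by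
  simp only [hermiteKernelShift, map_sum, map_div₀, map_mul, eval_monicHermite_conj,
    Complex.conj_ofReal, Complex.conj_conj]

lemma eval_monicHermite_add_two (c : ℝ) (k : ℕ) (z : ℂ) : (monicHermite c (k + 2)).eval z =
    z * (monicHermite c (k + 1)).eval z - (k + 1) / c * (monicHermite c k).eval z := by
  simp [monicHermite]

lemma ofReal_hermiteNorm_succ (c : ℝ) (k : ℕ) :
    (hermiteNorm c (k + 1) : ℂ) = (k + 1) / c * hermiteNorm c k := by
  rw [hermiteNorm_succ]; push_cast; ring

lemma ofReal_hermiteNorm_ne_zero (hc : 0 < c) (k : ℕ) : (hermiteNorm c k : ℂ) ≠ 0 :=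
  Complex.ofReal_ne_zero.2 (hermiteNorm_pos hc k).ne'

/-- The three-term recurrence is inserted for p_{k+1}(z). As (k/c)/h_k = 1/h_{k−1}, its lower term
reproduces the shifted sum with z and w exchanged. -/
lemma hermiteKernelShift_succ (hc : 0 < c) (z w : ℂ) (m : ℕ) :
    hermiteKernelShift c z w (m + 1) =
      z * hermiteKernel c z w (m + 1) - hermiteKernelShift c w z m := by
  have hc' : (c : ℂ) ≠ 0 := Complex.ofReal_ne_zero.2 hc.ne'
  induction m with
  | zero =>
    simp [hermiteKernelShift, hermiteKernel, Finset.sum_range_succ, monicHermite, hermiteNorm]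
    field_simp
    ring
  | succ m ih =>
    rw [hermiteKernelShift_add_one, ih, hermiteKernel_add_one z w (m + 1),
      hermiteKernelShift_add_one w z m, eval_monicHermite_add_two c (m + 1) z,
      ofReal_hermiteNorm_succ c (m + 1)]
    have h1 := ofReal_hermiteNorm_ne_zero hc (m + 1)
    have h2 : (m : ℂ) + 1 + 1 ≠ 0 := by exact_mod_cast (Nat.succ_ne_zero (m + 1))
    push_cast
    field_simp
    ring

/-- The relation that makes the recursion of `HasSecondMoments.succ` close on kernels. The
increments in m agree by the recurrences in z and in w. -/
lemma hermiteKernel_identity (hc : 0 < c) (z w : ℂ) (m : ℕ) :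
    w * hermiteKernelShift c z w (m + 1) - z * hermiteKernelShift c z w m +
      hermiteKernel c z w (m + 1) / c =
    (m + 2) / c * (hermiteKernel c z w (m + 2) - hermiteKernel c z w m) := by
  have hc' : (c : ℂ) ≠ 0 := Complex.ofReal_ne_zero.2 hc.ne'
  have hd : ∀ m, hermiteKernel c z w (m + 2) - hermiteKernel c z w m =
      (monicHermite c (m + 1)).eval z * (monicHermite c (m + 1)).eval w / hermiteNorm c (m + 1) +
      (monicHermite c (m + 2)).eval z * (monicHermite c (m + 2)).eval w / hermiteNorm c (m + 2) := by
    intro m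
    rw [hermiteKernel_add_one, hermiteKernel_add_one]; ring
  rw [hd]
  induction m with
  | zero =>
    simp [hermiteKernelShift, hermiteKernel, Finset.sum_range_succ, monicHermite, hermiteNorm]
    field_simp
    ring
  | succ m ih =>
    rw [hermiteKernelShift_add_one z w (m + 1), hermiteKernel_add_one z w (m + 1)]
    nth_rewrite 2 [hermiteKernelShift_add_one z w m]
    have e1 := eval_monicHermite_add_two c (m + 1) z
    have e2 := eval_monicHermite_add_two c (m + 1) w
    have n1 := ofReal_hermiteNorm_succ c (m + 1)
    have n2 := ofReal_hermiteNorm_succ c (m + 2)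
    have h1 := ofReal_hermiteNorm_ne_zero hc (m + 1)
    have h2 : (m : ℂ) + 1 + 1 ≠ 0 := by exact_mod_cast (Nat.succ_ne_zero (m + 1))
    have h3 : (m : ℂ) + 2 + 1 ≠ 0 := by exact_mod_cast (Nat.succ_ne_zero (m + 2))
    simp only [show m + 1 + 1 = m + 2 by ring, show m + 1 + 2 = m + 3 by ring] at *
    rw [n2]
    rw [n1] at ih ⊢
    push_cast at *
    set P1 := (monicHermite c (m + 1)).eval z
    set P2 := (monicHermite c (m + 2)).eval z
    set P3 := (monicHermite c (m + 3)).eval z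
    set R1 := (monicHermite c (m + 1)).eval w
    set R2 := (monicHermite c (m + 2)).eval w
    set R3 := (monicHermite c (m + 3)).eval w
    set h : ℂ := (hermiteNorm c (m + 1) : ℂ)
    have ez : z * P2 = P3 + (m + 1 + 1) / c * P1 := by rw [e1]; ring
    have ew : w * R2 = R3 + (m + 1 + 1) / c * R1 := by rw [e2]; ring
    have key : w * (P3 * R2 / ((m + 1 + 1) / c * h)) - z * (P2 * R1 / h) =
        P3 * R3 / ((m + 1 + 1) / c * h) - (m + 1 + 1) / c * (P1 * R1 / h) := by
      calc _ = P3 * (w * R2) / ((m + 1 + 1) / c * h) - (z * P2) * R1 / h := by ring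
        _ = _ := by rw [ez, ew]; field_simp; ring
    have e3 : ((m : ℂ) + 1 + 2) / c * (P3 * R3 / (((m : ℂ) + 2 + 1) / c * ((m + 1 + 1) / c * h))) =
        P3 * R3 / ((m + 1 + 1) / c * h) := by
      rw [show (m : ℂ) + 1 + 2 = m + 2 + 1 by ring]; field_simp
    linear_combination ih + key - e3

/-- The expectation of a product over independent factors. -/
lemma integral_mul_mul_prod {α β δ : Type*} [MeasurableSpace α] [MeasurableSpace β]
    [MeasurableSpace δ] {μ : Measure α} {ν : Measure β} {κ : Measure δ} [SFinite μ] [SFinite ν]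
    [SFinite κ] {f : α → ℂ} {g : β → ℂ} {h : δ → ℂ} (hf : Integrable f μ) (hg : Integrable g ν)
    (hh : Integrable h κ) :
    Integrable (fun q : α × β × δ => f q.1 * (g q.2.1 * h q.2.2)) (μ.prod (ν.prod κ)) ∧
    ∫ q : α × β × δ, f q.1 * (g q.2.1 * h q.2.2) ∂(μ.prod (ν.prod κ)) =
      (∫ a, f a ∂μ) * ((∫ b, g b ∂ν) * ∫ d, h d ∂κ) := by
  refine ⟨hf.mul_prod (hg.mul_prod hh), ?_⟩
  rw [integral_prod_mul f (fun q : β × δ => g q.1 * h q.2), integral_prod_mul g h]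

/-- Expansion of |(z − a)p − tq|² under `charLaw_succ`, where the independent a and t have E a = 0,
E a² = 1/c, E t = (m + 1)/c, E t² = (m + 1)(m + 2)/c². -/
lemma HasSecondMoments.succ (hc : 0 < c) (z : ℂ) (m : ℕ) {K L Q : ℂ}
    (h : HasSecondMoments (charLaw c z m) K L Q) :
    HasSecondMoments (charLaw c z (m + 1))
      ((z * conj z + 1 / c) * K - (m + 1) / c * (z * L + conj z * conj L) +
        (m + 1) * (m + 2) / c ^ 2 * Q)
      (z * K - (m + 1) / c * conj L) K := by
  have := isProbabilityMeasure_charLaw hc z m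
  have := isProbabilityMeasure_sqNormLaw hc m
  have hdiag : ∀ f : ℂ[X], Integrable (fun a : ℝ => f.eval (a : ℂ)) (diagLaw c) :=
    integrable_eval_diagLaw c
  have ht : ∀ k : ℕ, Integrable (fun t : ℝ => (t : ℂ) ^ k) (sqNormLaw c m) := fun k => by
    simpa using (integrable_pow_sqNormLaw hc m k).ofReal (𝕜 := ℂ)
  have hti : ∀ k : ℕ, ∫ t : ℝ, (t : ℂ) ^ k ∂(sqNormLaw c m) =
      (m + k).factorial / (m.factorial * (c : ℂ) ^ k) := fun k => by
    have := congrArg (fun r : ℝ => (r : ℂ)) (integral_pow_sqNormLaw hc m k)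
    simp only [← integral_complex_ofReal] at this
    push_cast at this
    exact this
  have hm : (m.factorial : ℂ) ≠ 0 := by exact_mod_cast m.factorial_ne_zero
  have hc' : (c : ℂ) ≠ 0 := Complex.ofReal_ne_zero.2 hc.ne'
  have t0 : ∫ t : ℝ, (t : ℂ) ^ 0 ∂(sqNormLaw c m) = 1 := by simp
  have t1 : ∫ t : ℝ, (t : ℂ) ^ 1 ∂(sqNormLaw c m) = (m + 1) / c := by
    rw [hti, Nat.factorial_succ]; push_cast; field_simp
  have t2 : ∫ t : ℝ, (t : ℂ) ^ 2 ∂(sqNormLaw c m) = (m + 1) * (m + 2) / c ^ 2 := by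
    rw [hti, show m + 2 = (m + 1) + 1 by ring, Nat.factorial_succ, Nat.factorial_succ]; push_cast
    field_simp; ring
  have gX : gaussE c X = 0 := by
    have := gaussE_X_mul hc (1 : ℂ[X]); simpa using this
  have gX2 : gaussE c (X * X) = 1 / c := by
    rw [gaussE_X_mul hc]; simp [gaussE_one]
  have gC : ∀ r : ℂ, gaussE c (C r) = r := fun r => by
    rw [← mul_one (C r), ← smul_eq_C_mul, map_smul, gaussE_one]; simp
  have gCX : ∀ r : ℂ, gaussE c (C r * X) = 0 := fun r => by
    rw [← smul_eq_C_mul, map_smul, gX]; simp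
  have a2 : gaussE c ((C z - X) * (C (conj z) - X)) = z * conj z + 1 / c := by
    rw [show (C z - X) * (C (conj z) - X) = C (z * conj z) - C z * X - C (conj z) * X + X * X by
      rw [C_mul]; ring, map_add, map_sub, map_sub, gC, gCX, gCX, gX2]; ring
  have a1 : ∀ r : ℂ, gaussE c (C r - X) = r := fun r => by rw [map_sub, gC, gX]; ring
  have A := integral_mul_mul_prod (hdiag ((C z - X) * (C (conj z) - X))) (ht 0) h.integrable_fst
  have B1 := integral_mul_mul_prod (hdiag (C z - X)) (ht 1) h.integrable_mixed
  have B2 := integral_mul_mul_prod (hdiag (C (conj z) - X)) (ht 1) h.integrable_mixed'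
  have D := integral_mul_mul_prod (hdiag 1) (ht 2) h.integrable_snd
  have E1 := integral_mul_mul_prod (hdiag (C z - X)) (ht 0) h.integrable_fst
  have E2 := integral_mul_mul_prod (hdiag 1) (ht 1) h.integrable_mixed'
  have G := integral_mul_mul_prod (hdiag 1) (ht 0) h.integrable_fst
  simp only [← gaussE_apply, a2, a1, gaussE_one, t0, t1, t2, h.integral_fst, h.integral_mixed,
    h.integral_mixed', h.integral_snd] at A B1 B2 D E1 E2 G
  have hmap : Measurable fun q : ℝ × ℝ × ℂ × ℂ =>
      ((z - (q.1 : ℂ)) * q.2.2.1 - (q.2.1 : ℂ) * q.2.2.2, q.2.2.1) := by fun_prop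
  have I1 := ((A.1.sub B1.1).sub B2.1).add D.1
  have I2 := E1.1.sub E2.1
  have e1 : ∫ q, _ ∂_ = _ := integral_add' ((A.1.sub B1.1).sub B2.1) D.1
  rw [integral_sub' (A.1.sub B1.1) B2.1, integral_sub' A.1 B1.1, A.2, B1.2, B2.2, D.2] at e1
  have e2 : ∫ q, _ ∂_ = _ := integral_sub' E1.1 E2.1
  rw [E1.2, E2.2] at e2
  rw [charLaw_succ hc]
  refine ⟨?_, ?_, ?_, ?_, ?_, ?_⟩
  · rw [integrable_map_measure (by fun_prop) hmap.aemeasurable]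
    refine I1.congr (Eventually.of_forall fun q => ?_)
    simp
    ring
  · rw [integrable_map_measure (by fun_prop) hmap.aemeasurable]
    refine I2.congr (Eventually.of_forall fun q => ?_)
    simp
    ring
  · rw [integrable_map_measure (by fun_prop) hmap.aemeasurable]
    refine G.1.congr (Eventually.of_forall fun q => ?_)
    simp
  · rw [integral_map hmap.aemeasurable (by fun_prop)]
    refine Eq.trans (integral_congr_ae (Eventually.of_forall fun q => ?_)) (e1.trans ?_)
    · simp
      ring
    · ring
  · rw [integral_map hmap.aemeasurable (by fun_prop)]
    refine Eq.trans (integral_congr_ae (Eventually.of_forall fun q => ?_)) (e2.trans ?_)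
    · simp
      ring
    · ring
  · rw [integral_map hmap.aemeasurable (by fun_prop)]
    refine Eq.trans (integral_congr_ae (Eventually.of_forall fun q => ?_)) (G.2.trans ?_)
    · simp
    · ring

lemma hasSecondMoments_charLaw_zero (hc : 0 < c) (z : ℂ) :
    HasSecondMoments (charLaw c z 0) (z * conj z + 1 / c) z 1 := by
  have gX : gaussE c X = 0 := by
    have := gaussE_X_mul hc (1 : ℂ[X]); simpa using this
  have gX2 : gaussE c (X * X) = 1 / c := by
    rw [gaussE_X_mul hc]; simp [gaussE_one]
  have gC : ∀ r : ℂ, gaussE c (C r) = r := fun r => by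
    rw [← mul_one (C r), ← smul_eq_C_mul, map_smul, gaussE_one]; simp
  have gCX : ∀ r : ℂ, gaussE c (C r * X) = 0 := fun r => by
    rw [← smul_eq_C_mul, map_smul, gX]; simp
  have a2 : gaussE c ((C z - X) * (C (conj z) - X)) = z * conj z + 1 / c := by
    rw [show (C z - X) * (C (conj z) - X) = C (z * conj z) - C z * X - C (conj z) * X + X * X by
      rw [C_mul]; ring, map_add, map_sub, map_sub, gC, gCX, gCX, gX2]; ring
  have a1 : gaussE c (C z - X) = z := by rw [map_sub, gC, gX]; ring
  have hmap : Measurable fun a : ℝ => (z - (a : ℂ), (1 : ℂ)) := by fun_prop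
  rw [charLaw_zero hc]
  refine ⟨?_, ?_, ?_, ?_, ?_, ?_⟩
  · rw [integrable_map_measure (by fun_prop) hmap.aemeasurable]
    refine (integrable_eval_diagLaw c ((C z - X) * (C (conj z) - X))).congr
      (Eventually.of_forall fun q => ?_)
    simp
  · rw [integrable_map_measure (by fun_prop) hmap.aemeasurable]
    refine (integrable_eval_diagLaw c (C z - X)).congr (Eventually.of_forall fun q => ?_)
    simp
  · rw [integrable_map_measure (by fun_prop) hmap.aemeasurable]
    refine (integrable_eval_diagLaw c 1).congr (Eventually.of_forall fun q => ?_)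
    simp
  · rw [integral_map hmap.aemeasurable (by fun_prop), ← a2, gaussE_apply]
    simp
  · rw [integral_map hmap.aemeasurable (by fun_prop)]
    refine Eq.trans ?_ a1
    rw [gaussE_apply]
    simp
  · rw [integral_map hmap.aemeasurable (by fun_prop)]
    simp

/-- The Hermite kernels solve the linear recursion for the second moments with the right initial
values. -/
lemma hasSecondMoments_charLaw (hc : 0 < c) (z : ℂ) (m : ℕ) :
    HasSecondMoments (charLaw c z m)
      (hermiteNorm c (m + 1) * hermiteKernel c z (conj z) (m + 1))
      (hermiteNorm c m * hermiteKernelShift c z (conj z) m)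
      (hermiteNorm c m * hermiteKernel c z (conj z) m) := by
  have hc' : (c : ℂ) ≠ 0 := Complex.ofReal_ne_zero.2 hc.ne'
  induction m with
  | zero =>
    convert hasSecondMoments_charLaw_zero hc z using 1
    · simp [hermiteNorm, hermiteKernel, monicHermite, Finset.sum_range_succ]
      field_simp
      ring
    · simp [hermiteNorm, hermiteKernelShift, monicHermite]
    · simp [hermiteNorm, hermiteKernel, monicHermite]
  | succ m ih =>
    have hs := hermiteKernelShift_succ hc z (conj z) m
    have hi := hermiteKernel_identity hc z (conj z) m
    have n1 := ofReal_hermiteNorm_succ c m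
    have n2 := ofReal_hermiteNorm_succ c (m + 1)
    convert ih.succ hc z m using 1
    · simp only [map_mul, conj_hermiteKernelShift, Complex.conj_ofReal]
      rw [n2, n1]
      push_cast
      rw [hs] at hi
      linear_combination (-((m + 1) / c * (hermiteNorm c m : ℂ))) * hi
    · simp only [map_mul, conj_hermiteKernelShift, Complex.conj_ofReal]
      rw [hs, n1]
      ring

end CharMoments

/-! ### Averaging over a Gaussian real part. -/

section CharExpectation

open Polynomial

variable {c : ℝ}

local notation "conj" => starRingEnd ℂ

/-- The mean of `|det (z - H) - iδ det (z - H')|²`, where `H'` is the first minor of the Gaussian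
Hermitian matrix `H` of size `m + 1` and the real part of `z` is Gaussian. -/
def meanCharSq (c Y δ : ℝ) (m : ℕ) : ℝ :=
  hermiteNorm c (m + 1) * lagMass (m + 2) (c * Y ^ 2) +
    δ ^ 2 * hermiteNorm c m * lagMass (m + 1) (c * Y ^ 2) -
    2 * δ * Y * hermiteNorm c m * ∑ k ∈ Finset.range (m + 1), lagMass (k + 1) (c * Y ^ 2)

/-- The polynomial in the real part of `z` that underlies `hermiteKernel`. -/
def mixedPoly (c Y : ℝ) (k l : ℕ) : ℂ[X] :=
  (monicHermite c k).comp (X + C (Complex.I * Y)) * (monicHermite c l).comp (X - C (Complex.I * Y))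

lemma sum_hermiteMoment_diag (hc : 0 < c) (Y : ℝ) (m : ℕ) :
    ∑ k ∈ Finset.range (m + 1), (1 / hermiteNorm c k : ℂ) * hermiteMoment c Y k k =
      lagMass (m + 1) (c * Y ^ 2) := by
  have h : ∀ k ∈ Finset.range (m + 1), (1 / hermiteNorm c k : ℂ) * hermiteMoment c Y k k =
      ((lagMass (k + 1) (c * Y ^ 2) : ℂ) - lagMass k (c * Y ^ 2)) := fun k _ => by
    have := ofReal_hermiteNorm_ne_zero hc k
    rw [(hermiteMoment_eq hc k Y).1]
    push_cast
    field_simp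
  rw [Finset.sum_congr rfl h, Finset.sum_range_sub fun k => (lagMass k (c * Y ^ 2) : ℂ)]
  simp [lagMass]

lemma sum_hermiteMoment_shift (hc : 0 < c) (Y : ℝ) (m : ℕ) :
    ∑ k ∈ Finset.range (m + 1), (1 / hermiteNorm c k : ℂ) * hermiteMoment c Y (k + 1) k =
      Complex.I * Y * ∑ k ∈ Finset.range (m + 1), (lagMass (k + 1) (c * Y ^ 2) : ℂ) := by
  rw [Finset.mul_sum]
  refine Finset.sum_congr rfl fun k _ => ?_
  have := ofReal_hermiteNorm_ne_zero hc k
  rw [(hermiteMoment_eq hc k Y).2]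
  push_cast
  field_simp

lemma sum_hermiteMoment_shift' (hc : 0 < c) (Y : ℝ) (m : ℕ) :
    ∑ k ∈ Finset.range (m + 1), (1 / hermiteNorm c k : ℂ) * hermiteMoment c Y k (k + 1) =
      -(Complex.I * Y * ∑ k ∈ Finset.range (m + 1), (lagMass (k + 1) (c * Y ^ 2) : ℂ)) := by
  have h := sum_hermiteMoment_shift hc (-Y) m
  simp only [hermiteMoment_comm] at h
  rw [h]
  simp

/-- For fixed imaginary part the mean is a polynomial in the real part a; it is displayed as such so
that `gaussE` can be applied to it. -/
lemma integral_charLaw_norm_sq (hc : 0 < c) (Y δ : ℝ) (m : ℕ) (a : ℝ) :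
    Integrable (fun p : ℂ × ℂ => ‖p.1 - Complex.I * δ * p.2‖ ^ 2)
      (charLaw c (a + Complex.I * Y) m) ∧
    ((∫ p : ℂ × ℂ, ‖p.1 - Complex.I * δ * p.2‖ ^ 2 ∂(charLaw c (a + Complex.I * Y) m) : ℝ) : ℂ) =
      ((hermiteNorm c (m + 1) : ℂ) • ∑ k ∈ Finset.range (m + 2),
          (1 / hermiteNorm c k : ℂ) • mixedPoly c Y k k +
        (δ ^ 2 * hermiteNorm c m : ℂ) • ∑ k ∈ Finset.range (m + 1),
          (1 / hermiteNorm c k : ℂ) • mixedPoly c Y k k +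
        (Complex.I * δ * hermiteNorm c m : ℂ) • ∑ k ∈ Finset.range (m + 1),
          (1 / hermiteNorm c k : ℂ) • mixedPoly c Y (k + 1) k -
        (Complex.I * δ * hermiteNorm c m : ℂ) • ∑ k ∈ Finset.range (m + 1),
          (1 / hermiteNorm c k : ℂ) • mixedPoly c Y k (k + 1)).eval (a : ℂ) := by
  set z : ℂ := a + Complex.I * Y with hz
  have h := hasSecondMoments_charLaw hc z m
  have hzc : conj z = a - Complex.I * Y := by simp [hz, sub_eq_add_neg]
  have hpt : ∀ p : ℂ × ℂ, ((‖p.1 - Complex.I * δ * p.2‖ ^ 2 : ℝ) : ℂ) =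
      p.1 * conj p.1 + (δ : ℂ) ^ 2 * (p.2 * conj p.2) + Complex.I * δ * (p.1 * conj p.2) -
        Complex.I * δ * (conj p.1 * p.2) := fun p => by
    push_cast
    rw [← Complex.mul_conj']
    simp only [map_sub, map_mul, Complex.conj_I, Complex.conj_ofReal]
    linear_combination (-(δ : ℂ) ^ 2 * (p.2 * conj p.2)) * Complex.I_sq
  have i1 := h.integrable_fst
  have i2 := h.integrable_snd.const_mul ((δ : ℂ) ^ 2)
  have i3 := h.integrable_mixed.const_mul (Complex.I * δ)
  have i4 := h.integrable_mixed'.const_mul (Complex.I * δ)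
  have hI : Integrable (fun p : ℂ × ℂ => ((‖p.1 - Complex.I * δ * p.2‖ ^ 2 : ℝ) : ℂ)) (charLaw c z m) := by
    simp only [hpt]
    exact ((i1.add i2).add i3).sub i4
  refine ⟨hI.re, ?_⟩
  rw [← integral_complex_ofReal]
  simp only [hpt]
  have e := integral_sub ((i1.add i2).add i3) i4
  rw [integral_add' (i1.add i2) i3, integral_add' i1 i2, integral_const_mul, integral_const_mul,
    integral_const_mul, h.integral_fst, h.integral_snd, h.integral_mixed, h.integral_mixed'] at e
  simp only [Pi.add_apply] at e
  rw [e]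
  simp only [map_mul, conj_hermiteKernelShift, Complex.conj_ofReal]
  have ev : ∀ k l, (mixedPoly c Y k l).eval (a : ℂ) =
      (monicHermite c k).eval z * (monicHermite c l).eval (conj z) := fun k l => by
    rw [hzc, hz]; simp [mixedPoly]
  simp only [eval_sub, eval_add, eval_smul, eval_finsetSum, ev, smul_eq_mul]
  have k1 : ∀ m, hermiteKernel c z (conj z) m = ∑ k ∈ Finset.range (m + 1),
      (1 / hermiteNorm c k : ℂ) * ((monicHermite c k).eval z * (monicHermite c k).eval (conj z)) :=
    fun m => Finset.sum_congr rfl fun k _ => by ring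
  have k2 : hermiteKernelShift c z (conj z) m = ∑ k ∈ Finset.range (m + 1),
      (1 / hermiteNorm c k : ℂ) * ((monicHermite c (k + 1)).eval z * (monicHermite c k).eval (conj z)) :=
    Finset.sum_congr rfl fun k _ => by ring
  have k3 : hermiteKernelShift c (conj z) z m = ∑ k ∈ Finset.range (m + 1),
      (1 / hermiteNorm c k : ℂ) * ((monicHermite c k).eval z * (monicHermite c (k + 1)).eval (conj z)) :=
    Finset.sum_congr rfl fun k _ => by ring
  rw [← k1, ← k1, ← k2, ← k3]
  ring

/-- Averaging turns the kernels into sums of `hermiteMoment`: the diagonal ones telescope to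
`lagMass`, and the two shifted ones are opposite, hence add up in the cross term. Nonnegativity of
the closed form comes for free from its origin as a mean square. -/
lemma lintegral_charLaw_norm_sq (hc : 0 < c) (Y δ : ℝ) (m : ℕ) :
    ∫⁻ a : ℝ, ∫⁻ p : ℂ × ℂ, ENNReal.ofReal (‖p.1 - Complex.I * δ * p.2‖ ^ 2)
      ∂(charLaw c (a + Complex.I * Y) m) ∂(diagLaw c) = ENNReal.ofReal (meanCharSq c Y δ m) ∧
    0 ≤ meanCharSq c Y δ m := by
  have hin := integral_charLaw_norm_sq hc Y δ m
  set T : ℂ[X] := (hermiteNorm c (m + 1) : ℂ) • ∑ k ∈ Finset.range (m + 2),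
          (1 / hermiteNorm c k : ℂ) • mixedPoly c Y k k +
        (δ ^ 2 * hermiteNorm c m : ℂ) • ∑ k ∈ Finset.range (m + 1),
          (1 / hermiteNorm c k : ℂ) • mixedPoly c Y k k +
        (Complex.I * δ * hermiteNorm c m : ℂ) • ∑ k ∈ Finset.range (m + 1),
          (1 / hermiteNorm c k : ℂ) • mixedPoly c Y (k + 1) k -
        (Complex.I * δ * hermiteNorm c m : ℂ) • ∑ k ∈ Finset.range (m + 1),
          (1 / hermiteNorm c k : ℂ) • mixedPoly c Y k (k + 1) with hT
  have hE : gaussE c T = (meanCharSq c Y δ m : ℂ) := by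
    have e : ∀ k l, gaussE c (mixedPoly c Y k l) = hermiteMoment c Y k l := fun _ _ => rfl
    rw [hT]
    simp only [map_sub, map_add, map_smul, map_sum, e, smul_eq_mul]
    rw [sum_hermiteMoment_diag hc, sum_hermiteMoment_diag hc, sum_hermiteMoment_shift hc,
      sum_hermiteMoment_shift' hc, meanCharSq]
    push_cast
    linear_combination (2 * (δ : ℂ) * Y * hermiteNorm c m *
      ∑ k ∈ Finset.range (m + 1), (lagMass (k + 1) (c * Y ^ 2) : ℂ)) * Complex.I_sq
  set G : ℝ → ℝ := fun a => ∫ p : ℂ × ℂ, ‖p.1 - Complex.I * δ * p.2‖ ^ 2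
    ∂(charLaw c (a + Complex.I * Y) m) with hG
  have hGT : ∀ a : ℝ, G a = (T.eval (a : ℂ)).re := fun a => by
    rw [← (hin a).2, Complex.ofReal_re]
  have hG0 : ∀ a, 0 ≤ G a := fun a => integral_nonneg fun p => by positivity
  have hGint : Integrable G (diagLaw c) := by
    refine (integrable_eval_diagLaw c T).re.congr (Eventually.of_forall fun a => ?_)
    rw [hGT]; rfl
  have hval : ∫ a, G a ∂(diagLaw c) = meanCharSq c Y δ m := by
    have : ((∫ a, G a ∂(diagLaw c) : ℝ) : ℂ) = gaussE c T := by
      rw [← integral_complex_ofReal, gaussE_apply]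
      exact integral_congr_ae (Eventually.of_forall fun a => (hin a).2)
    rw [hE] at this
    exact_mod_cast this
  refine ⟨?_, hval ▸ integral_nonneg hG0⟩
  rw [← hval, ofReal_integral_eq_lintegral_ofReal hGint (Eventually.of_forall hG0)]
  refine lintegral_congr fun a => ?_
  rw [← ofReal_integral_eq_lintegral_ofReal (hin a).1 (Eventually.of_forall fun p => by positivity)]

end CharExpectation

/-! ### Linear algebra of the Jacobian determinant. -/

section EigenMapDet

open Matrix

variable {n : ℕ}

/-- The map is block triangular with an identity block, so it is a shear composed with a block
diagonal map. The square of the shear is conjugate to the shear by scaling the second factor; its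
determinant d ≠ 0 satisfies d² = d, hence d = 1. -/
lemma det_shear {E F : Type*} [AddCommGroup E] [Module ℝ E] [FiniteDimensional ℝ E]
    [AddCommGroup F] [Module ℝ F] [FiniteDimensional ℝ F] (D : E × F →ₗ[ℝ] E × F)
    (D₂ : F →ₗ[ℝ] F) (h1 : ∀ q, (D q).1 = q.1) (h2 : ∀ u, (D (0, u)).2 = D₂ u) :
    LinearMap.det D = LinearMap.det D₂ := by
  let S : ℝ → (E × F →ₗ[ℝ] E × F) := fun r =>
    (LinearMap.fst ℝ E F).prod (LinearMap.snd ℝ E F +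
      r • (LinearMap.snd ℝ E F ∘ₗ D ∘ₗ LinearMap.inl ℝ E F ∘ₗ LinearMap.fst ℝ E F))
  let P : ℝ → (E × F →ₗ[ℝ] E × F) := fun r => LinearMap.prodMap LinearMap.id (r • LinearMap.id)
  have hD : D = S 1 ∘ₗ LinearMap.prodMap LinearMap.id D₂ := by
    refine LinearMap.ext fun q => Prod.ext (by simp [S, h1]) ?_
    have : D q = D (q.1, 0) + D (0, q.2) := by rw [← map_add]; simp
    simp [S, this, h2, add_comm]
  have hmul : S 1 ∘ₗ S 1 = S 2 := by
    refine LinearMap.ext fun q => Prod.ext (by simp [S]) ?_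
    simp [S, two_smul, add_assoc]
  have hconj : P 2 ∘ₗ S 1 = S 2 ∘ₗ P 2 := by
    refine LinearMap.ext fun q => Prod.ext (by simp [S, P]) ?_
    simp [S, P, smul_add]
  have hinv : S 1 ∘ₗ S (-1) = LinearMap.id := by
    refine LinearMap.ext fun q => Prod.ext (by simp [S]) ?_
    simp [S]
  have hne : LinearMap.det (S 1) ≠ 0 := by
    intro h
    have := congrArg LinearMap.det hinv
    rw [LinearMap.det_comp, h, LinearMap.det_id] at this
    simp at this
  have hP : LinearMap.det (P 2) ≠ 0 := by
    simp only [P]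
    rw [LinearMap.det_prodMap, LinearMap.det_smul]
    simp
  have e1 := congrArg LinearMap.det hmul
  have e2 := congrArg LinearMap.det hconj
  rw [LinearMap.det_comp] at e1
  rw [LinearMap.det_comp, LinearMap.det_comp, ← e1, mul_comm] at e2
  have e3 : LinearMap.det (S 1) = 1 := by
    have := mul_right_cancel₀ hP e2
    exact (mul_eq_left₀ hne).1 this.symm
  rw [hD, LinearMap.det_comp, e3, LinearMap.det_prodMap]
  simp

/-- The real part of the bilinear pairing with `a`, as a real-linear functional. -/
def reDot (a : Fin n → ℂ) : (Fin n → ℂ) →ₗ[ℝ] ℝ where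
  toFun u := (a ⬝ᵥ u).re
  map_add' u v := by simp [dotProduct_add]
  map_smul' r u := by simp [dotProduct_smul]

/-- The imaginary part of the bilinear pairing with `a`, as a real-linear functional. -/
def imDot (a : Fin n → ℂ) : (Fin n → ℂ) →ₗ[ℝ] ℝ where
  toFun u := (a ⬝ᵥ u).im
  map_add' u v := by simp [dotProduct_add]
  map_smul' r u := by simp [dotProduct_smul]

/-- `|w|²` -/
def sqNorm (w : Fin n → ℂ) : ℝ := ∑ i, ‖w i‖ ^ 2

lemma sqNorm_nonneg (w : Fin n → ℂ) : 0 ≤ sqNorm w := Finset.sum_nonneg fun _ _ => by positivity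

lemma star_dotProduct_self (w : Fin n → ℂ) : star w ⬝ᵥ w = (sqNorm w : ℂ) := by
  simp only [dotProduct, sqNorm, Complex.ofReal_sum]
  refine Finset.sum_congr rfl fun i _ => ?_
  rw [mul_comm]
  simpa using Complex.mul_conj' (w i)

/-- The matrix `A + w w* A*` with `A = z - H`. -/
def eigMatrix (H : Matrix (Fin n) (Fin n) ℂ) (z : ℂ) (w : Fin n → ℂ) : Matrix (Fin n) (Fin n) ℂ :=
  z • 1 - H + vecMulVec w (star (z • w - H *ᵥ w))

lemma eigMatrix_mulVec {H : Matrix (Fin n) (Fin n) ℂ} (hH : H.IsHermitian) (z : ℂ)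
    (w u : Fin n → ℂ) : eigMatrix H z w *ᵥ u = z • u - H *ᵥ u +
      (star z * (star w ⬝ᵥ u) - star w ⬝ᵥ H *ᵥ u) • w := by
  have : star (H *ᵥ w) = star w ᵥ* H := by rw [star_mulVec, hH.eq]
  rw [eigMatrix, add_mulVec, sub_mulVec, smul_mulVec, one_mulVec, vecMulVec_mulVec, star_sub,
    star_smul, sub_dotProduct, smul_dotProduct, this, ← dotProduct_mulVec, op_smul_eq_smul, smul_eq_mul]

lemma det_restrictScalars_toLin (M : Matrix (Fin n) (Fin n) ℂ) :
    LinearMap.det ((Matrix.toLin' M).restrictScalars ℝ) = ‖M.det‖ ^ 2 := by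
  rw [LinearMap.det_restrictScalars, LinearMap.det_toLin', Algebra.norm_complex_apply,
    Complex.normSq_eq_norm_sq]

/-- The determinant of the derivative of the eigenvalue parametrisation. -/
lemma det_eigenMap_deriv {H : Matrix (Fin n) (Fin n) ℂ} (hH : H.IsHermitian) (X Y : ℝ)
    (w : Fin n → ℂ) (D : ℝ × (Fin n → ℂ) →ₗ[ℝ] ℝ × (Fin n → ℂ))
    (hD : ∀ ξ ω, D (ξ, ω) =
      ((1 - sqNorm w) * ξ - X * (2 * (star w ⬝ᵥ ω).re) + 2 * (star w ⬝ᵥ H *ᵥ ω).re,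
      ((ξ : ℂ) - Complex.I * (Y * (2 * (star w ⬝ᵥ ω).re) / (1 + sqNorm w) : ℝ)) • w +
        (((X : ℂ) + Complex.I * Y) • ω - H *ᵥ ω))) :
    LinearMap.det D = ‖(eigMatrix H (X + Complex.I * Y) w).det‖ ^ 2 / (1 + sqNorm w) := by
  set z : ℂ := X + Complex.I * Y with hz
  set t := sqNorm w with ht
  have ht0 : 0 ≤ t := sqNorm_nonneg w
  have ht1 : 1 + t ≠ 0 := by positivity
  let R : (Fin n → ℂ) →ₗ[ℝ] (Fin n → ℂ) :=
    LinearMap.transvection (-(1 + t)⁻¹ • imDot (star w)) (Complex.I • w)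
  let M : (Fin n → ℂ) →ₗ[ℝ] (Fin n → ℂ) := (Matrix.toLin' (eigMatrix H z w)).restrictScalars ℝ
  let T₁ : ℝ × (Fin n → ℂ) →ₗ[ℝ] ℝ × (Fin n → ℂ) :=
    LinearMap.transvection (-(reDot (star w) ∘ₗ LinearMap.snd ℝ ℝ (Fin n → ℂ))) (1, 0)
  let T₂ : ℝ × (Fin n → ℂ) →ₗ[ℝ] ℝ × (Fin n → ℂ) :=
    LinearMap.transvection (LinearMap.fst ℝ ℝ (Fin n → ℂ)) (0, w)
  let T₃ : ℝ × (Fin n → ℂ) →ₗ[ℝ] ℝ × (Fin n → ℂ) :=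
    LinearMap.transvection
      (-(reDot (star (z • w - H *ᵥ w)) ∘ₗ LinearMap.snd ℝ ℝ (Fin n → ℂ))) (1, 0)
  -- The three T's are transvections of determinant 1. M is complex-linear, so its real determinant
  -- is a squared modulus, and R has determinant 1 − t/(1 + t) = 1/(1 + t).
  have hdec : D = T₁ ∘ₗ T₂ ∘ₗ LinearMap.prodMap LinearMap.id (R ∘ₗ M) ∘ₗ T₃ := by
    refine LinearMap.ext fun q => ?_
    obtain ⟨ξ, ω⟩ := q
    rw [hD]
    have hst : star (H *ᵥ w) = star w ᵥ* H := by rw [star_mulVec, hH.eq]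
    have h3 : star (z • w - H *ᵥ w) ⬝ᵥ ω = star z * (star w ⬝ᵥ ω) - star w ⬝ᵥ H *ᵥ ω := by
      rw [star_sub, star_smul, sub_dotProduct, smul_dotProduct, hst, ← dotProduct_mulVec, smul_eq_mul]
    set α := star w ⬝ᵥ ω with hα
    set β := star w ⬝ᵥ H *ᵥ ω with hβ
    have hMω : M ω = z • ω - H *ᵥ ω + (star z * α - β) • w := eigMatrix_mulVec hH z w ω
    have hwM : star w ⬝ᵥ M ω = z * α - β + (star z * α - β) * t := by
      rw [hMω, dotProduct_add, dotProduct_sub, dotProduct_smul, dotProduct_smul,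
        star_dotProduct_self]
      simp [hα, hβ, ht]
    have hRM : R (M ω) = M ω + (-((1 + t)⁻¹ * (z * α - β + (star z * α - β) * t).im)) • (Complex.I • w) := by
      simp only [R, LinearMap.transvection.apply, LinearMap.smul_apply, imDot, LinearMap.coe_mk,
        AddHom.coe_mk, hwM, smul_eq_mul]
      simp
    set b : ℝ := ξ - (star z * α - β).re with hb
    have hT3 : T₃ (ξ, ω) = (b, ω) := by
      simp only [T₃, LinearMap.transvection.apply, LinearMap.neg_apply, LinearMap.comp_apply,
        LinearMap.snd_apply, reDot, LinearMap.coe_mk, AddHom.coe_mk, h3]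
      refine Prod.ext ?_ (by simp)
      simp [hb, sub_eq_add_neg]
    have hcoef : ((b : ℂ) + (star z * α - β) -
        ((1 + t)⁻¹ * (z * α - β + (star z * α - β) * t).im : ℝ) * Complex.I) =
        (ξ : ℂ) - Complex.I * (Y * (2 * α.re) / (1 + t) : ℝ) := by
      have hr : Y * (2 * α.re) / (1 + t) = -((star z * α - β).im - (1 + t)⁻¹ *
          (z * α - β + (star z * α - β) * t).im) := by
        simp [hz]
        field_simp
        ring
      rw [hr]
      generalize (1 + t)⁻¹ * (z * α - β + (star z * α - β) * t).im = s
      rw [hb]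
      generalize star z * α - β = q
      apply Complex.ext <;> simp
    have hu : T₂ (b, R (M ω)) = (b, ((ξ : ℂ) - Complex.I * (Y * (2 * α.re) / (1 + t) : ℝ)) • w +
        (z • ω - H *ᵥ ω)) := by
      rw [← hcoef, hRM, hMω]
      simp only [T₂, LinearMap.transvection.apply]
      refine Prod.ext (by simp) ?_
      ext i
      simp [Complex.real_smul]
      ring
    simp only [LinearMap.comp_apply, hT3, LinearMap.prodMap_apply, LinearMap.id_apply]
    rw [hu]
    simp only [T₁, LinearMap.transvection.apply]
    refine Prod.ext ?_ (by simp)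
    have hdot : star w ⬝ᵥ (((ξ : ℂ) - Complex.I * (Y * (2 * α.re) / (1 + t) : ℝ)) • w +
        (z • ω - H *ᵥ ω)) = ((ξ : ℂ) - Complex.I * (Y * (2 * α.re) / (1 + t) : ℝ)) * t + (z * α - β) := by
      rw [dotProduct_add, dotProduct_sub, dotProduct_smul, dotProduct_smul, star_dotProduct_self]
      simp [hα, hβ, ht]
    simp only [LinearMap.neg_apply, LinearMap.comp_apply, LinearMap.snd_apply, reDot,
      LinearMap.coe_mk, AddHom.coe_mk, hdot]
    generalize Y * (2 * α.re) / (1 + t) = r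
    simp [hb, hz]
    ring
  have hR : LinearMap.det R = (1 + t)⁻¹ := by
    simp only [R, LinearMap.transvection.det]
    have : imDot (star w) (Complex.I • w) = t := by
      change (star w ⬝ᵥ (Complex.I • w)).im = t
      rw [dotProduct_smul, star_dotProduct_self]
      simp [ht]
    rw [LinearMap.smul_apply, this]
    simp
    field_simp
    ring
  have h1 : LinearMap.det T₁ = 1 := by simp [T₁, LinearMap.transvection.det]
  have h2 : LinearMap.det T₂ = 1 := by simp [T₂, LinearMap.transvection.det]
  have h3 : LinearMap.det T₃ = 1 := by simp [T₃, LinearMap.transvection.det]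
  rw [hdec, LinearMap.det_comp, LinearMap.det_comp, LinearMap.det_comp, LinearMap.det_prodMap,
    LinearMap.det_comp, h1, h2, h3, hR, det_restrictScalars_toLin]
  simp
  ring

end EigenMapDet

/-! ### The eigenpair parametrisation and its derivative. -/

section EigenMap

open Matrix

variable {n : ℕ}

/-- The imaginary part of an eigenvalue with eigenvector `(1, w)`. -/
def eigHeight (γ : ℝ) (w : Fin n → ℂ) : ℝ := γ / (1 + sqNorm w)

/-- The eigenvalue with real part `X` and eigenvector `(1, w)`. -/
def eigValue (γ X : ℝ) (w : Fin n → ℂ) : ℂ := X + Complex.I * eigHeight γ w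

/-- The first row of the matrix with remaining block `H` for which `eigValue γ X w` is an eigenvalue
with eigenvector `(1, w)`. -/
def eigenMap (γ : ℝ) (p : (Fin n → Fin n → ℝ) × (ℝ × (Fin n → ℂ))) :
    (Fin n → Fin n → ℝ) × (ℝ × (Fin n → ℂ)) :=
  (p.1, (p.2.1 * (1 - sqNorm p.2.2) + (star p.2.2 ⬝ᵥ hermitianOf p.1 *ᵥ p.2.2).re,
    eigValue γ p.2.1 p.2.2 • p.2.2 - hermitianOf p.1 *ᵥ p.2.2))

lemma differentiable_sqNorm : Differentiable ℝ (sqNorm (n := n)) := by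
  unfold sqNorm
  refine Differentiable.fun_sum fun i _ => ?_
  exact (differentiable_apply i).norm_sq ℝ

lemma differentiable_hermitianOf (i j : Fin n) :
    Differentiable ℝ fun x : Fin n → Fin n → ℝ => hermitianOf x i j := by
  have h : ∀ k l, Differentiable ℝ fun x : Fin n → Fin n → ℝ => (x k l : ℂ) := fun k l =>
    Complex.ofRealCLM.differentiable.comp (by fun_prop)
  simp only [hermitianOf, of_apply]
  split_ifs
  · exact h _ _
  · exact (h _ _).add ((h _ _).mul_const _)
  · exact (h _ _).sub ((h _ _).mul_const _)

lemma one_add_sqNorm_pos (w : Fin n → ℂ) : 0 < 1 + sqNorm w := by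
  have := sqNorm_nonneg w; positivity

lemma differentiable_eigenMap (γ : ℝ) : Differentiable ℝ (eigenMap (n := n) γ) := by
  have hs : Differentiable ℝ fun p : (Fin n → Fin n → ℝ) × (ℝ × (Fin n → ℂ)) => sqNorm p.2.2 :=
    differentiable_sqNorm.comp (by fun_prop)
  have hH : ∀ i j, Differentiable ℝ fun p : (Fin n → Fin n → ℝ) × (ℝ × (Fin n → ℂ)) =>
      hermitianOf p.1 i j := fun i j => (differentiable_hermitianOf i j).comp differentiable_fst
  have hw : ∀ i, Differentiable ℝ fun p : (Fin n → Fin n → ℝ) × (ℝ × (Fin n → ℂ)) => p.2.2 i :=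
    fun i => by fun_prop
  have hHw : ∀ i, Differentiable ℝ fun p : (Fin n → Fin n → ℝ) × (ℝ × (Fin n → ℂ)) =>
      (hermitianOf p.1 *ᵥ p.2.2) i := fun i => by
    simp only [mulVec, dotProduct]
    exact Differentiable.fun_sum fun j _ => (hH i j).mul (hw j)
  have hz : Differentiable ℝ fun p : (Fin n → Fin n → ℝ) × (ℝ × (Fin n → ℂ)) =>
      eigValue γ p.2.1 p.2.2 := by
    unfold eigValue eigHeight
    refine Differentiable.add (Complex.ofRealCLM.differentiable.comp (by fun_prop)) ?_
    have hY : Differentiable ℝ fun p : (Fin n → Fin n → ℝ) × (ℝ × (Fin n → ℂ)) =>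
        γ / (1 + sqNorm p.2.2) := by
      simp only [div_eq_mul_inv]
      exact Differentiable.const_mul
        (Differentiable.fun_inv (hs.const_add 1) fun p => (one_add_sqNorm_pos _).ne') γ
    exact Differentiable.const_mul (Complex.ofRealCLM.differentiable.comp hY) _
  refine differentiable_fst.prodMk (Differentiable.prodMk ?_ ?_)
  · refine Differentiable.add ?_ ?_
    · exact Differentiable.mul (by fun_prop) ((differentiable_const 1).sub hs)
    · refine Complex.reCLM.differentiable.comp ?_
      simp only [dotProduct, Pi.star_apply]
      refine Differentiable.fun_sum fun i _ => Differentiable.mul ?_ (hHw i)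
      exact Complex.conjCLE.differentiable.comp (hw i)
  · refine differentiable_pi.2 fun i => ?_
    exact (hz.mul (hw i)).sub (hHw i)

lemma sqNorm_add_smul (w ω : Fin n → ℂ) (s : ℝ) :
    sqNorm (w + (s : ℂ) • ω) = sqNorm w + s * (2 * (star w ⬝ᵥ ω).re) + s ^ 2 * sqNorm ω := by
  have h : ((sqNorm (w + (s : ℂ) • ω) : ℝ) : ℂ) = sqNorm w + s * (star w ⬝ᵥ ω + star (star w ⬝ᵥ ω)) +
      s ^ 2 * sqNorm ω := by
    rw [← star_dotProduct_self, ← star_dotProduct_self, ← star_dotProduct_self, ← star_dotProduct ω w,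
      star_add, star_smul]
    simp only [add_dotProduct, dotProduct_add, smul_dotProduct, dotProduct_smul, smul_eq_mul]
    simp
    ring
  have h2 : star w ⬝ᵥ ω + star (star w ⬝ᵥ ω) = ((2 * (star w ⬝ᵥ ω).re : ℝ) : ℂ) := by
    simpa using Complex.add_conj (star w ⬝ᵥ ω)
  rw [h2] at h
  exact_mod_cast h

lemma re_quadForm_add_smul {H : Matrix (Fin n) (Fin n) ℂ} (hH : H.IsHermitian) (w ω : Fin n → ℂ)
    (s : ℝ) : (star (w + (s : ℂ) • ω) ⬝ᵥ H *ᵥ (w + (s : ℂ) • ω)).re =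
      (star w ⬝ᵥ H *ᵥ w).re + s * (2 * (star w ⬝ᵥ H *ᵥ ω).re) + s ^ 2 * (star ω ⬝ᵥ H *ᵥ ω).re := by
  have h1 : star ω ⬝ᵥ H *ᵥ w = star (star w ⬝ᵥ H *ᵥ ω) := by
    rw [star_dotProduct, star_mulVec, hH.eq, ← dotProduct_mulVec]
  have h : star (w + (s : ℂ) • ω) ⬝ᵥ H *ᵥ (w + (s : ℂ) • ω) = star w ⬝ᵥ H *ᵥ w +
      s * (star w ⬝ᵥ H *ᵥ ω + star (star w ⬝ᵥ H *ᵥ ω)) + s ^ 2 * (star ω ⬝ᵥ H *ᵥ ω) := by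
    rw [← h1, star_add, star_smul, mulVec_add, mulVec_smul]
    simp only [add_dotProduct, dotProduct_add, smul_dotProduct, dotProduct_smul, smul_eq_mul]
    simp
    ring
  rw [h]
  have h2 : star w ⬝ᵥ H *ᵥ ω + star (star w ⬝ᵥ H *ᵥ ω) = ((2 * (star w ⬝ᵥ H *ᵥ ω).re : ℝ) : ℂ) := by
    simpa using Complex.add_conj (star w ⬝ᵥ H *ᵥ ω)
  rw [h2, Complex.add_re, Complex.add_re, ← Complex.ofReal_mul, Complex.ofReal_re,
    ← Complex.ofReal_pow, Complex.re_ofReal_mul]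

/-- On a line through the point every ingredient is an explicit function of a real parameter, so the
directional derivative is computed in one variable and identified by uniqueness. -/
lemma fderiv_eigenMap_snd (γ : ℝ) (x : Fin n → Fin n → ℝ) (X : ℝ) (w : Fin n → ℂ) (ξ : ℝ)
    (ω : Fin n → ℂ) : (fderiv ℝ (eigenMap γ) (x, (X, w)) (0, (ξ, ω))).2 =
      ((1 - sqNorm w) * ξ - X * (2 * (star w ⬝ᵥ ω).re) + 2 * (star w ⬝ᵥ hermitianOf x *ᵥ ω).re,
      ((ξ : ℂ) - Complex.I *
        (eigHeight γ w * (2 * (star w ⬝ᵥ ω).re) / (1 + sqNorm w) : ℝ)) • w +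
        (((X : ℂ) + Complex.I * eigHeight γ w) • ω - hermitianOf x *ᵥ ω)) := by
  set H := hermitianOf x
  have hH : H.IsHermitian := hermitianOf_isHermitian x
  set τ := 2 * (star w ⬝ᵥ ω).re
  have ht1 := (one_add_sqNorm_pos w).ne'
  have hcurve : HasDerivAt (fun s : ℝ => ((x, (X, w)) : (Fin n → Fin n → ℝ) × (ℝ × (Fin n → ℂ))) +
      s • (0, (ξ, ω))) (0, (ξ, ω)) 0 := by
    simpa using ((hasDerivAt_id (0 : ℝ)).smul_const
      ((0, (ξ, ω)) : (Fin n → Fin n → ℝ) × (ℝ × (Fin n → ℂ)))).const_add (x, (X, w))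
  have h1 : HasDerivAt (fun s : ℝ => eigenMap γ ((x, (X, w)) + s • (0, (ξ, ω))))
      (fderiv ℝ (eigenMap γ) (x, (X, w)) (0, (ξ, ω))) 0 := by
    have hd := (differentiable_eigenMap γ (x, (X, w))).hasFDerivAt
    have h0 : ((x, (X, w)) : (Fin n → Fin n → ℝ) × (ℝ × (Fin n → ℂ))) + (0 : ℝ) • (0, (ξ, ω)) =
      (x, (X, w)) := by simp
    rw [← h0] at hd
    have := hd.comp_hasDerivAt (0 : ℝ) hcurve
    rw [h0] at this
    exact this
  have h2 : HasDerivAt (fun s : ℝ => (eigenMap γ ((x, (X, w)) + s • (0, (ξ, ω)))).2)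
      ((fderiv ℝ (eigenMap γ) (x, (X, w)) (0, (ξ, ω))).2) 0 := by
    exact ((ContinuousLinearMap.snd ℝ _ _).hasFDerivAt).comp_hasDerivAt (0 : ℝ) h1
  have hT : HasDerivAt (fun s : ℝ => sqNorm w + s * τ + s ^ 2 * sqNorm ω) τ 0 := by
    have := (((hasDerivAt_id (0 : ℝ)).mul_const τ).const_add (sqNorm w)).fun_add
      (((hasDerivAt_id (0 : ℝ)).pow 2).mul_const (sqNorm ω))
    simpa using this
  have hQ : HasDerivAt (fun s : ℝ => (star w ⬝ᵥ H *ᵥ w).re + s * (2 * (star w ⬝ᵥ H *ᵥ ω).re) +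
      s ^ 2 * (star ω ⬝ᵥ H *ᵥ ω).re) (2 * (star w ⬝ᵥ H *ᵥ ω).re) 0 := by
    have := (((hasDerivAt_id (0 : ℝ)).mul_const (2 * (star w ⬝ᵥ H *ᵥ ω).re)).const_add
      ((star w ⬝ᵥ H *ᵥ w).re)).fun_add
      (((hasDerivAt_id (0 : ℝ)).pow 2).mul_const ((star ω ⬝ᵥ H *ᵥ ω).re))
    simpa using this
  have hX : HasDerivAt (fun s : ℝ => X + s * ξ) ξ 0 := by
    simpa using ((hasDerivAt_id (0 : ℝ)).mul_const ξ).const_add X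
  have hY : HasDerivAt (fun s : ℝ => γ / (1 + (sqNorm w + s * τ + s ^ 2 * sqNorm ω)))
      (-(eigHeight γ w * τ / (1 + sqNorm w))) 0 := by
    have := (hasDerivAt_const (0 : ℝ) γ).div (hT.const_add 1) (by simpa using ht1)
    refine this.congr_deriv ?_
    simp [eigHeight]
    field_simp
  have hs : HasDerivAt (fun s : ℝ => (s : ℂ)) 1 0 := by
    simpa using (hasDerivAt_id (0 : ℝ)).ofReal_comp
  have h3 : HasDerivAt (fun s : ℝ => (eigenMap γ ((x, (X, w)) + s • (0, (ξ, ω)))).2)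
      ((1 - sqNorm w) * ξ - X * τ + 2 * (star w ⬝ᵥ H *ᵥ ω).re,
      ((ξ : ℂ) - Complex.I * (eigHeight γ w * τ / (1 + sqNorm w) : ℝ)) • w +
        (((X : ℂ) + Complex.I * eigHeight γ w) • ω - H *ᵥ ω)) 0 := by
    have hfun : (fun s : ℝ => (eigenMap γ ((x, (X, w)) + s • (0, (ξ, ω)))).2) = fun s : ℝ =>
        ((X + s * ξ) * (1 - (sqNorm w + s * τ + s ^ 2 * sqNorm ω)) +
          ((star w ⬝ᵥ H *ᵥ w).re + s * (2 * (star w ⬝ᵥ H *ᵥ ω).re) +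
            s ^ 2 * (star ω ⬝ᵥ H *ᵥ ω).re),
        fun i => (((X + s * ξ : ℝ) : ℂ) + Complex.I *
          (γ / (1 + (sqNorm w + s * τ + s ^ 2 * sqNorm ω)) : ℝ)) * (w i + s * ω i) -
            ((H *ᵥ w) i + s * (H *ᵥ ω) i)) := by
      funext s
      have e : ((x, (X, w)) : (Fin n → Fin n → ℝ) × (ℝ × (Fin n → ℂ))) + s • (0, (ξ, ω)) =
          (x, (X + s * ξ, w + (s : ℂ) • ω)) := by
        refine Prod.ext (by simp) (Prod.ext (by simp) ?_)
        ext i; simp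
      rw [e]
      refine Prod.ext ?_ ?_
      · simp only [eigenMap]
        rw [sqNorm_add_smul, re_quadForm_add_smul hH]
      · ext i
        simp only [eigenMap, eigValue, eigHeight]
        rw [sqNorm_add_smul, mulVec_add, mulVec_smul]
        simp [H, τ]
        ring
    rw [hfun]
    refine HasDerivAt.prodMk ?_ (hasDerivAt_pi.2 fun i => ?_)
    · refine ((hX.mul (hT.const_sub 1)).add hQ).congr_deriv ?_
      simp
      ring
    · have hw : HasDerivAt (fun s : ℝ => w i + s * ω i) (ω i) 0 := by
        simpa using (hs.mul_const (ω i)).const_add (w i)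
      have hHw : HasDerivAt (fun s : ℝ => (H *ᵥ w) i + s * (H *ᵥ ω) i) ((H *ᵥ ω) i) 0 := by
        simpa using (hs.mul_const ((H *ᵥ ω) i)).const_add ((H *ᵥ w) i)
      refine (((hX.ofReal_comp.add (hY.ofReal_comp.const_mul Complex.I)).mul hw).sub hHw).congr_deriv ?_
      simp [eigHeight]
      ring
  exact h2.unique h3

lemma det_fderiv_eigenMap (γ : ℝ) (p : (Fin n → Fin n → ℝ) × (ℝ × (Fin n → ℂ))) :
    (fderiv ℝ (eigenMap γ) p).det =
      ‖(eigMatrix (hermitianOf p.1) (eigValue γ p.2.1 p.2.2) p.2.2).det‖ ^ 2 /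
        (1 + sqNorm p.2.2) := by
  obtain ⟨x, X, w⟩ := p
  have hfst : ∀ q, (fderiv ℝ (eigenMap γ) (x, (X, w)) q).1 = q.1 := by
    intro q
    have h := (differentiable_eigenMap γ (x, (X, w))).hasFDerivAt
    have h1 := (ContinuousLinearMap.fst ℝ (Fin n → Fin n → ℝ) (ℝ × (Fin n → ℂ))).hasFDerivAt.comp
      (x, (X, w)) h
    have h2 : HasFDerivAt (fun p : (Fin n → Fin n → ℝ) × (ℝ × (Fin n → ℂ)) => p.1)
      (ContinuousLinearMap.fst ℝ _ _) (x, (X, w)) := hasFDerivAt_fst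
    exact congrArg (fun L => L q) (h1.unique h2)
  let D : ℝ × (Fin n → ℂ) →ₗ[ℝ] ℝ × (Fin n → ℂ) := LinearMap.snd ℝ _ _ ∘ₗ
    (fderiv ℝ (eigenMap γ) (x, (X, w)) : (Fin n → Fin n → ℝ) × (ℝ × (Fin n → ℂ)) →ₗ[ℝ]
      (Fin n → Fin n → ℝ) × (ℝ × (Fin n → ℂ))) ∘ₗ
    LinearMap.inr ℝ _ _
  rw [ContinuousLinearMap.det, det_shear _ D hfst fun u => rfl]
  exact det_eigenMap_deriv (hermitianOf_isHermitian x) X (eigHeight γ w) w D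
    fun ξ ω => fderiv_eigenMap_snd γ x X w ξ ω

instance : (volume : Measure ((Fin n → Fin n → ℝ) × (ℝ × (Fin n → ℂ)))).IsAddHaarMeasure := by
  have h1 : (volume : Measure (Fin n → ℝ)).IsAddHaarMeasure := inferInstance
  have h2 : (volume : Measure (Fin n → Fin n → ℝ)).IsAddHaarMeasure :=
    Measure.instIsAddHaarMeasureForallVolumeOfMeasurableAddOfSigmaFinite
  have h3 : (volume : Measure (ℝ × (Fin n → ℂ))).IsAddHaarMeasure :=
    Measure.prod.instIsAddHaarMeasure _ _
  exact Measure.prod.instIsAddHaarMeasure _ _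

lemma lintegral_eigenMap (γ : ℝ) {C : Set ((Fin n → Fin n → ℝ) × (ℝ × (Fin n → ℂ)))}
    (hC : MeasurableSet C) {W : (Fin n → Fin n → ℝ) × (ℝ × (Fin n → ℂ)) → ℝ≥0∞}
    (hW : Measurable W) :
    ∫⁻ p in C, ENNReal.ofReal (‖(eigMatrix (hermitianOf p.1) (eigValue γ p.2.1 p.2.2) p.2.2).det‖ ^ 2 /
        (1 + sqNorm p.2.2)) * W (eigenMap γ p) =
      ∫⁻ y, Measure.count (eigenMap γ ⁻¹' {y} ∩ C) * W y := by
  rw [← lintegral_abs_det_mul_eq_lintegral_count volume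
    (fun p => (differentiable_eigenMap γ p).hasFDerivAt) hC hW]
  refine lintegral_congr fun p => ?_
  have := one_add_sqNorm_pos p.2.2
  rw [det_fderiv_eigenMap, abs_of_nonneg (by positivity)]

/-- Critical values are negligible. Through `rootMultiplicity_eigValue` this yields almost sure
simplicity of the eigenvalues. -/
lemma ae_det_eigMatrix_ne_zero (γ : ℝ) :
    ∀ᵐ y : (Fin n → Fin n → ℝ) × (ℝ × (Fin n → ℂ)), ∀ p, eigenMap γ p = y →
      (eigMatrix (hermitianOf p.1) (eigValue γ p.2.1 p.2.2) p.2.2).det ≠ 0 := by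
  set C : Set ((Fin n → Fin n → ℝ) × (ℝ × (Fin n → ℂ))) :=
    {p | (fderiv ℝ (eigenMap γ) p).det = 0} with hCdef
  have h : (volume : Measure ((Fin n → Fin n → ℝ) × (ℝ × (Fin n → ℂ)))) (eigenMap γ '' C) = 0 :=
    addHaar_image_eq_zero_of_det_fderivWithin_eq_zero volume
      (fun p _ => (differentiable_eigenMap γ p).hasFDerivAt.hasFDerivWithinAt) fun p hp => hp
  filter_upwards [measure_eq_zero_iff_ae_notMem.1 h] with y hy p hp hdet
  refine hy ⟨p, ?_, hp⟩
  rw [hCdef, mem_ofPred_eq, det_fderiv_eigenMap, hdet]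
  simp

end EigenMap

/-! ### Almost surely no eigenvector has vanishing first coordinate. -/

section NoRealEigenvalue

open Matrix

variable {n : ℕ}

/-- The Hermitian matrix has an eigenvector whose first coordinate vanishes. -/
def HasSmallEigenvector (x : Fin (n + 1) → Fin (n + 1) → ℝ) : Prop :=
  ∃ u : Fin (n + 1) → ℂ, u ≠ 0 ∧ u 0 = 0 ∧ ∃ l : ℂ, hermitianOf x *ᵥ u = l • u

lemma eq_zero_of_star_dotProduct_self {w : Fin n → ℂ} (h : star w ⬝ᵥ w = 0) : w = 0 := by
  rw [star_dotProduct_self, Complex.ofReal_eq_zero, sqNorm,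
    Finset.sum_eq_zero_iff_of_nonneg fun _ _ => by positivity] at h
  ext i
  simpa using h i (Finset.mem_univ i)

lemma eval_charpoly_eq_zero_iff (M : Matrix (Fin n) (Fin n) ℂ) (z : ℂ) :
    M.charpoly.eval z = 0 ↔ ∃ u ≠ 0, M *ᵥ u = z • u := by
  rw [Matrix.eval_charpoly, ← Matrix.exists_mulVec_eq_zero_iff]
  refine exists_congr fun u => and_congr_right fun _ => ?_
  rw [sub_mulVec, sub_eq_zero, scalar_apply, ← smul_one_eq_diagonal, smul_mulVec, one_mulVec, eq_comm]

/-- Normalised to the compact unit sphere, with the eigenvalue eliminated by the Rayleigh quotient,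
the condition is closed, and projection along a compact factor preserves closedness. It serves for
measurability. -/
lemma isClosed_hasSmallEigenvector :
    IsClosed {x : Fin (n + 1) → Fin (n + 1) → ℝ | HasSmallEigenvector x} := by
  let K := Metric.sphere (0 : Fin (n + 1) → ℂ) 1
  have hH := continuous_hermitianOf (n := n + 1)
  have hcl : IsClosed {p : (Fin (n + 1) → Fin (n + 1) → ℝ) × K | (p.2 : Fin (n + 1) → ℂ) 0 = 0 ∧
      (star (p.2 : Fin (n + 1) → ℂ) ⬝ᵥ p.2) • (hermitianOf p.1 *ᵥ p.2) =
        (star (p.2 : Fin (n + 1) → ℂ) ⬝ᵥ hermitianOf p.1 *ᵥ p.2) • (p.2 : Fin (n + 1) → ℂ)} := by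
    have hc : Continuous fun p : (Fin (n + 1) → Fin (n + 1) → ℝ) × K =>
        hermitianOf p.1 *ᵥ (p.2 : Fin (n + 1) → ℂ) :=
      (hH.comp continuous_fst).matrix_mulVec (continuous_subtype_val.comp continuous_snd)
    have hu : Continuous fun p : (Fin (n + 1) → Fin (n + 1) → ℝ) × K => (p.2 : Fin (n + 1) → ℂ) :=
      continuous_subtype_val.comp continuous_snd
    refine IsClosed.inter (isClosed_eq ((continuous_apply 0).comp hu) continuous_const) (isClosed_eq ?_ ?_)
    · exact (hu.star.dotProduct hu).smul hc
    · exact (hu.star.dotProduct hc).smul hu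
  have himg := isClosedMap_fst_of_compactSpace _ hcl
  convert himg using 1
  ext x
  constructor
  · rintro ⟨u, hu, hu0, l, hl⟩
    have hn : ‖u‖ ≠ 0 := norm_ne_zero_iff.2 hu
    refine ⟨(x, ⟨((‖u‖⁻¹ : ℝ) : ℂ) • u, ?_⟩), ⟨?_, ?_⟩, rfl⟩
    · simp [K, norm_smul, hn]
    · simp [hu0]
    · simp only [mulVec_smul, hl, smul_dotProduct, dotProduct_smul, star_smul, smul_smul, smul_eq_mul]
      congr 1
      ring
  · rintro ⟨⟨y, u⟩, ⟨h0, h1⟩, rfl⟩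
    have hu : (u : Fin (n + 1) → ℂ) ≠ 0 := by
      intro h
      have := u.2
      rw [h] at this
      simp [K] at this
    have hs : star (u : Fin (n + 1) → ℂ) ⬝ᵥ u ≠ 0 := fun h => hu (eq_zero_of_star_dotProduct_self h)
    refine ⟨u, hu, h0, (star (u : Fin (n + 1) → ℂ) ⬝ᵥ u)⁻¹ *
      (star (u : Fin (n + 1) → ℂ) ⬝ᵥ hermitianOf y *ᵥ u), ?_⟩
    rw [← smul_smul, ← h1, smul_smul, inv_mul_cancel₀ hs, one_smul]

lemma mulVec_cons_zero (a : ℝ) (v : Fin n → ℂ) (x : Fin n → Fin n → ℝ) (u : Fin (n + 1) → ℂ)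
    (h0 : u 0 = 0) (l : ℂ) (h : hermitianOf (border a v x) *ᵥ u = l • u) :
    star v ⬝ᵥ (fun i => u i.succ) = 0 ∧
      hermitianOf x *ᵥ (fun i => u i.succ) = l • fun i => u i.succ := by
  refine ⟨?_, ?_⟩
  · have := congrFun h 0
    simpa [mulVec, dotProduct, Fin.sum_univ_succ, h0] using this
  · ext i
    have := congrFun h i.succ
    simpa [mulVec, dotProduct, Fin.sum_univ_succ, h0] using this

/-- `v ↦ v* w` as a real-linear map. -/
def starDot (w : Fin n → ℂ) : (Fin n → ℂ) →ₗ[ℝ] ℂ where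
  toFun v := star v ⬝ᵥ w
  map_add' u v := by simp [add_dotProduct]
  map_smul' r u := by simp [smul_dotProduct]

lemma volume_starDot_eq_zero {w : Fin n → ℂ} (hw : w ≠ 0) :
    volume {v : Fin n → ℂ | star v ⬝ᵥ w = 0} = 0 := by
  have h : LinearMap.ker (starDot w) ≠ ⊤ := by
    intro h
    have : w ∈ LinearMap.ker (starDot w) := h ▸ Submodule.mem_top
    exact hw (eq_zero_of_star_dotProduct_self this)
  exact Measure.addHaar_submodule volume _ h

/-- Eigenspaces of x are one-dimensional, since two independent eigenvectors could be combined to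
cancel the first coordinate. A bad v is therefore orthogonal to one of finitely many fixed vectors.
-/
lemma volume_border_small_eq_zero {x : Fin (n + 1) → Fin (n + 1) → ℝ} (hx : ¬ HasSmallEigenvector x)
    (a : ℝ) : volume {v : Fin (n + 1) → ℂ | HasSmallEigenvector (border a v x)} = 0 := by
  have hpick : ∀ l : ℂ, ∃ w : Fin (n + 1) → ℂ, w ≠ 0 ∧ ∀ u ≠ 0, hermitianOf x *ᵥ u = l • u →
      ∀ v : Fin (n + 1) → ℂ, star v ⬝ᵥ u = 0 → star v ⬝ᵥ w = 0 := by
    intro l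
    by_cases hl : ∃ w ≠ 0, hermitianOf x *ᵥ w = l • w
    · obtain ⟨w, hw, hwl⟩ := hl
      refine ⟨w, hw, fun u hu hul v hv => ?_⟩
      have hu0 : u 0 ≠ 0 := fun h => hx ⟨u, hu, h, l, hul⟩
      have hz : u 0 • w - w 0 • u = 0 := by
        by_contra hne
        refine hx ⟨_, hne, by simp [mul_comm], l, ?_⟩
        rw [mulVec_sub, mulVec_smul, mulVec_smul, hwl, hul, smul_sub, smul_comm, smul_comm (w 0)]
      have hd := congrArg (fun y => star v ⬝ᵥ y) (sub_eq_zero.1 hz)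
      simp only [dotProduct_smul, hv, mul_zero, smul_eq_mul] at hd
      exact (mul_eq_zero.1 hd).resolve_left hu0
    -- If l is not an eigenvalue, any nonzero vector will do.
    · refine ⟨Pi.single 0 1, by simp, fun u hu hul => absurd ⟨u, hu, hul⟩ hl⟩
  choose w hw0 hw using hpick
  refine measure_mono_null (t := ⋃ l ∈ (hermitianOf x).charpoly.roots.toFinset,
    {v : Fin (n + 1) → ℂ | star v ⬝ᵥ w l = 0}) ?_ ?_
  · rintro v ⟨u, hu, hu0, l, hl⟩
    obtain ⟨h1, h2⟩ := mulVec_cons_zero a v x u hu0 l hl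
    have hu' : (fun i : Fin (n + 1) => u i.succ) ≠ 0 := by
      intro h
      refine hu (funext fun i => ?_)
      refine Fin.cases hu0 (fun j => congrFun h j) i
    have hroot : l ∈ (hermitianOf x).charpoly.roots.toFinset := by
      rw [Multiset.mem_toFinset, Polynomial.mem_roots (Matrix.charpoly_monic _).ne_zero]
      exact (eval_charpoly_eq_zero_iff _ _).2 ⟨_, hu', h2⟩
    exact mem_biUnion hroot (hw l _ hu' h2 v h1)
  · exact (measure_biUnion_null_iff (Finset.countable_toSet _)).2 fun l _ => volume_starDot_eq_zero (hw0 l)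

lemma ae_not_hasSmallEigenvector (n : ℕ) :
    ∀ᵐ x : Fin (n + 1) → Fin (n + 1) → ℝ, ¬ HasSmallEigenvector x := by
  induction n with
  | zero =>
    refine Eventually.of_forall fun x => ?_
    rintro ⟨u, hu, hu0, _⟩
    refine hu (funext fun i => ?_)
    rw [Fin.eq_zero i]; exact hu0
  | succ n ih =>
    set S : Set (Fin (n + 2) → Fin (n + 2) → ℝ) := {x | HasSmallEigenvector x} with hS
    have hSm : MeasurableSet S := isClosed_hasSmallEigenvector.measurableSet
    have hind : Measurable (S.indicator (1 : (Fin (n + 2) → Fin (n + 2) → ℝ) → ℝ≥0∞)) :=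
      measurable_one.indicator hSm
    rw [ae_iff]
    simp only [not_not]
    rw [← lintegral_indicator_one hSm, lintegral_border hind]
    have hz : ∀ a : ℝ, ∫⁻ v : Fin (n + 1) → ℂ, ∫⁻ x : Fin (n + 1) → Fin (n + 1) → ℝ,
        S.indicator 1 (border a v x) = 0 := by
      intro a
      have hm : Measurable fun p : (Fin (n + 1) → ℂ) × (Fin (n + 1) → Fin (n + 1) → ℝ) =>
          S.indicator (1 : (Fin (n + 2) → Fin (n + 2) → ℝ) → ℝ≥0∞) (border a p.1 p.2) :=
        hind.comp ((measurePreserving_border (n := n + 1)).measurable.comp measurable_prodMk_left)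
      rw [lintegral_lintegral_swap hm.aemeasurable]
      refine (lintegral_congr_ae ?_).trans lintegral_zero
      filter_upwards [ih] with x hx
      have hset : MeasurableSet {v : Fin (n + 1) → ℂ | HasSmallEigenvector (border a v x)} :=
        hSm.preimage ((measurePreserving_border (n := n + 1)).measurable.comp
          ((measurable_const (a := a)).prodMk (measurable_id.prodMk (measurable_const (a := x)))))
      have := volume_border_small_eq_zero hx a
      rw [← lintegral_indicator_one hset] at this
      exact this
    rw [lintegral_congr hz, lintegral_zero]

end NoRealEigenvalue

/-! ### Eigenvalues of J as fibres of the parametrisation. -/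

section EigenvalueCount

open Matrix

variable {n : ℕ} {γ : ℝ}

section Entries

variable (γ : ℝ) (a : ℝ) (v : Fin n → ℂ) (x : Fin n → Fin n → ℝ)

@[simp] lemma deformedGUE_border_zero_zero :
    deformedGUE γ (border a v x) 0 0 = a + Complex.I * γ := by
  simp [deformedGUE]

@[simp] lemma deformedGUE_border_zero_succ (j : Fin n) :
    deformedGUE γ (border a v x) 0 j.succ = star (v j) := by
  simp [deformedGUE, (Fin.succ_ne_zero j).symm]

@[simp] lemma deformedGUE_border_succ_zero (i : Fin n) :
    deformedGUE γ (border a v x) i.succ 0 = v i := by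
  simp [deformedGUE]

@[simp] lemma deformedGUE_border_succ_succ (i j : Fin n) :
    deformedGUE γ (border a v x) i.succ j.succ = hermitianOf x i j := by
  simp [deformedGUE, Matrix.diagonal_apply]

lemma deformedGUE_mulVec (z : ℂ) (w : Fin n → ℂ) :
    deformedGUE γ (border a v x) *ᵥ Fin.cons 1 w = z • (Fin.cons 1 w : Fin (n + 1) → ℂ) ↔
      (a : ℂ) + Complex.I * γ + star v ⬝ᵥ w = z ∧ v = z • w - hermitianOf x *ᵥ w := by
  constructor
  · intro h
    refine ⟨?_, ?_⟩
    · have := congrFun h 0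
      simpa [mulVec, dotProduct, Fin.sum_univ_succ] using this
    · ext i
      have := congrFun h i.succ
      simp only [mulVec, dotProduct, Fin.sum_univ_succ, deformedGUE_border_succ_zero,
        deformedGUE_border_succ_succ, Fin.cons_zero, Fin.cons_succ, mul_one, Pi.smul_apply,
        smul_eq_mul] at this
      simp only [Pi.sub_apply, Pi.smul_apply, smul_eq_mul, mulVec, dotProduct]
      linear_combination this
  · rintro ⟨h1, h2⟩
    ext i
    refine Fin.cases ?_ (fun i => ?_) i
    · simpa [mulVec, dotProduct, Fin.sum_univ_succ] using h1
    · have := congrFun h2 i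
      simp only [Pi.sub_apply, Pi.smul_apply, smul_eq_mul, mulVec, dotProduct] at this
      simp only [mulVec, dotProduct, Fin.sum_univ_succ, deformedGUE_border_succ_zero,
        deformedGUE_border_succ_succ, Fin.cons_zero, Fin.cons_succ, mul_one, Pi.smul_apply,
        smul_eq_mul]
      linear_combination this

end Entries

lemma star_dotProduct_mulVec_self {H : Matrix (Fin n) (Fin n) ℂ} (hH : H.IsHermitian)
    (w : Fin n → ℂ) : star w ⬝ᵥ H *ᵥ w = ((star w ⬝ᵥ H *ᵥ w).re : ℂ) := by
  have h : star (star w ⬝ᵥ H *ᵥ w) = star w ⬝ᵥ H *ᵥ w := by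
    conv_rhs => rw [star_dotProduct, star_mulVec, hH.eq, ← dotProduct_mulVec]
  exact (Complex.conj_eq_iff_re.1 h).symm

lemma star_sub_dotProduct {H : Matrix (Fin n) (Fin n) ℂ} (hH : H.IsHermitian) (z : ℂ)
    (w : Fin n → ℂ) : star (z • w - H *ᵥ w) ⬝ᵥ w =
      star z * sqNorm w - ((star w ⬝ᵥ H *ᵥ w).re : ℂ) := by
  rw [← star_dotProduct_mulVec_self hH, star_sub, star_smul, sub_dotProduct, smul_dotProduct,
    star_dotProduct_self, star_mulVec, hH.eq, ← dotProduct_mulVec, smul_eq_mul]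

/-- The pairs (eigenvalue, eigenvector with first coordinate one) are the preimages under
`eigenMap`. -/
lemma eigenMap_eq_iff (γ a X : ℝ) (v w : Fin n → ℂ) (x : Fin n → Fin n → ℝ) :
    eigenMap γ (x, (X, w)) = (x, (a, v)) ↔
      deformedGUE γ (border a v x) *ᵥ Fin.cons 1 w =
        eigValue γ X w • (Fin.cons 1 w : Fin (n + 1) → ℂ) := by
  have hH := hermitianOf_isHermitian x
  have ht := (one_add_sqNorm_pos w).ne'
  have hY : eigHeight γ w * (1 + sqNorm w) = γ := by rw [eigHeight]; field_simp
  rw [deformedGUE_mulVec]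
  simp only [eigenMap, Prod.mk.injEq, true_and]
  rw [eq_comm (a := v)]
  refine and_congr_left fun hv => ?_
  rw [← hv, star_sub_dotProduct hH, eigValue]
  set q := (star w ⬝ᵥ hermitianOf x *ᵥ w).re
  have key : (a : ℂ) + Complex.I * γ + (star ((X : ℂ) + Complex.I * eigHeight γ w) * sqNorm w - q) -
      (X + Complex.I * eigHeight γ w) = ((a - (X * (1 - sqNorm w) + q) : ℝ) : ℂ) := by
    have hYc : (eigHeight γ w : ℂ) * (1 + sqNorm w) = γ := by exact_mod_cast hY
    rw [← hYc]
    simp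
    ring
  rw [← sub_eq_zero (b := (X : ℂ) + Complex.I * eigHeight γ w), key, Complex.ofReal_eq_zero,
    sub_eq_zero, eq_comm]

/-- An eigenvector of J with first coordinate 0 is not affected by the perturbation, so it would be
an eigenvector of the Hermitian matrix. Otherwise it is scaled to (1, w), and the imaginary part of
the first row gives the height γ/(1 + |w|²). -/
lemma exists_eigenMap_eq (a : ℝ) (v : Fin n → ℂ) (x : Fin n → Fin n → ℝ)
    (hs : ¬ HasSmallEigenvector (border a v x)) {z : ℂ}
    (hz : (deformedGUE γ (border a v x)).charpoly.eval z = 0) :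
    ∃ X w, eigenMap γ (x, (X, w)) = (x, (a, v)) ∧ eigValue γ X w = z := by
  obtain ⟨u, hu, huz⟩ := (eval_charpoly_eq_zero_iff _ _).1 hz
  have hu0 : u 0 ≠ 0 := by
    intro h0
    refine hs ⟨u, hu, h0, z, ?_⟩
    rw [← huz, deformedGUE, add_mulVec, smul_mulVec]
    have : (diagonal fun i : Fin (n + 1) => if (i : ℕ) = 0 then (γ : ℂ) else 0) *ᵥ u = 0 := by
      ext i
      rw [mulVec_diagonal]
      by_cases hi : (i : ℕ) = 0
      · have : i = 0 := Fin.ext hi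
        simp [this, h0]
      · simp [hi]
    rw [this, smul_zero, add_zero]
  set w : Fin n → ℂ := fun i => u i.succ / u 0 with hw
  have hcons : (Fin.cons 1 w : Fin (n + 1) → ℂ) = (u 0)⁻¹ • u := by
    ext i
    refine Fin.cases ?_ (fun i => ?_) i
    · simp [hu0]
    · simp [hw, div_eq_inv_mul]
  have hcw : deformedGUE γ (border a v x) *ᵥ Fin.cons 1 w =
      z • (Fin.cons 1 w : Fin (n + 1) → ℂ) := by
    rw [hcons, mulVec_smul, huz, smul_comm]
  have h2 := (deformedGUE_mulVec γ a v x z w).1 hcw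
  have hH := hermitianOf_isHermitian x
  have ht := (one_add_sqNorm_pos w).ne'
  have hzw : eigValue γ z.re w = z := by
    have h3 := h2.1
    rw [h2.2, star_sub_dotProduct hH] at h3
    have him := congrArg Complex.im h3
    simp at him
    apply Complex.ext
    · simp [eigValue]
    · simp only [eigValue, eigHeight, Complex.add_im, Complex.ofReal_im, Complex.mul_im, Complex.I_re,
        Complex.I_im, Complex.ofReal_re, zero_mul, one_mul, zero_add]
      rw [div_eq_iff ht]
      linarith
  refine ⟨z.re, w, ?_, hzw⟩
  rw [eigenMap_eq_iff, hzw]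
  exact hcw

lemma eigHeight_pos (hγ : 0 < γ) (w : Fin n → ℂ) : 0 < eigHeight γ w :=
  div_pos hγ (one_add_sqNorm_pos w)

lemma eigValue_im (γ X : ℝ) (w : Fin n → ℂ) : (eigValue γ X w).im = eigHeight γ w := by
  simp [eigValue]

/-- Two different vectors w for the same z would differ by an eigenvector of the Hermitian block
with eigenvalue z, which is not real. -/
lemma eigenMap_injOn_fiber (hγ : 0 < γ) {y p q : (Fin n → Fin n → ℝ) × (ℝ × (Fin n → ℂ))}
    (hp : eigenMap γ p = y) (hq : eigenMap γ q = y)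
    (h : eigValue γ p.2.1 p.2.2 = eigValue γ q.2.1 q.2.2) : p = q := by
  obtain ⟨x, X, w⟩ := p
  obtain ⟨x', X', w'⟩ := q
  have hpq : eigenMap γ (x, X, w) = eigenMap γ (x', X', w') := hp.trans hq.symm
  simp only [eigenMap, Prod.mk.injEq] at hpq
  obtain ⟨rfl, -, hv⟩ := hpq
  simp only at h hv
  rw [← h] at hv
  have hX : X = X' := by
    have := congrArg Complex.re h
    simpa [eigValue] using this
  have hw : w = w' := by
    by_contra hne
    have hd : w - w' ≠ 0 := sub_ne_zero.2 hne
    set z := eigValue γ X w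
    have hu : hermitianOf x *ᵥ (w - w') = z • (w - w') := by
      rw [mulVec_sub, smul_sub]
      linear_combination (exp := 1) -hv
    have h1 := star_dotProduct_mulVec_self (hermitianOf_isHermitian x) (w - w')
    rw [hu, dotProduct_smul, star_dotProduct_self, smul_eq_mul] at h1
    have him := congrArg Complex.im h1
    simp only [Complex.mul_im, Complex.ofReal_im, mul_zero, Complex.ofReal_re, zero_add] at him
    rcases mul_eq_zero.1 him with h2 | h2
    · rw [eigValue_im] at h2
      exact (eigHeight_pos hγ w).ne' h2
    · refine hd (eq_zero_of_star_dotProduct_self ?_)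
      rw [star_dotProduct_self, h2, Complex.ofReal_zero]
  rw [hX, hw]

/-- The matrix with first column `(1, w)` that agrees with the identity in the other columns. -/
def columnShear (w : Fin n → ℂ) : Matrix (Fin (n + 1)) (Fin (n + 1)) ℂ :=
  Matrix.of (Fin.cons (Fin.cons 1 0) fun i => Fin.cons (w i) ((1 : Matrix (Fin n) (Fin n) ℂ) i))

@[simp] lemma columnShear_zero_zero (w : Fin n → ℂ) : columnShear w 0 0 = 1 := rfl
@[simp] lemma columnShear_zero_succ (w : Fin n → ℂ) (j : Fin n) : columnShear w 0 j.succ = 0 := rfl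
@[simp] lemma columnShear_succ_zero (w : Fin n → ℂ) (i : Fin n) : columnShear w i.succ 0 = w i := rfl
@[simp] lemma columnShear_succ_succ (w : Fin n → ℂ) (i j : Fin n) :
    columnShear w i.succ j.succ = (1 : Matrix (Fin n) (Fin n) ℂ) i j := rfl

lemma columnShear_mul_neg (w : Fin n → ℂ) : columnShear w * columnShear (-w) = 1 := by
  ext i j
  refine Fin.cases ?_ (fun i => ?_) i <;> refine Fin.cases ?_ (fun j => ?_) j
  · simp [Matrix.mul_apply, Fin.sum_univ_succ]
  · simp [Matrix.mul_apply, Fin.sum_univ_succ, (Fin.succ_ne_zero j).symm]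
  · simp [Matrix.mul_apply, Fin.sum_univ_succ, Matrix.one_apply]
  · simp [Matrix.mul_apply, Fin.sum_univ_succ, Matrix.one_apply]

lemma charpoly_of_column_zero (K : Matrix (Fin (n + 1)) (Fin (n + 1)) ℂ)
    (hK : ∀ i : Fin n, K i.succ 0 = 0) :
    K.charpoly = (Polynomial.X - Polynomial.C (K 0 0)) * (K.submatrix Fin.succ Fin.succ).charpoly := by
  rw [charpoly, det_succ_column_zero, Fin.sum_univ_succ]
  have h0 : ∀ i : Fin n, charmatrix K i.succ 0 = 0 := fun i => by
    rw [charmatrix_apply_ne _ _ _ (Fin.succ_ne_zero i), hK]; simp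
  have h1 : (charmatrix K).submatrix (Fin.succAbove 0) Fin.succ =
      charmatrix (K.submatrix Fin.succ Fin.succ) := by
    ext i j
    simp [charmatrix_apply, Matrix.diagonal_apply]
  simp only [h0, mul_zero, zero_mul, Finset.sum_const_zero, add_zero, h1, charmatrix_apply_eq]
  simp [charpoly]

/-- Conjugation by `columnShear w` makes (1, w) the first basis vector, after which the matrix is
block triangular. -/
lemma charpoly_of_mulVec_cons (J : Matrix (Fin (n + 1)) (Fin (n + 1)) ℂ) (w : Fin n → ℂ) (z : ℂ)
    (h : J *ᵥ Fin.cons 1 w = z • (Fin.cons 1 w : Fin (n + 1) → ℂ)) :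
    J.charpoly = (Polynomial.X - Polynomial.C z) *
      (J.submatrix Fin.succ Fin.succ - vecMulVec w fun j : Fin n => J 0 j.succ).charpoly := by
  have hcol : ∀ i, (J * columnShear w) i 0 = z * (Fin.cons 1 w : Fin (n + 1) → ℂ) i := by
    intro i
    have := congrFun h i
    have hc : ∀ k, columnShear w k 0 = (Fin.cons 1 w : Fin (n + 1) → ℂ) k := fun k => by
      refine Fin.cases ?_ (fun k => ?_) k <;> simp
    simpa [Matrix.mul_apply, mulVec, dotProduct, hc] using this
  have hcol' : ∀ i (j : Fin n), (J * columnShear w) i j.succ = J i j.succ := by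
    intro i j
    simp [Matrix.mul_apply, Fin.sum_univ_succ, Matrix.one_apply]
  have hrow0 : ∀ (M : Matrix (Fin (n + 1)) (Fin (n + 1)) ℂ) j,
      (columnShear (-w) * M) 0 j = M 0 j := by
    intro M j
    simp [Matrix.mul_apply, Fin.sum_univ_succ]
  have hrow : ∀ (M : Matrix (Fin (n + 1)) (Fin (n + 1)) ℂ) (i : Fin n) j,
      (columnShear (-w) * M) i.succ j = M i.succ j - w i * M 0 j := by
    intro M i j
    simp [Matrix.mul_apply, Fin.sum_univ_succ, Matrix.one_apply]
    ring
  have e : (columnShear (-w) * (J * columnShear w)).charpoly = J.charpoly := by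
    rw [charpoly_mul_comm, Matrix.mul_assoc, columnShear_mul_neg, Matrix.mul_one]
  have h00 : (columnShear (-w) * (J * columnShear w)) 0 0 = z := by
    rw [hrow0, hcol, Fin.cons_zero, mul_one]
  have hsub : (columnShear (-w) * (J * columnShear w)).submatrix Fin.succ Fin.succ =
      J.submatrix Fin.succ Fin.succ - vecMulVec w fun j : Fin n => J 0 j.succ := by
    ext i j
    rw [submatrix_apply, hrow, hcol', hcol', Matrix.sub_apply, submatrix_apply, vecMulVec_apply]
  have h0 : ∀ i : Fin n, (columnShear (-w) * (J * columnShear w)) i.succ 0 = 0 := by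
    intro i
    rw [hrow, hcol, hcol, Fin.cons_succ, Fin.cons_zero]
    ring
  rw [← e, charpoly_of_column_zero _ h0, h00, hsub]

lemma charpoly_deformedGUE_border (a : ℝ) (v w : Fin n → ℂ) (x : Fin n → Fin n → ℝ) (z : ℂ)
    (h : deformedGUE γ (border a v x) *ᵥ Fin.cons 1 w = z • (Fin.cons 1 w : Fin (n + 1) → ℂ)) :
    (deformedGUE γ (border a v x)).charpoly = (Polynomial.X - Polynomial.C z) *
      (hermitianOf x - vecMulVec w (star v)).charpoly := by
  rw [charpoly_of_mulVec_cons _ w z h]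
  congr 2
  ext i j
  simp [vecMulVec_apply]

/-- After removal of the factor X − z, the remaining characteristic polynomial takes the value det
`eigMatrix` at z, so a regular point of the map is a simple eigenvalue. -/
lemma rootMultiplicity_eigValue {a X : ℝ} {v w : Fin n → ℂ} {x : Fin n → Fin n → ℝ}
    (h : eigenMap γ (x, (X, w)) = (x, (a, v)))
    (hdet : (eigMatrix (hermitianOf x) (eigValue γ X w) w).det ≠ 0) :
    (deformedGUE γ (border a v x)).charpoly.rootMultiplicity (eigValue γ X w) = 1 := by
  have hv : v = eigValue γ X w • w - hermitianOf x *ᵥ w := by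
    simp only [eigenMap, Prod.mk.injEq, true_and] at h
    exact h.2.symm
  have hc := charpoly_deformedGUE_border a v w x _ ((eigenMap_eq_iff γ a X v w x).1 h)
  set z := eigValue γ X w
  have hev : (hermitianOf x - vecMulVec w (star v)).charpoly.eval z ≠ 0 := by
    rw [Matrix.eval_charpoly, scalar_apply, ← smul_one_eq_diagonal]
    convert hdet using 2
    rw [eigMatrix, ← hv]
    abel
  have hne := (Matrix.charpoly_monic (deformedGUE γ (border a v x))).ne_zero
  rw [hc] at hne ⊢
  rw [Polynomial.rootMultiplicity_mul hne,
    Polynomial.rootMultiplicity_X_sub_C_self, Polynomial.rootMultiplicity_eq_zero hev]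

/-- For generic y the roots are simple and `eigValue` maps the fibre bijectively onto them, so
multiplicity and cardinality agree. -/
lemma countIm_eq_count (hγ : 0 < γ) {y : (Fin n → Fin n → ℝ) × (ℝ × (Fin n → ℂ))}
    (hdet : ∀ p, eigenMap γ p = y →
      (eigMatrix (hermitianOf p.1) (eigValue γ p.2.1 p.2.2) p.2.2).det ≠ 0)
    (hs : ¬ HasSmallEigenvector (border y.2.1 y.2.2 y.1)) (B : Set ℝ) :
    (countIm (deformedGUE γ (border y.2.1 y.2.2 y.1)) B : ℝ≥0∞) =
      Measure.count (eigenMap γ ⁻¹' {y} ∩ {p | eigHeight γ p.2.2 ∈ B}) := by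
  classical
  obtain ⟨x, a, v⟩ := y
  set J := deformedGUE γ (border a v x) with hJ
  set R := J.charpoly.roots with hR
  have hne := (Matrix.charpoly_monic J).ne_zero
  have hfib : ∀ p, eigenMap γ p = (x, (a, v)) → p.1 = x := fun p hp => congrArg Prod.fst hp
  have hmem : ∀ z, z ∈ R ↔ ∃ X w, eigenMap γ (x, (X, w)) = (x, (a, v)) ∧ eigValue γ X w = z := by
    intro z
    rw [hR, Polynomial.mem_roots hne, Polynomial.IsRoot.def]
    refine ⟨fun h => exists_eigenMap_eq a v x hs h, ?_⟩
    rintro ⟨X, w, h1, rfl⟩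
    refine (eval_charpoly_eq_zero_iff _ _).2 ⟨_, ?_, (eigenMap_eq_iff γ a X v w x).1 h1⟩
    intro h
    have := congrFun h 0
    simp at this
  have hnodup : R.Nodup := by
    rw [Multiset.nodup_iff_count_le_one]
    intro z
    by_cases hz : z ∈ R
    · obtain ⟨X, w, h1, rfl⟩ := (hmem z).1 hz
      rw [hR, Polynomial.count_roots]
      exact (rootMultiplicity_eigValue h1 (hdet (x, (X, w)) h1)).le
    · rw [Multiset.count_eq_zero_of_notMem hz]; exact zero_le_one
  set P := eigenMap γ ⁻¹' {(x, (a, v))} ∩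
    {p : (Fin n → Fin n → ℝ) × (ℝ × (Fin n → ℂ)) | eigHeight γ p.2.2 ∈ B} with hP
  have hinj : InjOn (fun p : (Fin n → Fin n → ℝ) × (ℝ × (Fin n → ℂ)) => eigValue γ p.2.1 p.2.2) P :=
    fun p hp q hq h => eigenMap_injOn_fiber hγ hp.1 hq.1 h
  have himg : (fun p : (Fin n → Fin n → ℝ) × (ℝ × (Fin n → ℂ)) => eigValue γ p.2.1 p.2.2) '' P =
      ((R.toFinset.filter fun z => z.im ∈ B : Finset ℂ) : Set ℂ) := by
    ext z
    simp only [mem_image, Finset.coe_filter, Multiset.mem_toFinset]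
    constructor
    · rintro ⟨⟨x', X, w⟩, ⟨h1, h2⟩, rfl⟩
      have hx : x' = x := hfib _ h1
      subst hx
      refine ⟨(hmem _).2 ⟨X, w, h1, rfl⟩, ?_⟩
      simp only [eigValue_im]
      exact h2
    · rintro ⟨h1, h2⟩
      obtain ⟨X, w, h3, rfl⟩ := (hmem z).1 h1
      refine ⟨(x, (X, w)), ⟨h3, ?_⟩, rfl⟩
      rw [eigValue_im] at h2
      exact h2
  have hfin : P.Finite := Finite.of_finite_image (himg ▸ Finset.finite_toSet _) hinj
  have hcard : countIm J B = (R.toFinset.filter fun z => z.im ∈ B).card := by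
    rw [countIm, Multiset.countP_eq_card_filter, Finset.card, Finset.filter_val,
      Multiset.toFinset_val, Multiset.dedup_eq_self.2 hnodup]
  have henc : P.encard = ((R.toFinset.filter fun z => z.im ∈ B).card : ℕ∞) := by
    rw [← hinj.encard_image, himg, Set.encard_coe_eq_coe_finsetCard]
  change (countIm J B : ℝ≥0∞) = Measure.count P
  rw [Measure.count_apply hfin.measurableSet, henc, hcard]
  simp

end EigenvalueCount

/-! ### Reduction of the Jacobian weight to one direction. -/

section JacobianWeight

open Matrix

variable {n : ℕ}

/-- The squared Jacobian factor times the Gaussian weight of the full matrix, for the eigenvalue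
`X + iY` with eigenvector `(1, w)`. -/
def jacWeight (c X Y : ℝ) (w : Fin n → ℂ) (x : Fin n → Fin n → ℝ) : ℝ≥0∞ :=
  ENNReal.ofReal (‖(eigMatrix (hermitianOf x) (X + Complex.I * Y) w).det‖ ^ 2) *
    (gaussA c (X * (1 - sqNorm w) + (star w ⬝ᵥ hermitianOf x *ᵥ w).re) *
      gaussV c (sqNorm (((X : ℂ) + Complex.I * Y) • w - hermitianOf x *ᵥ w)) * gaussW c x)

lemma star_mulVec_dotProduct_mulVec {U : Matrix (Fin n) (Fin n) ℂ} (hU : Uᴴ * U = 1)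
    (u v : Fin n → ℂ) : star (U *ᵥ u) ⬝ᵥ (U *ᵥ v) = star u ⬝ᵥ v := by
  rw [star_mulVec, ← dotProduct_mulVec, mulVec_mulVec, hU, one_mulVec]

lemma sqNorm_mulVec {U : Matrix (Fin n) (Fin n) ℂ} (hU : Uᴴ * U = 1) (u : Fin n → ℂ) :
    sqNorm (U *ᵥ u) = sqNorm u := by
  have := star_mulVec_dotProduct_mulVec hU u u
  rw [star_dotProduct_self, star_dotProduct_self] at this
  exact_mod_cast this

lemma jacWeight_conj {U : Matrix (Fin n) (Fin n) ℂ} (hU : Uᴴ * U = 1) (c X Y : ℝ)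
    (w : Fin n → ℂ) (x : Fin n → Fin n → ℝ) :
    jacWeight c X Y (U *ᵥ w) (conjCoord U x) = jacWeight c X Y w x := by
  have hU' : U * Uᴴ = 1 := mul_eq_one_comm.1 hU
  set z : ℂ := X + Complex.I * Y
  set H := hermitianOf x
  have hHw : hermitianOf (conjCoord U x) *ᵥ (U *ᵥ w) = U *ᵥ (H *ᵥ w) := by
    rw [hermitianOf_conjCoord, mulVec_mulVec, Matrix.mul_assoc, hU, Matrix.mul_one, ← mulVec_mulVec]
  have hv : z • (U *ᵥ w) - U *ᵥ (H *ᵥ w) = U *ᵥ (z • w - H *ᵥ w) := by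
    rw [mulVec_sub, mulVec_smul]
  have hM : eigMatrix (hermitianOf (conjCoord U x)) z (U *ᵥ w) = U * eigMatrix H z w * Uᴴ := by
    rw [eigMatrix, hHw, hv, hermitianOf_conjCoord, eigMatrix, Matrix.mul_add, Matrix.add_mul,
      Matrix.mul_sub, Matrix.sub_mul, Matrix.mul_smul, Matrix.smul_mul, Matrix.mul_one, hU',
      mul_vecMulVec, vecMulVec_mul, star_mulVec]
  have hdet : (U * eigMatrix H z w * Uᴴ).det = (eigMatrix H z w).det := by
    rw [det_mul, det_mul, mul_right_comm, ← det_mul, hU', det_one, one_mul]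
  unfold jacWeight gaussW
  rw [hM, hdet, hHw, hv, sqNorm_mulVec hU, sqNorm_mulVec hU, star_mulVec_dotProduct_mulVec hU,
    trSq_conjCoord hU]

lemma det_sub_zero_zero {m : ℕ} (M N : Matrix (Fin (m + 1)) (Fin (m + 1)) ℂ) (δ : ℂ)
    (h00 : M 0 0 = N 0 0 - δ) (h0 : ∀ j : Fin m, M 0 j.succ = N 0 j.succ)
    (h1 : ∀ (i : Fin m) j, M i.succ j = N i.succ j) :
    M.det = N.det - δ * (N.submatrix Fin.succ Fin.succ).det := by
  have hs : ∀ f : Fin m → Fin (m + 1), M.submatrix Fin.succ f = N.submatrix Fin.succ f := fun f => by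
    ext i j; simp [h1]
  rw [det_succ_row_zero M, det_succ_row_zero N, Fin.sum_univ_succ, Fin.sum_univ_succ]
  simp only [h0, h00, hs]
  simp
  ring

/-- For w = s e₀ only the first row of `eigMatrix` differs from z − H, its off-diagonal entries
carrying a factor 1 + s². Conjugation by diag(1/√(1 + s²), 1, …, 1) shares that factor between row
and column, and the matrix is again z minus a Hermitian matrix, up to iYs² in the corner. -/
lemma det_eigMatrix_single {m : ℕ} (X Y h s : ℝ) (g : Fin m → ℂ) (x : Fin m → Fin m → ℝ) :
    (eigMatrix (hermitianOf (border h g x)) (X + Complex.I * Y) (Pi.single 0 (s : ℂ))).det =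
      charDet (X + Complex.I * Y)
        (border (X + (1 + s ^ 2) * (h - X)) (((√(1 + s ^ 2) : ℝ) : ℂ) • g) x) -
      Complex.I * (Y * s ^ 2 : ℝ) * charDet (X + Complex.I * Y) x := by
  set z : ℂ := X + Complex.I * Y with hz
  set r : ℝ := √(1 + s ^ 2) with hr
  have hr0 : (r : ℂ) ≠ 0 := Complex.ofReal_ne_zero.2 (by positivity)
  have hr2 : (r : ℂ) ^ 2 = 1 + s ^ 2 := by
    have : r ^ 2 = 1 + s ^ 2 := Real.sq_sqrt (by positivity)
    exact_mod_cast this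
  set M := eigMatrix (hermitianOf (border h g x)) z (Pi.single 0 (s : ℂ)) with hM
  set N := z • (1 : Matrix (Fin (m + 1)) (Fin (m + 1)) ℂ) -
    hermitianOf (border (X + (1 + s ^ 2) * (h - X)) ((r : ℂ) • g) x) with hN
  have hv : ∀ j, (hermitianOf (border h g x) *ᵥ Pi.single 0 (s : ℂ)) j =
      hermitianOf (border h g x) j 0 * s := fun j => by
    rw [mulVec_single]; simp [mul_comm]
  have hM00 : M 0 0 = N 0 0 - Complex.I * (Y * s ^ 2 : ℝ) := by
    rw [hM, hN, eigMatrix]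
    simp only [Matrix.add_apply, Matrix.sub_apply, Matrix.smul_apply, Matrix.one_apply_eq,
      vecMulVec_apply, Pi.star_apply, Pi.sub_apply, Pi.smul_apply, hv, hermitianOf_border_zero_zero,
      Pi.single_eq_same, smul_eq_mul, hz]
    simp
    ring
  have hM0 : ∀ j : Fin m, M 0 j.succ = r * N 0 j.succ := fun j => by
    rw [hM, hN, eigMatrix]
    simp only [Matrix.add_apply, Matrix.sub_apply, Matrix.smul_apply,
      Matrix.one_apply_ne (Fin.succ_ne_zero j).symm,
      vecMulVec_apply, Pi.star_apply, Pi.sub_apply, Pi.smul_apply, hv, hermitianOf_border_zero_succ,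
      hermitianOf_border_succ_zero, Pi.single_eq_same, smul_eq_mul,
      Pi.single_eq_of_ne (Fin.succ_ne_zero j)]
    simp
    linear_combination (starRingEnd ℂ) (g j) * hr2
  have hM1 : ∀ i : Fin m, r * M i.succ 0 = N i.succ 0 := fun i => by
    rw [hM, hN, eigMatrix]
    simp [vecMulVec_apply, Matrix.one_apply_ne (Fin.succ_ne_zero i)]
  have hM2 : ∀ i j : Fin m, M i.succ j.succ = N i.succ j.succ := fun i j => by
    rw [hM, hN, eigMatrix]
    simp [vecMulVec_apply, Matrix.one_apply]
  have hsub : N.submatrix Fin.succ Fin.succ = z • 1 - hermitianOf x := by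
    ext i j
    simp [hN, Matrix.one_apply]
  let D₁ : Matrix (Fin (m + 1)) (Fin (m + 1)) ℂ := diagonal (Fin.cons (r : ℂ)⁻¹ fun _ => 1)
  let D₂ : Matrix (Fin (m + 1)) (Fin (m + 1)) ℂ := diagonal (Fin.cons (r : ℂ) fun _ => 1)
  have hdet : (D₁ * M * D₂).det = M.det := by
    rw [det_mul, det_mul, det_diagonal, det_diagonal]
    simp [Fin.prod_univ_succ]
    field_simp
  have hent : ∀ i j, (D₁ * M * D₂) i j = (Fin.cons (r : ℂ)⁻¹ fun _ => 1 : Fin (m + 1) → ℂ) i * M i j *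
      (Fin.cons (r : ℂ) fun _ => 1 : Fin (m + 1) → ℂ) j := fun i j => by
    rw [mul_diagonal, diagonal_mul]
  rw [← hdet, charDet, ← hN, charDet, ← hsub]
  refine det_sub_zero_zero _ _ _ ?_ ?_ ?_
  · rw [hent, ← hM00]; simp; field_simp
  · intro j
    rw [hent, hM0]; simp; field_simp
  · intro i j
    rw [hent]
    refine Fin.cases ?_ (fun j => ?_) j
    · rw [← hM1]; simp [mul_comm]
    · rw [← hM2]; simp

/-- The same rescaled border completes the squares in the Gaussian exponent, so the real part X
splits off with its own Gaussian weight. -/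
lemma jacWeight_single {m : ℕ} (c X Y h s : ℝ) (g : Fin m → ℂ) (x : Fin m → Fin m → ℝ) :
    jacWeight c X Y (Pi.single 0 (s : ℂ)) (border h g x) =
      gaussA c X * gaussV c (s ^ 2 * Y ^ 2) *
      (fun x' : Fin (m + 1) → Fin (m + 1) → ℝ =>
        ENNReal.ofReal (‖charDet (X + Complex.I * Y) x' - Complex.I * (Y * s ^ 2 : ℝ) *
          charDet (X + Complex.I * Y) (minorCoord x')‖ ^ 2) * gaussW c x')
        (border (X + (1 + s ^ 2) * (h - X)) (((√(1 + s ^ 2) : ℝ) : ℂ) • g) x) := by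
  have hv : ∀ j, (hermitianOf (border h g x) *ᵥ Pi.single 0 (s : ℂ)) j =
      hermitianOf (border h g x) j 0 * s := fun j => by
    rw [mulVec_single]; simp [mul_comm]
  have hsq : sqNorm (Pi.single 0 (s : ℂ) : Fin (m + 1) → ℂ) = s ^ 2 := by
    simp [sqNorm, Fin.sum_univ_succ]
  have hq : (star (Pi.single 0 (s : ℂ) : Fin (m + 1) → ℂ) ⬝ᵥ
      hermitianOf (border h g x) *ᵥ Pi.single 0 (s : ℂ)).re = s ^ 2 * h := by
    rw [dotProduct, Fin.sum_univ_succ]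
    simp only [hv]
    simp
    ring
  have hs2 : sqNorm (((X : ℂ) + Complex.I * Y) • (Pi.single 0 (s : ℂ) : Fin (m + 1) → ℂ) -
      hermitianOf (border h g x) *ᵥ Pi.single 0 (s : ℂ)) =
      s ^ 2 * ((X - h) ^ 2 + Y ^ 2 + ∑ i, ‖g i‖ ^ 2) := by
    rw [sqNorm, Fin.sum_univ_succ]
    simp only [Pi.sub_apply, Pi.smul_apply, hv, hermitianOf_border_zero_zero,
      hermitianOf_border_succ_zero, Pi.single_eq_same, smul_eq_mul,
      Pi.single_eq_of_ne (Fin.succ_ne_zero _), mul_zero, zero_sub, norm_neg, norm_mul]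
    have e0 : ‖((X : ℂ) + Complex.I * Y) * s - h * s‖ ^ 2 = s ^ 2 * ((X - h) ^ 2 + Y ^ 2) := by
      rw [← Complex.normSq_eq_norm_sq, Complex.normSq_apply]
      simp
      ring
    have e1 : ∀ i, (‖g i‖ * ‖(s : ℂ)‖) ^ 2 = s ^ 2 * ‖g i‖ ^ 2 := fun i => by
      rw [Complex.norm_real, mul_pow, Real.norm_eq_abs, sq_abs]; ring
    rw [e0, Finset.sum_congr rfl fun i _ => e1 i, ← Finset.mul_sum]
    ring
  have hg : ∑ i, ‖((((√(1 + s ^ 2) : ℝ) : ℂ) • g) i)‖ ^ 2 = (1 + s ^ 2) * ∑ i, ‖g i‖ ^ 2 := by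
    rw [Finset.mul_sum]
    refine Finset.sum_congr rfl fun i _ => ?_
    rw [Pi.smul_apply, norm_smul, mul_pow, Complex.norm_real, Real.norm_eq_abs, sq_abs,
      Real.sq_sqrt (by positivity)]
  dsimp only
  rw [jacWeight, det_eigMatrix_single, hsq, hq, hs2, gaussW_border, gaussW_border, hg, minorCoord_border]
  have hexp : gaussA c (X * (1 - s ^ 2) + s ^ 2 * h) *
        gaussV c (s ^ 2 * ((X - h) ^ 2 + Y ^ 2 + ∑ i, ‖g i‖ ^ 2)) *
        (gaussA c h * gaussV c (∑ i, ‖g i‖ ^ 2)) =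
      gaussA c X * gaussV c (s ^ 2 * Y ^ 2) * (gaussA c (X + (1 + s ^ 2) * (h - X)) *
        gaussV c ((1 + s ^ 2) * ∑ i, ‖g i‖ ^ 2)) := by
    unfold gaussA gaussV
    simp only [← ENNReal.ofReal_mul (Real.exp_nonneg _), ← Real.exp_add]
    congr 2
    ring
  generalize ENNReal.ofReal (‖charDet (X + Complex.I * Y)
        (border (X + (1 + s ^ 2) * (h - X)) (((√(1 + s ^ 2) : ℝ) : ℂ) • g) x) -
      Complex.I * (Y * s ^ 2 : ℝ) * charDet (X + Complex.I * Y) x‖ ^ 2) = d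
  calc _ = d * gaussW c x * (gaussA c (X * (1 - s ^ 2) + s ^ 2 * h) *
        gaussV c (s ^ 2 * ((X - h) ^ 2 + Y ^ 2 + ∑ i, ‖g i‖ ^ 2)) *
        (gaussA c h * gaussV c (∑ i, ‖g i‖ ^ 2))) := by ring
    _ = _ := by rw [hexp]; ring

end JacobianWeight

/-! ### Integration of the Jacobian weight over the block. -/

section JacobianIntegral

open Matrix

variable {n : ℕ}

lemma continuous_sqNorm : Continuous (sqNorm (n := n)) := differentiable_sqNorm.continuous

lemma continuous_gaussW (c : ℝ) : Continuous (gaussW (n := n) c) := by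
  have := continuous_trSq (n := n)
  unfold gaussW
  exact ENNReal.continuous_ofReal.comp (by fun_prop)

lemma continuous_gaussA (c : ℝ) : Continuous (gaussA c) := by
  unfold gaussA
  exact ENNReal.continuous_ofReal.comp (by fun_prop)

lemma continuous_gaussV (c : ℝ) : Continuous (gaussV c) := by
  unfold gaussV
  exact ENNReal.continuous_ofReal.comp (by fun_prop)

lemma measurable_jacWeight {α : Type*} [TopologicalSpace α] [MeasurableSpace α] [BorelSpace α]
    (c : ℝ) {X Y : α → ℝ} {w : α → Fin n → ℂ} {x : α → Fin n → Fin n → ℝ} (hX : Continuous X)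
    (hY : Continuous Y) (hw : Continuous w) (hx : Continuous x) :
    Measurable fun a => jacWeight c (X a) (Y a) (w a) (x a) := by
  have hH : Continuous fun a => hermitianOf (x a) := continuous_hermitianOf.comp hx
  have hz : Continuous fun a => ((X a : ℂ) + Complex.I * Y a) := by fun_prop
  have hHw : Continuous fun a => hermitianOf (x a) *ᵥ w a := hH.matrix_mulVec hw
  have hv : Continuous fun a => ((X a : ℂ) + Complex.I * Y a) • w a - hermitianOf (x a) *ᵥ w a :=
    (hz.smul hw).sub hHw
  have hM : Continuous fun a => eigMatrix (hermitianOf (x a)) (X a + Complex.I * Y a) (w a) := by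
    unfold eigMatrix
    exact ((hz.smul continuous_const).sub hH).add (hw.matrix_vecMulVec hv.star)
  have hs : Continuous fun a => sqNorm (w a) := continuous_sqNorm.comp hw
  have hq : Continuous fun a => (star (w a) ⬝ᵥ hermitianOf (x a) *ᵥ w a).re :=
    Complex.continuous_re.comp (hw.star.dotProduct hHw)
  unfold jacWeight
  have m1 := (ENNReal.continuous_ofReal.comp (hM.matrix_det.norm.pow 2)).measurable
  have m2 := ((continuous_gaussA c).comp ((hX.mul ((continuous_const (y := (1 : ℝ))).sub hs)).add hq)).measurable
  have m3 := ((continuous_gaussV c).comp (continuous_sqNorm.comp hv)).measurable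
  have m4 := ((continuous_gaussW c).comp hx).measurable
  exact m1.mul ((m2.mul m3).mul m4)

lemma lintegral_comp_smul {E : Type*} [NormedAddCommGroup E] [NormedSpace ℝ E]
    [FiniteDimensional ℝ E] [MeasurableSpace E] [BorelSpace E] (μ : Measure E) [μ.IsAddHaarMeasure]
    {f : E → ℝ≥0∞} (hf : Measurable f) {r : ℝ} (hr : 0 < r) :
    ∫⁻ x, f (r • x) ∂μ = ENNReal.ofReal ((r ^ Module.finrank ℝ E)⁻¹) * ∫⁻ x, f x ∂μ := by
  have h := Measure.map_addHaar_smul μ hr.ne'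
  rw [abs_of_pos (by positivity)] at h
  rw [← lintegral_map (f := f) (g := fun x => r • x) hf (measurable_const_smul r), h,
    lintegral_smul_measure, smul_eq_mul]

lemma measurable_border {m : ℕ} : Measurable fun p : ℝ × ((Fin m → ℂ) × (Fin m → Fin m → ℝ)) =>
    border p.1 p.2.1 p.2.2 := measurePreserving_border.measurable

/-- The Gaussian weight of `x'` times `|det (z - H) - iδ det (z - H')|²`. -/
def charWeight {m : ℕ} (c : ℝ) (z : ℂ) (δ : ℝ) (x : Fin (m + 1) → Fin (m + 1) → ℝ) : ℝ≥0∞ :=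
  ENNReal.ofReal (‖charDet z x - Complex.I * δ * charDet z (minorCoord x)‖ ^ 2) * gaussW c x

lemma measurable_charWeight {m : ℕ} (c : ℝ) (z : ℂ) (δ : ℝ) :
    Measurable (charWeight (m := m) c z δ) := by
  unfold charWeight
  have h1 := continuous_charDet (n := m + 1) z
  have h2 := (continuous_charDet (n := m) z).comp continuous_minorCoord
  refine Measurable.mul (ENNReal.continuous_ofReal.comp ?_).measurable (measurable_gaussW c)
  exact (h1.sub (continuous_const.mul h2)).norm.pow 2

/-- The corner scales by r² and each of the m complex border entries by r, so the volume factor is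
r² · r^(2m). -/
lemma lintegral_border_scale {m : ℕ} {F : (Fin (m + 1) → Fin (m + 1) → ℝ) → ℝ≥0∞}
    (hF : Measurable F) (X : ℝ) {r : ℝ} (hr : 0 < r) :
    ∫⁻ h : ℝ, ∫⁻ g : Fin m → ℂ, ∫⁻ x : Fin m → Fin m → ℝ,
      F (border (X + r ^ 2 * (h - X)) (r • g) x) =
      ENNReal.ofReal (((r ^ 2) ^ (m + 1))⁻¹) * ∫⁻ x, F x := by
  have hFb : Measurable fun p : (ℝ × (Fin m → ℂ)) × (Fin m → Fin m → ℝ) =>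
      F (border p.1.1 p.1.2 p.2) := by
    have : Measurable fun p : (ℝ × (Fin m → ℂ)) × (Fin m → Fin m → ℝ) =>
      (p.1.1, (p.1.2, p.2)) := by fun_prop
    exact hF.comp (measurable_border.comp this)
  have hG : Measurable fun p : ℝ × (Fin m → ℂ) =>
      ∫⁻ x : Fin m → Fin m → ℝ, F (border p.1 p.2 x) := hFb.lintegral_prod_right'
  rw [lintegral_border hF]
  generalize hG' : (fun p : ℝ × (Fin m → ℂ) => ∫⁻ x : Fin m → Fin m → ℝ, F (border p.1 p.2 x)) = G
    at hG
  have hGp : ∀ (a : ℝ) (v : Fin m → ℂ), ∫⁻ x : Fin m → Fin m → ℝ, F (border a v x) = G (a, v) :=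
    fun a v => congrFun hG' (a, v)
  simp only [hGp]
  have hK : Measurable fun a : ℝ => ∫⁻ v : Fin m → ℂ, G (a, v) := hG.lintegral_prod_right'
  have hg : ∀ a : ℝ, ∫⁻ g : Fin m → ℂ, G (a, r • g) =
      ENNReal.ofReal (((r ^ 2) ^ m)⁻¹) * ∫⁻ g : Fin m → ℂ, G (a, g) := by
    intro a
    have hm : Measurable fun g : Fin m → ℂ => G (a, g) := hG.comp measurable_prodMk_left
    rw [lintegral_comp_smul volume hm hr, Module.finrank_pi_fintype, Finset.sum_const,
      Complex.finrank_real_complex, Finset.card_univ, Fintype.card_fin, smul_eq_mul, mul_comm m,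
      pow_mul]
  simp only [hg]
  have hK' : Measurable fun h : ℝ => ∫⁻ g : Fin m → ℂ, G (X + r ^ 2 * (h - X), g) :=
    hK.comp (by fun_prop : Measurable fun h : ℝ => X + r ^ 2 * (h - X))
  have hK2 : Measurable fun h : ℝ => ∫⁻ g : Fin m → ℂ, G (h + (X - r ^ 2 * X), g) :=
    hK.comp (by fun_prop : Measurable fun h : ℝ => h + (X - r ^ 2 * X))
  have e1 := lintegral_comp_smul volume hK2 (r := r ^ 2) (by positivity)
  have e2 := lintegral_add_right_eq_self (μ := (volume : Measure ℝ)) (fun a : ℝ =>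
    ∫⁻ v : Fin m → ℂ, G (a, v)) (X - r ^ 2 * X)
  rw [e2, Module.finrank_self, pow_one] at e1
  have e3 : ∀ h : ℝ, r ^ 2 • h + (X - r ^ 2 * X) = X + r ^ 2 * (h - X) := fun h => by
    rw [smul_eq_mul]; ring
  simp only [e3] at e1
  rw [lintegral_const_mul _ hK', e1, ← mul_assoc, ← ENNReal.ofReal_mul (by positivity), ← mul_inv,
    ← pow_succ]

lemma lintegral_jacWeight_single {m : ℕ} (c X Y s : ℝ) :
    ∫⁻ x : Fin (m + 1) → Fin (m + 1) → ℝ, jacWeight c X Y (Pi.single 0 (s : ℂ)) x =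
      gaussA c X * gaussV c (s ^ 2 * Y ^ 2) * (ENNReal.ofReal (((1 + s ^ 2) ^ (m + 1))⁻¹) *
        ∫⁻ x : Fin (m + 1) → Fin (m + 1) → ℝ, charWeight c (X + Complex.I * Y) (Y * s ^ 2) x) := by
  have hF := measurable_charWeight (m := m) c (X + Complex.I * Y) (Y * s ^ 2)
  have hjm : Measurable fun x : Fin (m + 1) → Fin (m + 1) → ℝ =>
      jacWeight c X Y (Pi.single 0 (s : ℂ)) x :=
    measurable_jacWeight c continuous_const continuous_const continuous_const continuous_id
  have hr2 : √(1 + s ^ 2) ^ 2 = 1 + s ^ 2 := Real.sq_sqrt (by positivity)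
  have hst : ∀ (h : ℝ) (g : Fin m → ℂ) (x : Fin m → Fin m → ℝ),
      jacWeight c X Y (Pi.single 0 (s : ℂ)) (border h g x) =
      gaussA c X * gaussV c (s ^ 2 * Y ^ 2) * charWeight c (X + Complex.I * Y) (Y * s ^ 2)
        (border (X + √(1 + s ^ 2) ^ 2 * (h - X)) (√(1 + s ^ 2) • g) x) := by
    intro h g x
    have hcoe : ((√(1 + s ^ 2) : ℝ) : ℂ) • g = √(1 + s ^ 2) • g := by ext i; simp
    rw [jacWeight_single, hr2, ← hcoe, charWeight]
  rw [lintegral_border hjm, ← hr2, ← lintegral_border_scale hF X (Real.sqrt_pos.2 (by positivity))]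
  have hc1 : gaussA c X * gaussV c (s ^ 2 * Y ^ 2) ≠ ∞ :=
    ENNReal.mul_ne_top ENNReal.ofReal_ne_top ENNReal.ofReal_ne_top
  simp only [hst, lintegral_const_mul' _ _ hc1]

/-- Unitary invariance moves w to |w| e₀, so the integral depends on w only through |w|². -/
lemma lintegral_jacWeight {m : ℕ} (c X Y : ℝ) (w : Fin (m + 1) → ℂ) :
    ∫⁻ x : Fin (m + 1) → Fin (m + 1) → ℝ, jacWeight c X Y w x =
      gaussA c X * gaussV c (sqNorm w * Y ^ 2) * (ENNReal.ofReal (((1 + sqNorm w) ^ (m + 1))⁻¹) *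
        ∫⁻ x : Fin (m + 1) → Fin (m + 1) → ℝ, charWeight c (X + Complex.I * Y) (Y * sqNorm w) x) := by
  obtain ⟨U, hU, hUw⟩ := exists_unitary_mulVec_single w
  have hjm : Measurable fun x : Fin (m + 1) → Fin (m + 1) → ℝ => jacWeight c X Y w x :=
    measurable_jacWeight c continuous_const continuous_const continuous_const continuous_id
  have hs : √(∑ i, ‖w i‖ ^ 2) ^ 2 = sqNorm w := Real.sq_sqrt (sqNorm_nonneg w)
  rw [← (measurePreserving_conjCoord hU).lintegral_comp hjm, ← hs, ← lintegral_jacWeight_single]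
  refine lintegral_congr fun x => ?_
  conv_lhs => rw [← hUw]
  rw [jacWeight_conj hU]

end JacobianIntegral

/-! ### The expected count as a one-dimensional integral. -/

section MeanCount

open Matrix

variable {n : ℕ}

lemma measurePreserving_border' : MeasurePreserving
    (fun y : (Fin n → Fin n → ℝ) × (ℝ × (Fin n → ℂ)) => border y.2.1 y.2.2 y.1) volume volume := by
  have h1 : MeasurePreserving (Prod.swap : (Fin n → Fin n → ℝ) × (ℝ × (Fin n → ℂ)) →
      (ℝ × (Fin n → ℂ)) × (Fin n → Fin n → ℝ)) volume volume := Measure.measurePreserving_swap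
  exact measurePreserving_border.comp (volume_preserving_prodAssoc.comp h1)

/-- Along an embedding, integrals are transported without measurability of the integrand, so none is
required of `countIm`. -/
lemma measurableEmbedding_border' : MeasurableEmbedding
    (fun y : (Fin n → Fin n → ℝ) × (ℝ × (Fin n → ℂ)) => border y.2.1 y.2.2 y.1) := by
  refine Measurable.measurableEmbedding measurePreserving_border'.measurable ?_
  rintro ⟨x, a, v⟩ ⟨x', a', v'⟩ h
  have h' := congrArg hermitianOf h
  have h1 : a = a' := by
    have := congrFun (congrFun h' 0) 0
    simpa using this
  have h2 : v = v' := by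
    ext i
    have := congrFun (congrFun h' i.succ) 0
    simpa using this
  have h3 : x = x' := by
    rw [← hermCoord_hermitianOf x, ← hermCoord_hermitianOf x']
    congr 1
    ext i j
    have := congrFun (congrFun h' i.succ) j.succ
    simpa using this
  rw [h1, h2, h3]

/-- Almost surely the count is the cardinality of a fibre of `eigenMap`, to which the area formula
applies. -/
lemma lintegral_countIm_mul_gaussW {γ : ℝ} (hγ : 0 < γ) (c : ℝ) {B : Set ℝ} (hB : MeasurableSet B) :
    ∫⁻ x : Fin (n + 1) → Fin (n + 1) → ℝ, (countIm (deformedGUE γ x) B : ℝ≥0∞) * gaussW c x =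
      ∫⁻ p : (Fin n → Fin n → ℝ) × (ℝ × (Fin n → ℂ)) in {p | eigHeight γ p.2.2 ∈ B},
        ENNReal.ofReal ((1 + sqNorm p.2.2)⁻¹) *
          jacWeight c p.2.1 (eigHeight γ p.2.2) p.2.2 p.1 := by
  have hY : Measurable fun p : (Fin n → Fin n → ℝ) × (ℝ × (Fin n → ℂ)) => eigHeight γ p.2.2 := by
    have : Measurable (sqNorm (n := n)) := continuous_sqNorm.measurable
    unfold eigHeight
    fun_prop
  have hW : Measurable fun y : (Fin n → Fin n → ℝ) × (ℝ × (Fin n → ℂ)) =>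
      gaussW c (border y.2.1 y.2.2 y.1) :=
    (measurable_gaussW c).comp measurePreserving_border'.measurable
  rw [← measurePreserving_border'.lintegral_comp_emb measurableEmbedding_border']
  have hae := measurePreserving_border' (n := n) |>.quasiMeasurePreserving.ae
    (ae_not_hasSmallEigenvector n)
  have hcount : ∀ᵐ y : (Fin n → Fin n → ℝ) × (ℝ × (Fin n → ℂ)),
      (countIm (deformedGUE γ (border y.2.1 y.2.2 y.1)) B : ℝ≥0∞) * gaussW c (border y.2.1 y.2.2 y.1) =
      Measure.count (eigenMap γ ⁻¹' {y} ∩ {p | eigHeight γ p.2.2 ∈ B}) *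
        gaussW c (border y.2.1 y.2.2 y.1) := by
    filter_upwards [hae, ae_det_eigMatrix_ne_zero (n := n) γ] with y h1 h2
    rw [countIm_eq_count hγ h2 h1 B]
  have hC : MeasurableSet {p : (Fin n → Fin n → ℝ) × (ℝ × (Fin n → ℂ)) | eigHeight γ p.2.2 ∈ B} :=
    hY hB
  rw [lintegral_congr_ae hcount, ← lintegral_eigenMap γ hC hW]
  refine lintegral_congr fun p => ?_
  have ht := one_add_sqNorm_pos p.2.2
  rw [gaussW_border, div_eq_mul_inv, mul_comm (‖_‖ ^ 2), ENNReal.ofReal_mul (by positivity), mul_assoc]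
  rfl

lemma measurable_charWeight_param {m : ℕ} (c Y δ : ℝ) :
    Measurable fun p : ℝ × (Fin (m + 1) → Fin (m + 1) → ℝ) =>
      charWeight c (p.1 + Complex.I * Y) δ p.2 := by
  have hdet : ∀ k, Continuous fun p : ℝ × (Fin k → Fin k → ℝ) =>
      charDet (p.1 + Complex.I * Y) p.2 := fun k => by
    have hH : Continuous fun p : ℝ × (Fin k → Fin k → ℝ) => hermitianOf p.2 :=
      continuous_hermitianOf.comp continuous_snd
    have hz : Continuous fun p : ℝ × (Fin k → Fin k → ℝ) => ((p.1 : ℂ) + Complex.I * Y) := by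
      fun_prop
    unfold charDet
    exact ((hz.smul continuous_const).sub hH).matrix_det
  have h2 : Continuous fun p : ℝ × (Fin (m + 1) → Fin (m + 1) → ℝ) =>
      charDet (p.1 + Complex.I * Y) (minorCoord p.2) :=
    (hdet m).comp (continuous_fst.prodMk (continuous_minorCoord.comp continuous_snd))
  have m1 : Measurable fun p : ℝ × (Fin (m + 1) → Fin (m + 1) → ℝ) =>
      ENNReal.ofReal (‖charDet (p.1 + Complex.I * Y) p.2 - Complex.I * δ *
        charDet (p.1 + Complex.I * Y) (minorCoord p.2)‖ ^ 2) :=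
    (ENNReal.continuous_ofReal.comp (((hdet (m + 1)).sub (continuous_const.mul h2)).norm.pow 2)).measurable
  exact m1.mul ((measurable_gaussW c).comp measurable_snd)

/-- The weight of X that splits off in `jacWeight_single` is that of a diagonal entry, which is why
the Gaussian average of the determinants appears. -/
lemma lintegral_gaussA_mul_charWeight {m : ℕ} {c : ℝ} (hc : 0 < c) (Y δ : ℝ) :
    ∫⁻ X : ℝ, gaussA c X * ∫⁻ x : Fin (m + 1) → Fin (m + 1) → ℝ,
      charWeight c (X + Complex.I * Y) δ x =
      ENNReal.ofReal √(2 * Real.pi / c) * partZ c (m + 1) * ENNReal.ofReal (meanCharSq c Y δ m) := by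
  have hZ := partZ_ne_zero_ne_top hc (m + 1)
  have hI : Measurable fun X : ℝ => ∫⁻ x : Fin (m + 1) → Fin (m + 1) → ℝ,
      charWeight c (X + Complex.I * Y) δ x := (measurable_charWeight_param c Y δ).lintegral_prod_right'
  have hF : Measurable fun p : ℂ × ℂ => ENNReal.ofReal (‖p.1 - Complex.I * δ * p.2‖ ^ 2) := by
    fun_prop
  have hlaw : ∀ X : ℝ, ∫⁻ p : ℂ × ℂ, ENNReal.ofReal (‖p.1 - Complex.I * δ * p.2‖ ^ 2)
      ∂(charLaw c (X + Complex.I * Y) m) = (partZ c (m + 1))⁻¹ *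
        ∫⁻ x : Fin (m + 1) → Fin (m + 1) → ℝ, charWeight c (X + Complex.I * Y) δ x := fun X =>
    lintegral_charLaw c _ m hF
  have h := (lintegral_charLaw_norm_sq hc Y δ m).1
  simp only [hlaw] at h
  rw [lintegral_const_mul _ hI, lintegral_diagLaw hc hI] at h
  have hs0 : ENNReal.ofReal √(2 * Real.pi / c) ≠ 0 := by
    rw [ne_eq, ENNReal.ofReal_eq_zero, not_le]; positivity
  rw [← h]
  generalize hJ : (∫⁻ a : ℝ, (∫⁻ x : Fin (m + 1) → Fin (m + 1) → ℝ,
    charWeight c (a + Complex.I * Y) δ x) * gaussA c a) = J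
  calc _ = J := by rw [← hJ]; exact lintegral_congr fun X => mul_comm _ _
    _ = (ENNReal.ofReal √(2 * Real.pi / c) * (ENNReal.ofReal √(2 * Real.pi / c))⁻¹) *
        (partZ c (m + 1) * (partZ c (m + 1))⁻¹) * J := by
        rw [ENNReal.mul_inv_cancel hs0 ENNReal.ofReal_ne_top, ENNReal.mul_inv_cancel hZ.1 hZ.2,
          one_mul, one_mul]
    _ = _ := by ring

/-- The expected count as an integral over the squared norm of the eigenvector. -/
lemma lintegral_countIm_eq {γ : ℝ} (hγ : 0 < γ) {c : ℝ} (hc : 0 < c) (m : ℕ) {B : Set ℝ}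
    (hB : MeasurableSet B) :
    ∫⁻ x : Fin (m + 2) → Fin (m + 2) → ℝ, (countIm (deformedGUE γ x) B : ℝ≥0∞) * gaussW c x =
      ENNReal.ofReal √(2 * Real.pi / c) * partZ c (m + 1) * ENNReal.ofReal (Real.pi ^ (m + 1) / m.factorial) *
      ∫⁻ t in Ioi (0 : ℝ), ENNReal.ofReal (t ^ m) * (B.indicator 1 (γ / (1 + t)) *
        (ENNReal.ofReal (((1 + t) ^ (m + 2))⁻¹) * gaussV c (t * (γ / (1 + t)) ^ 2) *
          ENNReal.ofReal (meanCharSq c (γ / (1 + t)) (γ / (1 + t) * t) m))) := by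
  have hYc : Continuous (eigHeight (n := m + 1) γ) := by
    unfold eigHeight
    exact continuous_const.div (continuous_const.add continuous_sqNorm)
      fun w => (one_add_sqNorm_pos w).ne'
  have hC : MeasurableSet {p : (Fin (m + 1) → Fin (m + 1) → ℝ) × (ℝ × (Fin (m + 1) → ℂ)) |
      eigHeight γ p.2.2 ∈ B} :=
    (hYc.measurable.comp (measurable_snd.comp measurable_snd)) hB
  rw [lintegral_countIm_mul_gaussW hγ c hB, ← lintegral_indicator hC]
  have hind : ∀ p : (Fin (m + 1) → Fin (m + 1) → ℝ) × (ℝ × (Fin (m + 1) → ℂ)),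
      {p : (Fin (m + 1) → Fin (m + 1) → ℝ) × (ℝ × (Fin (m + 1) → ℂ)) |
        eigHeight γ p.2.2 ∈ B}.indicator (fun p => ENNReal.ofReal ((1 + sqNorm p.2.2)⁻¹) *
          jacWeight c p.2.1 (eigHeight γ p.2.2) p.2.2 p.1) p =
      B.indicator 1 (eigHeight γ p.2.2) * (ENNReal.ofReal ((1 + sqNorm p.2.2)⁻¹) *
          jacWeight c p.2.1 (eigHeight γ p.2.2) p.2.2 p.1) := by
    intro p
    by_cases h : eigHeight γ p.2.2 ∈ B
    · rw [indicator_of_mem (by exact h), indicator_of_mem h]; simp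
    · rw [indicator_of_notMem (by exact h), indicator_of_notMem h]; simp
  have hB1 : Measurable fun w : Fin (m + 1) → ℂ => B.indicator (1 : ℝ → ℝ≥0∞) (eigHeight γ w) :=
    (measurable_one.indicator hB).comp hYc.measurable
  have hs1 : Measurable fun w : Fin (m + 1) → ℂ => ENNReal.ofReal ((1 + sqNorm w)⁻¹) := by
    have : Measurable (sqNorm (n := m + 1)) := continuous_sqNorm.measurable
    fun_prop
  have hj : Measurable fun p : (Fin (m + 1) → Fin (m + 1) → ℝ) × (ℝ × (Fin (m + 1) → ℂ)) =>
      jacWeight c p.2.1 (eigHeight γ p.2.2) p.2.2 p.1 :=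
    measurable_jacWeight c (by fun_prop) (hYc.comp (by fun_prop)) (by fun_prop) (by fun_prop)
  have hw2 : Measurable fun p : (Fin (m + 1) → Fin (m + 1) → ℝ) × (ℝ × (Fin (m + 1) → ℂ)) => p.2.2 :=
    by fun_prop
  have htot : Measurable fun p : (Fin (m + 1) → Fin (m + 1) → ℝ) × (ℝ × (Fin (m + 1) → ℂ)) =>
      B.indicator 1 (eigHeight γ p.2.2) * (ENNReal.ofReal ((1 + sqNorm p.2.2)⁻¹) *
          jacWeight c p.2.1 (eigHeight γ p.2.2) p.2.2 p.1) :=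
    (hB1.comp hw2).mul ((hs1.comp hw2).mul hj)
  simp only [hind]
  rw [Measure.volume_eq_prod, lintegral_prod_symm _ htot.aemeasurable]
  have hin : Measurable fun q : ℝ × (Fin (m + 1) → ℂ) =>
      ∫⁻ x : Fin (m + 1) → Fin (m + 1) → ℝ, B.indicator 1 (eigHeight γ q.2) *
        (ENNReal.ofReal ((1 + sqNorm q.2)⁻¹) * jacWeight c q.1 (eigHeight γ q.2) q.2 x) :=
    htot.lintegral_prod_left'
  rw [Measure.volume_eq_prod, lintegral_prod_symm _ hin.aemeasurable]
  have hw : ∀ w : Fin (m + 1) → ℂ, ∫⁻ X : ℝ, ∫⁻ x : Fin (m + 1) → Fin (m + 1) → ℝ,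
      B.indicator 1 (eigHeight γ w) *
        (ENNReal.ofReal ((1 + sqNorm w)⁻¹) * jacWeight c X (eigHeight γ w) w x) =
      (fun t : ℝ => ENNReal.ofReal √(2 * Real.pi / c) * partZ c (m + 1) * (B.indicator 1 (γ / (1 + t)) *
        (ENNReal.ofReal (((1 + t) ^ (m + 2))⁻¹) * gaussV c (t * (γ / (1 + t)) ^ 2) *
          ENNReal.ofReal (meanCharSq c (γ / (1 + t)) (γ / (1 + t) * t) m)))) (∑ i, ‖w i‖ ^ 2) := by
    intro w
    have hjX : ∀ X : ℝ, Measurable fun x : Fin (m + 1) → Fin (m + 1) → ℝ =>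
        jacWeight c X (eigHeight γ w) w x := fun X =>
      measurable_jacWeight c continuous_const continuous_const continuous_const continuous_id
    have e1 : ∀ X : ℝ, ∫⁻ x : Fin (m + 1) → Fin (m + 1) → ℝ, B.indicator 1 (eigHeight γ w) *
        (ENNReal.ofReal ((1 + sqNorm w)⁻¹) * jacWeight c X (eigHeight γ w) w x) =
        B.indicator 1 (eigHeight γ w) * (ENNReal.ofReal ((1 + sqNorm w)⁻¹) *
          (gaussV c (sqNorm w * eigHeight γ w ^ 2) * ENNReal.ofReal (((1 + sqNorm w) ^ (m + 1))⁻¹))) *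
        (gaussA c X * ∫⁻ x : Fin (m + 1) → Fin (m + 1) → ℝ,
          charWeight c (X + Complex.I * eigHeight γ w) (eigHeight γ w * sqNorm w) x) := by
      intro X
      rw [lintegral_const_mul _ ((hjX X).const_mul _), lintegral_const_mul _ (hjX X),
        lintegral_jacWeight]
      ring
    have hm : Measurable fun X : ℝ => gaussA c X * ∫⁻ x : Fin (m + 1) → Fin (m + 1) → ℝ,
          charWeight c (X + Complex.I * eigHeight γ w) (eigHeight γ w * sqNorm w) x :=
      (measurable_gaussA c).mul (measurable_charWeight_param c _ _).lintegral_prod_right'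
    simp only [e1]
    rw [lintegral_const_mul _ hm, lintegral_gaussA_mul_charWeight hc]
    have ht := one_add_sqNorm_pos w
    have e2 : ENNReal.ofReal (((1 + sqNorm w) ^ (m + 2))⁻¹) = ENNReal.ofReal ((1 + sqNorm w)⁻¹) *
        ENNReal.ofReal (((1 + sqNorm w) ^ (m + 1))⁻¹) := by
      rw [← ENNReal.ofReal_mul (by positivity), ← mul_inv]
      congr 2; ring
    change _ = ENNReal.ofReal √(2 * Real.pi / c) * partZ c (m + 1) *
      (B.indicator 1 (γ / (1 + sqNorm w)) *
        (ENNReal.ofReal (((1 + sqNorm w) ^ (m + 2))⁻¹) *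
          gaussV c (sqNorm w * (γ / (1 + sqNorm w)) ^ 2) *
          ENNReal.ofReal (meanCharSq c (γ / (1 + sqNorm w)) (γ / (1 + sqNorm w) * sqNorm w) m)))
    rw [e2]
    unfold eigHeight
    ring
  simp only [hw]
  have hmean : Measurable fun t : ℝ => meanCharSq c (γ / (1 + t)) (γ / (1 + t) * t) m := by
    unfold meanCharSq lagMass lagWeight
    fun_prop
  have hphi : Measurable fun t : ℝ => B.indicator (1 : ℝ → ℝ≥0∞) (γ / (1 + t)) *
        (ENNReal.ofReal (((1 + t) ^ (m + 2))⁻¹) * gaussV c (t * (γ / (1 + t)) ^ 2) *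
          ENNReal.ofReal (meanCharSq c (γ / (1 + t)) (γ / (1 + t) * t) m)) := by
    have h1 : Measurable fun t : ℝ => B.indicator (1 : ℝ → ℝ≥0∞) (γ / (1 + t)) :=
      (measurable_one.indicator hB).comp (by fun_prop)
    have h2 := measurable_gaussV c
    fun_prop
  rw [lintegral_sum_norm_sq m (f := fun t : ℝ => ENNReal.ofReal √(2 * Real.pi / c) * partZ c (m + 1) *
      (B.indicator 1 (γ / (1 + t)) *
        (ENNReal.ofReal (((1 + t) ^ (m + 2))⁻¹) * gaussV c (t * (γ / (1 + t)) ^ 2) *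
          ENNReal.ofReal (meanCharSq c (γ / (1 + t)) (γ / (1 + t) * t) m)))) (hphi.const_mul _)]
  have e3 : ∀ t : ℝ, ENNReal.ofReal (t ^ m) * (ENNReal.ofReal √(2 * Real.pi / c) * partZ c (m + 1) *
      (B.indicator 1 (γ / (1 + t)) *
        (ENNReal.ofReal (((1 + t) ^ (m + 2))⁻¹) * gaussV c (t * (γ / (1 + t)) ^ 2) *
          ENNReal.ofReal (meanCharSq c (γ / (1 + t)) (γ / (1 + t) * t) m)))) =
      ENNReal.ofReal √(2 * Real.pi / c) * partZ c (m + 1) * (ENNReal.ofReal (t ^ m) *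
      (B.indicator 1 (γ / (1 + t)) *
        (ENNReal.ofReal (((1 + t) ^ (m + 2))⁻¹) * gaussV c (t * (γ / (1 + t)) ^ 2) *
          ENNReal.ofReal (meanCharSq c (γ / (1 + t)) (γ / (1 + t) * t) m)))) := fun t => by ring
  have hm3 : Measurable fun t : ℝ => ENNReal.ofReal (t ^ m) *
      (B.indicator (1 : ℝ → ℝ≥0∞) (γ / (1 + t)) *
        (ENNReal.ofReal (((1 + t) ^ (m + 2))⁻¹) * gaussV c (t * (γ / (1 + t)) ^ 2) *
          ENNReal.ofReal (meanCharSq c (γ / (1 + t)) (γ / (1 + t) * t) m))) :=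
    Measurable.mul (by fun_prop) hphi
  simp only [e3]
  rw [lintegral_const_mul _ hm3]
  ring

end MeanCount

/-! ### Identification of the closed-form density. -/

section MeanDensity

lemma lintegral_Ioi_eq_lintegral_Ioo {γ : ℝ} (hγ : 0 < γ) (F : ℝ → ℝ≥0∞) :
    ∫⁻ t in Ioi (0 : ℝ), F t =
      ∫⁻ Y in Ioo 0 γ, ENNReal.ofReal (γ / Y ^ 2) * F (γ / Y - 1) := by
  have him : (fun Y : ℝ => γ / Y - 1) '' Ioo 0 γ = Ioi 0 := by
    ext t
    simp only [mem_image, mem_Ioo, mem_Ioi]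
    constructor
    · rintro ⟨Y, ⟨h0, h1⟩, rfl⟩
      rw [sub_pos, one_lt_div h0]
      exact h1
    · intro ht
      refine ⟨γ / (1 + t), ⟨by positivity, ?_⟩, ?_⟩
      · rw [div_lt_iff₀ (by positivity)]
        nlinarith
      · field_simp
        ring
  have hd : ∀ Y ∈ Ioo 0 γ, HasDerivWithinAt (fun Y : ℝ => γ / Y - 1) (-(γ / Y ^ 2)) (Ioo 0 γ) Y := by
    intro Y hY
    have h := ((hasDerivAt_inv hY.1.ne').const_mul γ).sub_const 1
    exact (h.congr_deriv (by rw [div_eq_mul_inv]; ring)).hasDerivWithinAt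
  have hinj : InjOn (fun Y : ℝ => γ / Y - 1) (Ioo 0 γ) := by
    intro a ha b hb hab
    have h : γ / a = γ / b := by simpa using hab
    rw [div_eq_div_iff ha.1.ne' hb.1.ne'] at h
    exact (mul_left_cancel₀ hγ.ne' h).symm
  rw [← him, lintegral_image_eq_lintegral_abs_deriv_mul measurableSet_Ioo hd hinj]
  refine setLIntegral_congr_fun measurableSet_Ioo fun Y hY => ?_
  have := hY.1
  simp only [abs_neg]
  rw [abs_of_pos (by positivity)]

/-- The factor c^(m+1)/m! with c = m + 2 clears the norms (m + 1)!/c^(m+1) and m!/c^m. The two index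
ranges agree because `lagMass 0` is an empty sum. -/
lemma meanCharSq_eq_densityIm {γ : ℝ} (m : ℕ) (Y : ℝ) :
    ((m + 2 : ℕ) : ℝ) ^ (m + 1) / m.factorial * ((γ - Y) ^ m / γ ^ (m + 1) *
      Real.exp (-((m + 2 : ℕ) : ℝ) * (Y * (γ - Y))) *
        meanCharSq ((m + 2 : ℕ) : ℝ) Y (γ - Y) m) =
      ((m + 2 : ℕ) : ℝ) * densityIm (m + 2) γ Y := by
  have hs : ∑ k ∈ Finset.range (m + 2), lagMass k (((m + 2 : ℕ) : ℝ) * Y ^ 2) =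
      ∑ k ∈ Finset.range (m + 1), lagMass (k + 1) (((m + 2 : ℕ) : ℝ) * Y ^ 2) := by
    rw [Finset.sum_range_succ' _ (m + 1)]
    simp [lagMass]
  have h1 : m + 2 - 1 = m + 1 := rfl
  have h2 : m + 2 - 2 = m := rfl
  rw [densityIm, hs, h1, h2, meanCharSq, hermiteNorm, hermiteNorm, neg_mul, Nat.factorial_succ]
  have hc : ((m + 2 : ℕ) : ℝ) ≠ 0 := by positivity
  have hm : (m.factorial : ℝ) ≠ 0 := by positivity
  have hcm : ((m + 2 : ℕ) : ℝ) - 1 = m + 1 := by push_cast; ring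
  have hf : (((m + 1) * m.factorial : ℕ) : ℝ) = (m + 1) * m.factorial := by push_cast; rfl
  rw [hcm, hf]
  generalize ((m + 2 : ℕ) : ℝ) = c at hc
  generalize lagMass (m + 2) (c * Y ^ 2) = A
  generalize lagMass (m + 1) (c * Y ^ 2) = A'
  generalize (∑ k ∈ Finset.range (m + 1), lagMass (k + 1) (c * Y ^ 2)) = S
  generalize Real.exp (-(c * (Y * (γ - Y)))) = E
  have e1 : c ^ (m + 1) / m.factorial * ((m + 1) * m.factorial / c ^ (m + 1)) = (m + 1 : ℝ) := by
    field_simp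
  have e2 : c ^ (m + 1) / m.factorial * (m.factorial / c ^ m) = c := by
    field_simp
    ring
  calc _ = (γ - Y) ^ m / γ ^ (m + 1) * E *
        ((c ^ (m + 1) / m.factorial * ((m + 1) * m.factorial / c ^ (m + 1))) * A +
        (c ^ (m + 1) / m.factorial * (m.factorial / c ^ m)) * ((γ - Y) ^ 2 * A' -
          2 * (γ - Y) * Y * S)) := by ring
    _ = _ := by rw [e1, e2]; field_simp; ring

lemma meanCountIm_eq_partZ_inv_mul (N : ℕ) (γ : ℝ) (B : Set ℝ) :
    meanCountIm N γ B = (partZ N N)⁻¹ *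
      ∫⁻ x : Fin N → Fin N → ℝ, (countIm (deformedGUE γ x) B : ℝ≥0∞) * gaussW N x := by
  have hw : gueWeight N = gaussW (N : ℝ) := rfl
  rw [meanCountIm, gue, hw, lintegral_smul_measure, smul_eq_mul,
    -- The weight is finite everywhere, so no measurability of `countIm` is required.
    lintegral_withDensity_eq_lintegral_mul_non_measurable _ (measurable_gaussW (N : ℝ))
      (ae_of_all _ fun x => ENNReal.ofReal_lt_top)]
  congr 1
  exact lintegral_congr fun x => mul_comm (gaussW (N : ℝ) x) _

/-- The sign is not visible in the closed form; it is inherited from the mean square `meanCharSq`.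
-/
lemma densityIm_nonneg {N : ℕ} (hN : 2 ≤ N) {γ Y : ℝ} (hγ : 0 < γ) (hY : Y ≤ γ) :
    0 ≤ densityIm N γ Y := by
  obtain ⟨m, rfl⟩ := Nat.exists_eq_add_of_le' hN
  have hc : (0 : ℝ) < ((m + 2 : ℕ) : ℝ) := by positivity
  refine nonneg_of_mul_nonneg_right (a := ((m + 2 : ℕ) : ℝ)) ?_ hc
  rw [← meanCharSq_eq_densityIm]
  have := (lintegral_charLaw_norm_sq hc Y (γ - Y) m).2
  have := sub_nonneg.2 hY
  positivity

lemma meanCountIm_eq {γ : ℝ} (hγ : 0 < γ) {N : ℕ} (hN : 2 ≤ N) {B : Set ℝ} (hB : MeasurableSet B) :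
    meanCountIm N γ B = N * ∫⁻ Y in B ∩ Ioo 0 γ, ENNReal.ofReal (densityIm N γ Y) := by
  obtain ⟨m, rfl⟩ := Nat.exists_eq_add_of_le' hN
  have hc : (0 : ℝ) < ((m + 2 : ℕ) : ℝ) := by positivity
  rw [meanCountIm_eq_partZ_inv_mul, lintegral_countIm_eq hγ hc m hB, lintegral_Ioi_eq_lintegral_Ioo hγ]
  have hcN : ((m + 2 : ℕ) : ℝ≥0∞) = ENNReal.ofReal ((m + 2 : ℕ) : ℝ) :=
    (ENNReal.ofReal_natCast _).symm
  rw [hcN]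
  have hred : ∀ Y ∈ Ioo 0 γ, ENNReal.ofReal (((m + 2 : ℕ) : ℝ) ^ (m + 1) / m.factorial) *
      (ENNReal.ofReal (γ / Y ^ 2) * (ENNReal.ofReal ((γ / Y - 1) ^ m) *
        (B.indicator 1 (γ / (1 + (γ / Y - 1))) *
          (ENNReal.ofReal (((1 + (γ / Y - 1)) ^ (m + 2))⁻¹) *
            gaussV ((m + 2 : ℕ) : ℝ) ((γ / Y - 1) * (γ / (1 + (γ / Y - 1))) ^ 2) *
          ENNReal.ofReal (meanCharSq ((m + 2 : ℕ) : ℝ) (γ / (1 + (γ / Y - 1)))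
            (γ / (1 + (γ / Y - 1)) * (γ / Y - 1)) m))))) =
      ENNReal.ofReal ((m + 2 : ℕ) : ℝ) *
        B.indicator (fun Y => ENNReal.ofReal (densityIm (m + 2) γ Y)) Y := by
    rintro Y ⟨h0, h1⟩
    have hg := sub_pos.2 h1
    have a1 : 1 + (γ / Y - 1) = γ / Y := by ring
    have a2 : γ / (γ / Y) = Y := by field_simp
    have a3 : (γ / Y - 1) * Y ^ 2 = Y * (γ - Y) := by field_simp
    have a4 : Y * (γ / Y - 1) = γ - Y := by field_simp
    have a5 : γ / Y - 1 = (γ - Y) / Y := by field_simp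
    rw [a1, a2, a3, a4]
    by_cases hYB : Y ∈ B
    · rw [indicator_of_mem hYB, indicator_of_mem hYB, ← ENNReal.ofReal_mul hc.le,
        ← meanCharSq_eq_densityIm, gaussV, Pi.one_apply, one_mul, a5]
      have := (lintegral_charLaw_norm_sq hc Y (γ - Y) m).2
      rw [← ENNReal.ofReal_mul (by positivity), ← ENNReal.ofReal_mul (by positivity),
        ← ENNReal.ofReal_mul (by positivity), ← ENNReal.ofReal_mul (by positivity),
        ← ENNReal.ofReal_mul (by positivity)]
      congr 1
      generalize meanCharSq _ _ _ _ = M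
      generalize Real.exp _ = E
      -- All powers of Y cancel: two from the substitution, m from t^m, against m + 2 from (1 +
      -- t)^(m+2).
      have hq : γ / Y ^ 2 * ((γ - Y) / Y) ^ m * ((γ / Y) ^ (m + 2))⁻¹ = (γ - Y) ^ m / γ ^ (m + 1) := by
        rw [div_pow, div_pow, pow_succ Y (m + 1), pow_succ Y m]
        field_simp
        ring
      rw [← hq]
      ring
    · simp [indicator_of_notMem hYB]
  -- The constants assemble to the partition function of size N, by its recursion in the size.
  have hK : ENNReal.ofReal √(2 * Real.pi / ((m + 2 : ℕ) : ℝ)) * partZ ((m + 2 : ℕ) : ℝ) (m + 1) *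
      ENNReal.ofReal (Real.pi ^ (m + 1) / m.factorial) =
      partZ ((m + 2 : ℕ) : ℝ) (m + 2) *
        ENNReal.ofReal (((m + 2 : ℕ) : ℝ) ^ (m + 1) / m.factorial) := by
    rw [partZ_succ hc (m + 1), mul_right_comm, mul_right_comm _ (partZ _ _),
      ← ENNReal.ofReal_mul (by positivity), ← ENNReal.ofReal_mul (by positivity)]
    congr 2
    rw [div_pow]
    field_simp
  have hZ := partZ_ne_zero_ne_top hc (m + 2)
  rw [hK, mul_assoc, ← mul_assoc, ENNReal.inv_mul_cancel hZ.1 hZ.2, one_mul,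
    ← lintegral_const_mul' _ _ ENNReal.ofReal_ne_top, setLIntegral_congr_fun measurableSet_Ioo hred,
    lintegral_const_mul' _ _ ENNReal.ofReal_ne_top, lintegral_indicator hB,
    Measure.restrict_restrict hB]

lemma continuous_densityIm (N : ℕ) (γ : ℝ) : Continuous (densityIm N γ) := by
  unfold densityIm lagMass lagWeight
  fun_prop

lemma isMeanDensityIm_densityIm {γ : ℝ} (hγ : 0 < γ) {N : ℕ} (hN : 2 ≤ N) :
    IsMeanDensityIm N γ (densityIm N γ) where
  continuousOn := (continuous_densityIm N γ).continuousOn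
  nonneg _ hY := densityIm_nonneg hN hγ hY.2.le
  meanCount_eq _ hB := meanCountIm_eq hγ hN hB

end MeanDensity

/-! ### Uniqueness of the continuous density. -/

section Uniqueness

/-- Equal integrals over all Borel sets give equality almost everywhere, and continuity upgrades it
to every point of the open interval. -/
lemma IsMeanDensityIm.eqOn {N : ℕ} (hN : N ≠ 0) {γ : ℝ} {ρ σ : ℝ → ℝ} (hρ : IsMeanDensityIm N γ ρ)
    (hσ : IsMeanDensityIm N γ σ) : EqOn ρ σ (Ioo 0 γ) := by
  refine Measure.eqOn_open_of_ae_eq (μ := volume) ?_ isOpen_Ioo hρ.continuousOn hσ.continuousOn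
  have m1 := (hρ.continuousOn.aemeasurable (μ := volume) measurableSet_Ioo).ennreal_ofReal
  have m2 := (hσ.continuousOn.aemeasurable (μ := volume) measurableSet_Ioo).ennreal_ofReal
  have h := ae_eq_of_forall_setLIntegral_eq_of_sigmaFinite₀ m1 m2 fun B hB _ => by
    have h1 := (hρ.meanCount_eq B hB).symm.trans (hσ.meanCount_eq B hB)
    rw [Measure.restrict_restrict hB]
    exact (ENNReal.mul_right_inj (by exact_mod_cast hN) (ENNReal.natCast_ne_top N)).1 h1
  filter_upwards [h, ae_restrict_mem measurableSet_Ioo] with Y hY hmem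
  exact (ENNReal.ofReal_eq_ofReal_iff (hρ.nonneg Y hmem) (hσ.nonneg Y hmem)).1 hY

end Uniqueness

end

theorem theorem2p1 (γ : ℝ) (hγ : 0 < γ) :
    -- the mean density of imaginary parts exists
    (∀ N : ℕ, 2 ≤ N → ∃ ρ : ℝ → ℝ, IsMeanDensityIm N γ ρ) ∧
    -- large-deviation asymptotics
    (∀ ρ : ℕ → ℝ → ℝ, (∀ N : ℕ, 2 ≤ N → IsMeanDensityIm N γ (ρ N)) →
      ∀ ε : ℝ, 0 < ε → ε ≤ 1 → ∀ y : ℝ, 0 < y → (ε = 1 → y < γ) →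
        -- leading order, with no exceptions
        ((fun N : ℕ => ρ N (scaledY ε y N) -
            1 / √(N : ℝ) * prefactorΨ γ (scaledY ε y N) *
              Real.exp (-(N : ℝ) * rateΦ γ (scaledY ε y N)))
          =o[atTop] fun N : ℕ =>
            1 / √(N : ℝ) * (scaledY ε y N) ^ (-(3 / 2) : ℝ) *
              Real.exp (-(N : ℝ) * rateΦ γ (scaledY ε y N))) ∧
        -- ratio tending to one, away from the degenerate zeros of the prefactor
        ((γ = 1 → 2 / 3 < ε) → ¬ (1 < γ ∧ ε = 1 ∧ y = yMax γ) →
          IsEquivalent atTop (fun N : ℕ => ρ N (scaledY ε y N))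
            (fun N : ℕ => 1 / √(N : ℝ) * prefactorΨ γ (scaledY ε y N) *
              Real.exp (-(N : ℝ) * rateΦ γ (scaledY ε y N))))) ∧
    -- shape of the rate function
    ContDiffOn ℝ ((⊤ : ℕ∞) : WithTop ℕ∞) (rateΦ γ) (Ico 0 γ) ∧
    (∀ Y ∈ Ico 0 γ, 0 ≤ rateΦ γ Y) ∧
    rateΦ γ 0 = 0 ∧
    (γ ≤ 1 → StrictMonoOn (rateΦ γ) (Ico 0 γ)) ∧
    (1 < γ →
      0 < yMax γ ∧ yMax γ < yMin γ ∧ yMin γ < γ ∧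
      IsLocalMin (rateΦ γ) (yMin γ) ∧ rateΦ γ (yMin γ) = 0 ∧
      IsLocalMax (rateΦ γ) (yMax γ) ∧
      ∀ Y ∈ Ioo 0 γ, IsLocalExtr (rateΦ γ) Y → Y = yMin γ ∨ Y = yMax γ) := by
  refine ⟨fun N hN => ⟨_, isMeanDensityIm_densityIm hγ hN⟩, ?_,
    fun Y hY => (contDiffAt_rateΦ hγ hY.2).contDiffWithinAt, fun Y hY => rateΦ_nonneg hγ hY,
    rateΦ_zero hγ, fun h => strictMonoOn_rateΦ hγ h, fun h => ⟨yMax_pos h, yMax_lt_yMin h, yMin_lt h,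
      isLocalMin_rateΦ h, rateΦ_yMin h, isLocalMax_rateΦ h,
      fun Y hY he => eq_yMin_or_yMax_of_isLocalExtr h hY he⟩⟩
  intro ρ hρ ε hε hε1 y hy hyγ
  obtain ⟨γ', hγ', hle⟩ := scaledY_eventually_le hγ hε1 hyγ
  have hpos : ∀ᶠ N : ℕ in atTop, 0 < scaledY ε y N := by
    filter_upwards [eventually_gt_atTop 0] with N hN using scaledY_pos hy hN
  -- By uniqueness an arbitrary mean density agrees with the closed form at the points Y_N, which
  -- eventually lie in (0, γ).
  have heq : ∀ᶠ N : ℕ in atTop, densityIm N γ (scaledY ε y N) = ρ N (scaledY ε y N) := by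
    filter_upwards [hpos, hle, eventually_ge_atTop 2] with N h0 h1 hN
    exact (isMeanDensityIm_densityIm hγ hN).eqOn (by omega) (hρ N hN) ⟨h0, h1.trans_lt hγ'⟩
  constructor
  · refine (densityIm_sub_isLittleO hγ hpos hγ' hle (tendsto_mul_scaledY hε hy)).congr' ?_
      EventuallyEq.rfl
    filter_upwards [heq] with N h
    rw [h]
  · intro hd1 hd2
    exact (densityIm_scaledY_isEquivalent hγ hε hε1 hy hyγ hd1 hd2).congr_left heq
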